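/- Let $h$ be a $C^\infty$ real function on an open neighbourhood $U$ of $(0,0)\in\mathbb R^2$ with $$h(u,v)=u^3-c\,uv^2+O\big(|(u,v)|^4\big),\qquad c\in\{1,3\},$$ so that the surface $\alpha(u,v)=(u,v,h(u,v))$ has a Euclidean flat umbilic at $\alpha(0,0)$ and is written in the special chart with $\varepsilon=-1$. Off the parabolic set $d:=h_{uu}h_{vv}-h_{uv}^2=0$ let $\nu=|d|^{-1/4}(\alpha_u\times\alpha_v)$ be the co-normal, $\xi$ the affine normal ($\langle\nu,\xi\rangle=1$, $\langle\xi,\nu_u\rangle=\langle\xi,\nu_v\rangle=0$), and $\mathrm{III}=\langle D\nu,D\xi\rangle=l\,du^2+2m\,du\,dv+n\,dv^2$. The affine asymptotic lines are the regular $C^1$ curves, off the parabolic set, with $\mathrm{III}=0$ on their tangent lines. Write $l=-\frac{A}{16d^2}$, $m=-\frac{B}{16d^2}$, $n=-\frac{C}{16d^2}$, where $A,B,C$ are the universal polynomials in the partial derivatives of $h$ of orders 2 to 4 thus obtained, and call $A\,du^2+2B\,du\,dv+C\,dv^2=0$ the extended equation, with discriminant function $\delta=4(B^2-AC)$. Then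 there is $\rho>0$, with the open disc $D_\rho=\{u^2+v^2<\rho^2\}$ contained in $U$, such that: 1. for $p\in D_\rho$: $\delta(p)=0$ if and only if $p=(0,0)$; 2. $D_\rho\setminus\{0\}$ contains no parabolic point, and there the extended equation and $\mathrm{III}=0$ have the same solutions; 3. let $\varphi(r,t)=(r\cos t,r\sin t)$. There are $C^\infty$ functions $\bar A,\bar B,\bar C$ on $[0,\rho)\times\mathbb R$ such that the pull-back by $\varphi$ of the form $A\,du^2+2B\,du\,dv+C\,dv^2$ is $r^2(\bar A\,dr^2+2r\bar B\,dr\,dt+r^2\bar C\,dt^2)$. The solutions of $\bar A\,dr^2+2r\bar B\,dr\,dt+r^2\bar C\,dt^2=0$ at each point of $[0,\rho)\times\mathbb R$ are exactly the multiples of $Y_1$ and the multiples of $Y_2$, where $Y_1,Y_2$ are $C^\infty$ vector fields on $[0,\rho)\times\mathbb R$ without zeros, with $\dot t>0$. For $0<r<\rho$ the fields $Y_1,Y_2$ are linearly independent, with $\dot r<0$ for $Y_1$ and $\dot r>0$ for $Y_2$; 4. $Y_1,Y_2$ restricted to $r>0$ push forward under $\varphi$ to vector fields $X_1,X_2$ on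 $D_\rho\setminus\{0\}$. A curve in $D_\rho\setminus\{0\}$, defined on an open interval, is an affine asymptotic line if and only if it is a regular $C^1$ curve which is everywhere tangent to $X_1$ or everywhere tangent to $X_2$; 5. $X_1$ has a stable topological focus at the origin: each trajectory starting in $D_\rho\setminus\{0\}$ stays there for all future time, tends to $0$, and its polar angle tends to $+\infty$. $X_2$ has an unstable topological focus: each trajectory through a point of $D_\rho\setminus\{0\}$ stays there for all past time, tends to $0$ as time tends to $-\infty$, and its polar angle then tends to $-\infty$. Moreover one homeomorphism $H$ from $D_\rho$ onto the unit disc, with $H(0)=0$, carries the oriented trajectories of $X_1$ and of $X_2$ in $D_\rho\setminus\{0\}$ respectively to those of the linear foci $(-x-y,\;x-y)$ and $(x-y,\;x+y)$ in the punctured unit disc, in both directions and up to orientation-preserving continuous changes of time. So the affine asymptotic lines near the origin are topologically two transversal families of spirals, one a stable and the other an unstable focus. -/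

import Mathlib

open Set Filter Topology Asymptotics Matrix
open scoped ContDiff

noncomputable section

namespace BlaschkeAsymptotic

/-! ### Affine differential geometry of a parametrized surface -/

/-- Partial derivative with respect to the first coordinate `u`. -/
def pdu {F : Type*} [NormedAddCommGroup F] [NormedSpace ℝ F] (f : ℝ × ℝ → F) (p : ℝ × ℝ) : F :=
  fderiv ℝ f p (1, 0)

/-- Partial derivative with respect to the second coordinate `v`. -/
def pdv {F : Type*} [NormedAddCommGroup F] [NormedSpace ℝ F] (f : ℝ × ℝ → F) (p : ℝ × ℝ) : F :=
  fderiv ℝ f p (0, 1)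

/-- The determinant `|a, b, c|` of three vectors of `ℝ³`. -/
def det3 (a b c : Fin 3 → ℝ) : ℝ := Matrix.det (Matrix.of ![a, b, c])

/-- `L N - M ^ 2` where `L = |α_u, α_v, α_uu|`, `M = |α_u, α_v, α_uv|`, `N = |α_u, α_v, α_vv|`.
The parabolic set of `α` is its zero set. -/
def parabolicFun (α : ℝ × ℝ → Fin 3 → ℝ) (p : ℝ × ℝ) : ℝ :=
  det3 (pdu α p) (pdv α p) (pdu (pdu α) p) * det3 (pdu α p) (pdv α p) (pdv (pdv α) p)
    - det3 (pdu α p) (pdv α p) (pdv (pdu α) p) ^ 2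

/-- The co-normal vector `ν = |L N - M²| ^ (-1/4) • (α_u × α_v)`. -/
def conormal (α : ℝ × ℝ → Fin 3 → ℝ) (p : ℝ × ℝ) : Fin 3 → ℝ :=
  |parabolicFun α p| ^ (-(1 / 4) : ℝ) • (crossProduct (pdu α p) (pdv α p))

/-- The affine normal `ξ`: at a non-parabolic point of a smooth surface it is the only vector with
`⟨ν, ξ⟩ = 1` and `⟨ξ, ν_u⟩ = ⟨ξ, ν_v⟩ = 0`. -/
def affineNormal (α : ℝ × ℝ → Fin 3 → ℝ) (p : ℝ × ℝ) : Fin 3 → ℝ :=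
  (conormal α p ⬝ᵥ crossProduct (pdu (conormal α) p) (pdv (conormal α) p))⁻¹ •
    crossProduct (pdu (conormal α) p) (pdv (conormal α) p)

/-- The affine third fundamental form `III(p; w) = ⟨Dν(p; w), Dξ(p; w)⟩`, which is
`l a² + 2 m a b + n b²` for `w = (a, b)`. -/
def affineIII (α : ℝ × ℝ → Fin 3 → ℝ) (p w : ℝ × ℝ) : ℝ :=
  fderiv ℝ (conormal α) p w ⬝ᵥ fderiv ℝ (affineNormal α) p w

/-- A regular `C¹` curve in the parameter plane, defined on the set `I` of times. -/
def IsRegularCurve (I : Set ℝ) (c : ℝ → ℝ × ℝ) : Prop :=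
  (∀ s ∈ I, DifferentiableAt ℝ c s ∧ deriv c s ≠ 0) ∧ ContinuousOn (deriv c) I

/-- Affine (Blaschke) asymptotic lines, as curves in the parameter plane: regular curves, off the
parabolic set, whose tangent directions annihilate the affine third fundamental form. -/
def IsAffineAsymptoticLine (α : ℝ × ℝ → Fin 3 → ℝ) (I : Set ℝ) (c : ℝ → ℝ × ℝ) : Prop :=
  IsRegularCurve I c ∧ ∀ s ∈ I, parabolicFun α (c s) ≠ 0 ∧ affineIII α (c s) (deriv c s) = 0

/-! ### The extended binary differential equation in a Monge chart -/

/-- The Monge chart `α(u, v) = (u, v, h(u, v))`. -/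
def monge (h : ℝ × ℝ → ℝ) (p : ℝ × ℝ) : Fin 3 → ℝ := ![p.1, p.2, h p]

/-- The numerator `A` of `l`: `l = -(1/16) A / (h_uu h_vv - h_uv²)²`. -/
def extA (h : ℝ × ℝ → ℝ) (p : ℝ × ℝ) : ℝ :=
  let huu := pdu (pdu h) p;
  let huv := pdv (pdu h) p;
  let hvv := pdv (pdv h) p;
  let huuu := pdu (pdu (pdu h)) p;
  let huuv := pdv (pdu (pdu h)) p;
  let huvv := pdv (pdv (pdu h)) p;
  let hvvv := pdv (pdv (pdv h)) p;
  let huuuu := pdu (pdu (pdu (pdu h))) p;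
  let huuuv := pdv (pdu (pdu (pdu h))) p;
  let huuvv := pdv (pdv (pdu (pdu h))) p;
  -4 * (hvv * huuuu - 2 * huv * huuuv) * (huu * hvv - huv ^ 2)
    - 4 * huu * (huu * hvv - huv ^ 2) * huuvv
    + 7 * hvv ^ 2 * huuu ^ 2 + 3 * huu ^ 2 * huvv ^ 2
    + (-28 * huuv * huv * hvv + 2 * (huu * hvv + 8 * huv ^ 2) * huvv
        - 4 * hvvv * huu * huv) * huuu
    + 12 * (huu * hvv + huv ^ 2) * huuv ^ 2
    + 4 * (huu ^ 2 * hvvv - 6 * huu * huv * huvv) * huuv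

/-- The numerator `B` of `m`: `m = -(1/16) B / (h_uu h_vv - h_uv²)²`. -/
def extB (h : ℝ × ℝ → ℝ) (p : ℝ × ℝ) : ℝ :=
  let huu := pdu (pdu h) p;
  let huv := pdv (pdu h) p;
  let hvv := pdv (pdv h) p;
  let huuu := pdu (pdu (pdu h)) p;
  let huuv := pdv (pdu (pdu h)) p;
  let huvv := pdv (pdv (pdu h)) p;
  let hvvv := pdv (pdv (pdv h)) p;
  let huuuv := pdv (pdu (pdu (pdu h))) p;
  let huuvv := pdv (pdv (pdu (pdu h))) p;
  let huvvv := pdv (pdv (pdv (pdu h))) p;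
  -4 * (hvv * huuuv - 2 * huv * huuvv) * (huu * hvv - huv ^ 2)
    + (7 * hvv ^ 2 * huuv - 10 * huv * hvv * huvv + (-huu * hvv + 4 * huv ^ 2) * hvvv) * huuu
    - 4 * huu * (huu * hvv - huv ^ 2) * huvvv
    - 18 * huuv ^ 2 * huv * hvv + 7 * huvv * hvvv * huu ^ 2
    + ((15 * huu * hvv + 24 * huv ^ 2) * huvv - 10 * huu * huv * hvvv) * huuv
    - 18 * huvv ^ 2 * huu * huv

/-- The numerator `C` of `n`: `n = -(1/16) C / (h_uu h_vv - h_uv²)²`. -/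
def extC (h : ℝ × ℝ → ℝ) (p : ℝ × ℝ) : ℝ :=
  let huu := pdu (pdu h) p;
  let huv := pdv (pdu h) p;
  let hvv := pdv (pdv h) p;
  let huuu := pdu (pdu (pdu h)) p;
  let huuv := pdv (pdu (pdu h)) p;
  let huvv := pdv (pdv (pdu h)) p;
  let hvvv := pdv (pdv (pdv h)) p;
  let huuvv := pdv (pdv (pdu (pdu h))) p;
  let huvvv := pdv (pdv (pdv (pdu h))) p;
  let hvvvv := pdv (pdv (pdv (pdv h))) p;
  -4 * (hvv * huuvv - 2 * huv * huvvv) * (huu * hvv - huv ^ 2)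
    - 4 * huu * hvvvv * (huu * hvv - huv ^ 2)
    + 4 * (-huv * hvv * hvvv + huvv * hvv ^ 2) * huuu
    + 3 * huuv ^ 2 * hvv ^ 2
    + 2 * (-12 * huv * hvv * huvv + (huu * hvv + 8 * huv ^ 2) * hvvv) * huuv
    + 12 * (huu * hvv + huv ^ 2) * huvv ^ 2
    - 28 * huvv * hvvv * huu * huv + 7 * hvvv ^ 2 * huu ^ 2

/-- The quadratic form of the extended equation `A du² + 2 B du dv + C dv² = 0`. -/
def extForm (h : ℝ × ℝ → ℝ) (p w : ℝ × ℝ) : ℝ :=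
  extA h p * w.1 ^ 2 + 2 * extB h p * w.1 * w.2 + extC h p * w.2 ^ 2

/-- The discriminant function of the extended equation. -/
def extDiscr (h : ℝ × ℝ → ℝ) (p : ℝ × ℝ) : ℝ :=
  4 * (extB h p ^ 2 - extA h p * extC h p)

/-! ### Polar blow-up and foci -/

/-- The open Euclidean disc of radius `ρ` about the origin. -/
def disc (ρ : ℝ) : Set (ℝ × ℝ) := {p | p.1 ^ 2 + p.2 ^ 2 < ρ ^ 2}

/-- The strip `0 ≤ r < ρ` of the `(r, t)`-plane. -/
def strip (ρ : ℝ) : Set (ℝ × ℝ) := {q | 0 ≤ q.1 ∧ q.1 < ρ}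

/-- The polar blow-up map `φ(r, t) = (r cos t, r sin t)`. -/
def polarMap (q : ℝ × ℝ) : ℝ × ℝ := (q.1 * Real.cos q.2, q.1 * Real.sin q.2)

/-- The quadratic form `a dr² + 2 r b dr dt + r² c dt²` at the point `q = (r, t)`. -/
def polarForm (a b c : ℝ × ℝ → ℝ) (q w : ℝ × ℝ) : ℝ :=
  a q * w.1 ^ 2 + 2 * q.1 * b q * w.1 * w.2 + q.1 ^ 2 * c q * w.2 ^ 2

/-- The linear vector field `(k x - y, x + k y)`: a focus, stable for `k < 0` and unstable for
`k > 0`, with counterclockwise rotation. -/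
def linearFocus (k : ℝ) (p : ℝ × ℝ) : ℝ × ℝ := (k * p.1 - p.2, p.1 + k * p.2)

/-- `H` sends every trajectory of `X` contained in `D` to an arc of a trajectory of `X'`, up to an
orientation preserving continuous change of time. -/
def SendsTrajectories (X X' H : ℝ × ℝ → ℝ × ℝ) (D : Set (ℝ × ℝ)) : Prop :=
  ∀ (I : Set ℝ) (γ : ℝ → ℝ × ℝ), IsOpen I → I.OrdConnected →
    (∀ s ∈ I, γ s ∈ D ∧ HasDerivAt γ (X (γ s)) s) →
    ∃ (σ : ℝ → ℝ) (η : ℝ → ℝ × ℝ), StrictMonoOn σ I ∧ ContinuousOn σ I ∧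
      ∀ s ∈ I, HasDerivAt η (X' (η (σ s))) (σ s) ∧ H (γ s) = η (σ s)

/-- The local homeomorphism `H` fixes the origin and is, off the origin, a topological equivalence
between the oriented trajectories of `X` in its source and those of `X'` in its target. -/
def IsTopologicalEquivalence (X X' : ℝ × ℝ → ℝ × ℝ)
    (H : OpenPartialHomeomorph (ℝ × ℝ) (ℝ × ℝ)) : Prop :=
  (0 : ℝ × ℝ) ∈ H.source ∧ H 0 = 0 ∧
    SendsTrajectories X X' H (H.source \ {0}) ∧
    SendsTrajectories X' X H.symm (H.target \ {0})

/-- Every trajectory of `X` starting in the punctured disc stays there for all future times, tends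
to the origin, and winds infinitely often around it (its polar angle tends to `+∞`). -/
def SpiralsIn (X : ℝ × ℝ → ℝ × ℝ) (ρ : ℝ) : Prop :=
  ∀ p ∈ disc ρ, p ≠ 0 → ∃ r t : ℝ → ℝ, polarMap (r 0, t 0) = p ∧
    (∀ s, 0 ≤ s → 0 < r s ∧ r s < ρ ∧
      HasDerivAt (fun s => polarMap (r s, t s)) (X (polarMap (r s, t s))) s) ∧
    ContinuousOn t (Ici 0) ∧ Tendsto r atTop (𝓝 0) ∧ Tendsto t atTop atTop

/-- Every trajectory of `X` through a point of the punctured disc stays there for all past times,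
tends to the origin as time tends to `-∞`, and winds infinitely often around it (its polar angle
tends to `-∞` as time tends to `-∞`). -/
def SpiralsOut (X : ℝ × ℝ → ℝ × ℝ) (ρ : ℝ) : Prop :=
  ∀ p ∈ disc ρ, p ≠ 0 → ∃ r t : ℝ → ℝ, polarMap (r 0, t 0) = p ∧
    (∀ s, s ≤ 0 → 0 < r s ∧ r s < ρ ∧
      HasDerivAt (fun s => polarMap (r s, t s)) (X (polarMap (r s, t s))) s) ∧
    ContinuousOn t (Iic 0) ∧ Tendsto r atBot (𝓝 0) ∧ Tendsto t atBot atBot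

end BlaschkeAsymptotic

end

open BlaschkeAsymptotic

/-! Since `⟨Dν(w), ξ⟩` vanishes identically, differentiating it along `w` gives `III(w) = -⟨D²ν(w,
w), ξ⟩`, so no derivative of the affine normal is needed. Where the Hessian determinant `d` is
negative, `ν = λ (-h_u, -h_v, 1)` with `λ⁴ d = -1`; two differentiations of this relation eliminate
the derivatives of `λ`, and `III` becomes `-1 / (16 d²)` times the extended form
(`affineIII_monge`).

At the flat umbilic the second derivatives of `h` vanish, so in polar coordinates each is `r` times
a smooth function (Hadamard's lemma). The numerators `A`, `B`, `C` are then divisible by `r²`, and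
after the division their fourth-order terms still carry a factor `r`. Hence on `r = 0` the blown-up
coefficients depend only on the cubic `u³ - c u v²`. With `k = cos t` and `s = sin t` they satisfy
`Abar = 192 c² (3 k² + c s²)² > 0` and, for `c = 1` or `3`, `Cbar < 0`; likewise `d / r² = -4 c (3
k² + c s²) < 0`. By compactness of the circle these signs persist on a strip `0 ≤ r ≤ ρ`
(`exists_polar_coefficients`, `exists_uniform_radius`). There the discriminant is positive off `r =
0`, and the equation reads `dr = r σ dt` for two smooth roots `σ` of opposite signs.

In `x = log r` these are two scalar equations `dx/dt = σ`, `2π`-periodic in `t`, with slopes bounded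
away from `0` and `∞`. One sign gives spirals tending to the origin in forward time, the other in
backward time. For the simultaneous conjugacy, each leaf is labelled by the angle at which it
crosses the boundary line `x = log ρ`. A point is determined by the pair of labels of its two
leaves, because leaves of opposite slopes meet exactly once. Sending it to the point of the linear
model with the same labels is a homeomorphism commuting with `t ↦ t + 2π`, so it descends to the
disc (`exists_foci_equivalence`). -/

/-! ### Partial derivatives, Hadamard's lemma and jets at the origin. -/

theorem contDiff_pdu {F : Type*} [NormedAddCommGroup F] [NormedSpace ℝ F] {f : ℝ × ℝ → F}
    (hf : ContDiff ℝ ∞ f) : ContDiff ℝ ∞ (pdu f) :=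
  (hf.fderiv_right (m := ∞) le_rfl).clm_apply contDiff_const

theorem contDiff_pdv {F : Type*} [NormedAddCommGroup F] [NormedSpace ℝ F] {f : ℝ × ℝ → F}
    (hf : ContDiff ℝ ∞ f) : ContDiff ℝ ∞ (pdv f) :=
  (hf.fderiv_right (m := ∞) le_rfl).clm_apply contDiff_const

theorem fderiv_eq_pdu_pdv {F : Type*} [NormedAddCommGroup F] [NormedSpace ℝ F]
    (f : ℝ × ℝ → F) (p w : ℝ × ℝ) : fderiv ℝ f p w = w.1 • pdu f p + w.2 • pdv f p := by
  have : w = w.1 • ((1 : ℝ), (0 : ℝ)) + w.2 • ((0 : ℝ), (1 : ℝ)) := by ext <;> simp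
  conv_lhs => rw [this]
  rw [map_add, map_smul, map_smul]
  rfl

theorem pdu_pdv_comm {F : Type*} [NormedAddCommGroup F] [NormedSpace ℝ F] {f : ℝ × ℝ → F}
    (hf : ContDiff ℝ ∞ f) (p : ℝ × ℝ) : pdu (pdv f) p = pdv (pdu f) p := by
  have hd : DifferentiableAt ℝ (fderiv ℝ f) p :=
    ((hf.fderiv_right (m := ∞) le_rfl).differentiable (by simp)) p
  have hs : IsSymmSndFDerivAt ℝ f p := hf.contDiffAt.isSymmSndFDerivAt (n := ∞) (by
    rw [minSmoothness_of_isRCLikeNormedField]; exact WithTop.coe_le_coe.2 (le_top : (2 : ℕ∞) ≤ ⊤))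
  have e := hs.eq (1, 0) (0, 1)
  have h1 : pdu (pdv f) p = fderiv ℝ (fderiv ℝ f) p (1, 0) (0, 1) := by
    have : HasFDerivAt (pdv f) _ p := hd.hasFDerivAt.clm_apply (hasFDerivAt_const ((0:ℝ),(1:ℝ)) p)
    rw [pdu, this.fderiv]; simp
  have h2 : pdv (pdu f) p = fderiv ℝ (fderiv ℝ f) p (0, 1) (1, 0) := by
    have : HasFDerivAt (pdu f) _ p := hd.hasFDerivAt.clm_apply (hasFDerivAt_const ((1:ℝ),(0:ℝ)) p)
    rw [pdv, this.fderiv]; simp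
  rw [h1, h2, e]

/-- Parametric integrals of smooth functions over a compact interval are smooth. -/
theorem contDiff_intervalIntegral_param {E G : Type} [NormedAddCommGroup E] [NormedSpace ℝ E]
    [FiniteDimensional ℝ E] [NormedAddCommGroup G] [NormedSpace ℝ G] [CompleteSpace G]
    {F : E × ℝ → G} (hF : ContDiff ℝ ∞ F) (a b : ℝ) :
    ContDiff ℝ ∞ fun x => ∫ s in a..b, F (x, s) := by
  rw [contDiff_infty]
  intro n
  -- The derivative in the parameter is an integral of the same kind with values in `E →L[ℝ] G`, so
  -- the target space has to vary in the induction.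
  induction n generalizing G with
  | zero =>
    rw [Nat.cast_zero, contDiff_zero]
    exact intervalIntegral.continuous_parametric_intervalIntegral_of_continuous'
      (f := fun x s => F (x, s)) hF.continuous a b
  | succ n ih =>
    rw [Nat.cast_succ, contDiff_succ_iff_hasFDerivAt]
    let F' : E × ℝ → E →L[ℝ] G := fun z => (fderiv ℝ F z).comp (ContinuousLinearMap.inl ℝ E ℝ)
    have hF' : ContDiff ℝ ∞ F' := (hF.fderiv_right (m := ∞) le_rfl).clm_comp contDiff_const
    refine ⟨fun x => ∫ s in a..b, F' (x, s), ih hF', fun x => ?_⟩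
    obtain ⟨C, hC⟩ := (((isCompact_closedBall x 1).prod (isCompact_uIcc (a := a) (b := b))).image
      hF'.continuous).isBounded.exists_norm_le
    refine intervalIntegral.hasFDerivAt_integral_of_dominated_of_fderiv_le
      (F := fun x s => F (x, s)) (F' := fun x s => F' (x, s)) (bound := fun _ => C)
      (Metric.closedBall_mem_nhds x one_pos) ?_ ?_ ?_ ?_ ?_ ?_
    · refine Eventually.of_forall fun y => Continuous.aestronglyMeasurable ?_
      exact hF.continuous.comp (by fun_prop)
    · exact (hF.continuous.comp (by fun_prop : Continuous fun s : ℝ => (x, s))).intervalIntegrable _ _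
    · exact (hF'.continuous.comp
        (by fun_prop : Continuous fun s : ℝ => (x, s))).aestronglyMeasurable
    · refine Eventually.of_forall fun s hs y hy => hC _ ⟨(y, s), ⟨hy, uIoc_subset_uIcc hs⟩, rfl⟩
    · exact intervalIntegrable_const
    · refine Eventually.of_forall fun s _ y _ => ?_
      have h1 : HasFDerivAt F (fderiv ℝ F (y, s)) (y, s) :=
        (hF.differentiable (by simp) _).hasFDerivAt
      exact h1.comp (f := fun x : E => (x, s)) y (hasFDerivAt_prodMk_left y s)

theorem hasDerivAt_comp_smul {g : ℝ × ℝ → ℝ} (hg : ContDiff ℝ ∞ g) (w : ℝ × ℝ) (s : ℝ) :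
    HasDerivAt (fun s : ℝ => g (s • w)) (w.1 * pdu g (s • w) + w.2 * pdv g (s • w)) s := by
  have h1 : HasFDerivAt g (fderiv ℝ g (s • w)) (s • w) :=
    (hg.differentiable (by simp) _).hasFDerivAt
  have h2 : HasDerivAt (fun s : ℝ => s • w) w s := by
    simpa using (hasDerivAt_id s).smul_const w
  have h3 := h1.comp_hasDerivAt s h2
  rw [fderiv_eq_pdu_pdv] at h3
  exact h3

/-- Hadamard's lemma in the plane. -/
theorem hadamard_plane {g : ℝ × ℝ → ℝ} (hg : ContDiff ℝ ∞ g) (h0 : g 0 = 0) :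
    ∃ a b : ℝ × ℝ → ℝ, ContDiff ℝ ∞ a ∧ ContDiff ℝ ∞ b ∧ (∀ p, g p = p.1 * a p + p.2 * b p) ∧
      a 0 = pdu g 0 ∧ b 0 = pdv g 0 := by
  have key : ∀ k : ℝ × ℝ → ℝ, ContDiff ℝ ∞ k →
      ContDiff ℝ ∞ fun p => ∫ s in (0:ℝ)..1, k (s • p) := fun k hk =>
    contDiff_intervalIntegral_param (F := fun z : (ℝ × ℝ) × ℝ => k (z.2 • z.1))
      (hk.comp (by fun_prop)) 0 1
  refine ⟨_, _, key _ (contDiff_pdu hg), key _ (contDiff_pdv hg), fun p => ?_, by simp, by simp⟩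
  have hd : ∀ s ∈ uIcc (0:ℝ) 1, HasDerivAt (fun s : ℝ => g (s • p))
      (p.1 * pdu g (s • p) + p.2 * pdv g (s • p)) s := fun s _ => hasDerivAt_comp_smul hg p s
  have c1 : Continuous fun s : ℝ => pdu g (s • p) := (contDiff_pdu hg).continuous.comp (by fun_prop)
  have c2 : Continuous fun s : ℝ => pdv g (s • p) := (contDiff_pdv hg).continuous.comp (by fun_prop)
  have := intervalIntegral.integral_eq_sub_of_hasDerivAt hd
    ((by fun_prop : Continuous _).intervalIntegrable _ _)
  rw [intervalIntegral.integral_add ((c1.const_mul _).intervalIntegrable _ _)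
    ((c2.const_mul _).intervalIntegrable _ _), intervalIntegral.integral_const_mul,
    intervalIntegral.integral_const_mul] at this
  simpa [h0] using this.symm

/-- A smooth function of one variable of size `O(s ^ (N + 1))` has zero `N`-jet. -/
theorem iteratedDeriv_eq_zero_of_isBigO {F : ℝ → ℝ} (hF : ContDiff ℝ ∞ F) {N : ℕ}
    (h : F =O[𝓝 0] fun s => s ^ (N + 1)) {n : ℕ} (hn : n ≤ N) : iteratedDeriv n F 0 = 0 := by
  induction n using Nat.strong_induction_on with
  | _ n ih =>
    have h1 := taylor_isLittleO_univ (x₀ := 0) (n := n) (hF.of_le (mod_cast le_top))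
    -- Both `F` and its Taylor remainder of order `n` are `o(s ^ n)`. The lower coefficients vanish
    -- by induction, so the `n`-th Taylor term alone is `o(s ^ n)`, which forces its coefficient to
    -- be zero.
    have h2 : F =o[𝓝 0] fun s : ℝ => s ^ n :=
      h.trans_isLittleO (isLittleO_pow_pow (by omega))
    have h3 := h2.sub (by simpa using h1)
    have h4 : (fun s : ℝ => ((n.factorial : ℝ)⁻¹ * iteratedDeriv n F 0) * s ^ n) =o[𝓝 0]
        fun s : ℝ => s ^ n := by
      refine h3.congr_left fun s => ?_
      rw [sub_sub_cancel, taylor_within_apply, Finset.sum_range_succ, Finset.sum_eq_zero]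
      · simp [iteratedDerivWithin_univ]; ring
      · intro k hk
        have hk := Finset.mem_range.1 hk
        rw [iteratedDerivWithin_univ, ih k hk (by omega), smul_zero]
    by_contra hne
    have hc : ((n.factorial : ℝ)⁻¹ * iteratedDeriv n F 0) ≠ 0 :=
      mul_ne_zero (by positivity) hne
    have h5 : (fun s : ℝ => s ^ n) =o[𝓝[≠] 0] fun s : ℝ => s ^ n :=
      ((isLittleO_const_mul_left_iff hc).1 h4).mono nhdsWithin_le_nhds
    have h6 := h5.bound (show (0:ℝ) < 1 / 2 by norm_num)
    have h7 : ∀ᶠ s : ℝ in 𝓝[≠] 0, s ≠ 0 := self_mem_nhdsWithin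
    obtain ⟨s, hs, hs'⟩ := (h6.and h7).exists
    have : 0 < ‖s ^ n‖ := norm_pos_iff.2 (pow_ne_zero _ hs')
    linarith

theorem pdu_lin {f g : ℝ × ℝ → ℝ} (hf : ContDiff ℝ ∞ f) (hg : ContDiff ℝ ∞ g) (a b : ℝ)
    (p : ℝ × ℝ) : pdu (fun p => a * f p + b * g p) p = a * pdu f p + b * pdu g p := by
  have h1 := ((hf.differentiable (by simp) p).hasFDerivAt.const_mul a).add
    ((hg.differentiable (by simp) p).hasFDerivAt.const_mul b)
  rw [pdu, HasFDerivAt.fderiv (f := fun p => a * f p + b * g p) h1]; rfl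

theorem pdv_lin {f g : ℝ × ℝ → ℝ} (hf : ContDiff ℝ ∞ f) (hg : ContDiff ℝ ∞ g) (a b : ℝ)
    (p : ℝ × ℝ) : pdv (fun p => a * f p + b * g p) p = a * pdv f p + b * pdv g p := by
  have h1 := ((hf.differentiable (by simp) p).hasFDerivAt.const_mul a).add
    ((hg.differentiable (by simp) p).hasFDerivAt.const_mul b)
  rw [pdv, HasFDerivAt.fderiv (f := fun p => a * f p + b * g p) h1]; rfl

/-- The second and third partial derivatives at the origin of a smooth function `O(|p| ^ 4)`
vanish. -/
theorem jet_eq_zero_of_isBigO {g : ℝ × ℝ → ℝ} (hg : ContDiff ℝ ∞ g)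
    (h : g =O[𝓝 0] fun p => ‖p‖ ^ 4) :
    (pdu (pdu g) 0 = 0 ∧ pdv (pdu g) 0 = 0 ∧ pdv (pdv g) 0 = 0) ∧
      pdu (pdu (pdu g)) 0 = 0 ∧ pdv (pdu (pdu g)) 0 = 0 ∧ pdv (pdv (pdu g)) 0 = 0 ∧
      pdv (pdv (pdv g)) 0 = 0 := by
  have hu := contDiff_pdu hg
  have hv := contDiff_pdv hg
  have huu := contDiff_pdu hu
  have huv := contDiff_pdv hu
  have hvv := contDiff_pdv hv
  have evu : pdu (pdv g) = pdv (pdu g) := funext (pdu_pdv_comm hg)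
  have euvu : pdu (pdv (pdu g)) = pdv (pdu (pdu g)) := funext (pdu_pdv_comm hu)
  have evvu : pdu (pdv (pdv g)) = pdv (pdv (pdu g)) := by
    rw [← evu]; exact funext (pdu_pdv_comm hv)
  -- Restriction to the line through `(a, b)`: the second and third derivatives at `0` are the
  -- quadratic and cubic forms of the jet evaluated at `(a, b)`.
  have key : ∀ a b : ℝ,
      a * (a * pdu (pdu g) 0 + b * pdv (pdu g) 0) + b * (a * pdv (pdu g) 0 + b * pdv (pdv g) 0) = 0
      ∧ a * (a * (a * pdu (pdu (pdu g)) 0 + b * pdv (pdu (pdu g)) 0)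
          + b * (a * pdv (pdu (pdu g)) 0 + b * pdv (pdv (pdu g)) 0))
        + b * (a * (a * pdv (pdu (pdu g)) 0 + b * pdv (pdv (pdu g)) 0)
          + b * (a * pdv (pdv (pdu g)) 0 + b * pdv (pdv (pdv g)) 0)) = 0 := by
    intro a b
    let F : ℝ → ℝ := fun s => g (s • (a, b))
    have hF : ContDiff ℝ ∞ F := hg.comp (by fun_prop)
    have hO : F =O[𝓝 0] fun s => s ^ (3 + 1) := by
      have ht : Tendsto (fun s : ℝ => s • (a, b)) (𝓝 0) (𝓝 0) :=
        (by fun_prop : Continuous fun s : ℝ => s • (a, b)).tendsto' _ _ (by simp)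
      refine (h.comp_tendsto ht).trans (IsBigO.of_bound (‖(a, b)‖ ^ 4) (Eventually.of_forall ?_))
      intro s
      simp only [Function.comp, norm_smul, norm_pow, norm_mul, norm_norm]
      rw [mul_pow, mul_comm]
    let D : (ℝ × ℝ → ℝ) → ℝ × ℝ → ℝ := fun f p => a * pdu f p + b * pdv f p
    have hD : ∀ f, ContDiff ℝ ∞ f → ContDiff ℝ ∞ (D f) := fun f hf =>
      (contDiff_const.mul (contDiff_pdu hf)).add (contDiff_const.mul (contDiff_pdv hf))
    have hd : ∀ f, ContDiff ℝ ∞ f →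
        deriv (fun s : ℝ => f (s • (a, b))) = fun s : ℝ => D f (s • (a, b)) := fun f hf =>
      funext fun s => (hasDerivAt_comp_smul hf (a, b) s).deriv
    have d1 : iteratedDeriv 1 F = fun s : ℝ => D g (s • (a, b)) := by
      rw [iteratedDeriv_one, hd g hg]
    have d2 : iteratedDeriv 2 F = fun s : ℝ => D (D g) (s • (a, b)) := by
      rw [iteratedDeriv_succ, d1, hd _ (hD g hg)]
    have d3 : iteratedDeriv 3 F = fun s : ℝ => D (D (D g)) (s • (a, b)) := by
      rw [iteratedDeriv_succ, d2, hd _ (hD _ (hD g hg))]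
    have z2 := iteratedDeriv_eq_zero_of_isBigO hF hO (n := 2) (by norm_num)
    have z3 := iteratedDeriv_eq_zero_of_isBigO hF hO (n := 3) (by norm_num)
    have e2 : D (D g) = fun p => a * (a * pdu (pdu g) p + b * pdv (pdu g) p)
        + b * (a * pdv (pdu g) p + b * pdv (pdv g) p) := by
      funext p
      change a * pdu (fun p => a * pdu g p + b * pdv g p) p
        + b * pdv (fun p => a * pdu g p + b * pdv g p) p = _
      rw [pdu_lin hu hv, pdv_lin hu hv, evu]
    have cu : ContDiff ℝ ∞ fun p => a * pdu (pdu g) p + b * pdv (pdu g) p :=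
      (contDiff_const.mul huu).add (contDiff_const.mul huv)
    have cv : ContDiff ℝ ∞ fun p => a * pdv (pdu g) p + b * pdv (pdv g) p :=
      (contDiff_const.mul huv).add (contDiff_const.mul hvv)
    rw [d2, e2] at z2
    rw [d3, e2] at z3
    simp only [zero_smul, D] at z2 z3
    rw [pdu_lin cu cv, pdv_lin cu cv, pdu_lin huu huv, pdv_lin huu huv, pdu_lin huv hvv,
      pdv_lin huv hvv, euvu, evvu] at z3
    exact ⟨z2, z3⟩
  -- Four pairwise independent directions determine a binary cubic form, and a fortiori a quadratic
  -- one.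
  have k1 := key 1 0
  have k2 := key 0 1
  have k3 := key 1 1
  have k4 := key 1 (-1)
  ring_nf at k1 k2 k3 k4
  refine ⟨⟨?_, ?_, ?_⟩, ?_, ?_, ?_, ?_⟩ <;> linarith [k1.1, k1.2, k2.1, k2.2, k3.1, k3.2, k4.1, k4.2]

/-- A function smooth near a point coincides there with a globally smooth one. -/
theorem exists_contDiff_eventuallyEq {U : Set (ℝ × ℝ)} (hU : IsOpen U) {p : ℝ × ℝ} (hp : p ∈ U)
    {h : ℝ × ℝ → ℝ} (hs : ContDiffOn ℝ ∞ h U) :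
    ∃ g : ℝ × ℝ → ℝ, ContDiff ℝ ∞ g ∧ g =ᶠ[𝓝 p] h := by
  obtain ⟨ε, hε, hball⟩ := Metric.isOpen_iff.1 hU p hp
  let f : ContDiffBump p := ⟨ε / 4, ε / 2, by positivity, by linarith⟩
  refine ⟨fun q => f q * h q, ?_, ?_⟩
  · rw [contDiff_iff_contDiffAt]
    intro q
    by_cases hq : q ∈ tsupport f
    · have hqU : q ∈ U := by
        rw [f.tsupport_eq] at hq
        exact hball (Metric.closedBall_subset_ball (by change ε / 2 < ε; linarith) hq)
      exact f.contDiff.contDiffAt.mul (hs.contDiffAt (hU.mem_nhds hqU))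
    · have : (fun q => f q * h q) =ᶠ[𝓝 q] fun _ => 0 := by
        filter_upwards [notMem_tsupport_iff_eventuallyEq.1 hq] with x hx
        simp [hx]
      exact contDiffAt_const.congr_of_eventuallyEq this
  · filter_upwards [f.eventuallyEq_one] with x hx
    simp [hx]

/-! ### Locality: everything at a point depends only on the germ of the chart there. -/

section Congruence

theorem pdu_congr {F : Type*} [NormedAddCommGroup F] [NormedSpace ℝ F] {f g : ℝ × ℝ → F}
    {p : ℝ × ℝ} (h : f =ᶠ[𝓝 p] g) : pdu f =ᶠ[𝓝 p] pdu g := by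
  filter_upwards [h.fderiv (𝕜 := ℝ)] with q hq
  rw [pdu, pdu, hq]

theorem pdv_congr {F : Type*} [NormedAddCommGroup F] [NormedSpace ℝ F] {f g : ℝ × ℝ → F}
    {p : ℝ × ℝ} (h : f =ᶠ[𝓝 p] g) : pdv f =ᶠ[𝓝 p] pdv g := by
  filter_upwards [h.fderiv (𝕜 := ℝ)] with q hq
  rw [pdv, pdv, hq]

theorem ext_congr {h g : ℝ × ℝ → ℝ} {p : ℝ × ℝ} (e : h =ᶠ[𝓝 p] g) :
    extA h p = extA g p ∧ extB h p = extB g p ∧ extC h p = extC g p := by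
  have u := pdu_congr e
  have v := pdv_congr e
  have uu := pdu_congr u
  have uv := pdv_congr u
  have vv := pdv_congr v
  have uuu := pdu_congr uu
  have uuv := pdv_congr uu
  have uvv := pdv_congr uv
  have vvv := pdv_congr vv
  have e1 := (pdu_congr uuu).eq_of_nhds
  have e2 := (pdv_congr uuu).eq_of_nhds
  have e3 := (pdv_congr uuv).eq_of_nhds
  have e4 := (pdv_congr uvv).eq_of_nhds
  have e5 := (pdv_congr vvv).eq_of_nhds
  refine ⟨?_, ?_, ?_⟩ <;>
  simp only [extA, extB, extC, uu.eq_of_nhds, uv.eq_of_nhds, vv.eq_of_nhds, uuu.eq_of_nhds,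
    uuv.eq_of_nhds, uvv.eq_of_nhds, vvv.eq_of_nhds, e1, e2, e3, e4, e5]

theorem extForm_congr {h g : ℝ × ℝ → ℝ} {p : ℝ × ℝ} (e : h =ᶠ[𝓝 p] g) (w : ℝ × ℝ) :
    extForm h p w = extForm g p w := by
  obtain ⟨a, b, c⟩ := ext_congr e
  simp only [extForm, a, b, c]

theorem extDiscr_congr {h g : ℝ × ℝ → ℝ} {p : ℝ × ℝ} (e : h =ᶠ[𝓝 p] g) :
    extDiscr h p = extDiscr g p := by
  obtain ⟨a, b, c⟩ := ext_congr e
  simp only [extDiscr, a, b, c]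

theorem monge_congr {h g : ℝ × ℝ → ℝ} {p : ℝ × ℝ} (e : h =ᶠ[𝓝 p] g) :
    monge h =ᶠ[𝓝 p] monge g := by
  filter_upwards [e] with q hq
  simp only [monge, hq]

theorem parabolicFun_congr {α β : ℝ × ℝ → Fin 3 → ℝ} {p : ℝ × ℝ} (e : α =ᶠ[𝓝 p] β) :
    parabolicFun α =ᶠ[𝓝 p] parabolicFun β := by
  filter_upwards [pdu_congr e, pdv_congr e, pdu_congr (pdu_congr e), pdv_congr (pdu_congr e),
    pdv_congr (pdv_congr e)] with q h1 h2 h3 h4 h5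
  simp only [parabolicFun, h1, h2, h3, h4, h5]

theorem conormal_congr {α β : ℝ × ℝ → Fin 3 → ℝ} {p : ℝ × ℝ} (e : α =ᶠ[𝓝 p] β) :
    conormal α =ᶠ[𝓝 p] conormal β := by
  filter_upwards [pdu_congr e, pdv_congr e, parabolicFun_congr e] with q h1 h2 h3
  simp only [conormal, h1, h2, h3]

theorem affineIII_congr {α β : ℝ × ℝ → Fin 3 → ℝ} {p : ℝ × ℝ} (e : α =ᶠ[𝓝 p] β) (w : ℝ × ℝ) :
    affineIII α p w = affineIII β p w := by
  have h1 := conormal_congr e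
  have h2 : affineNormal α =ᶠ[𝓝 p] affineNormal β := by
    filter_upwards [h1, pdu_congr h1, pdv_congr h1] with q h1 h2 h3
    simp only [affineNormal, h1, h2, h3]
  rw [affineIII, affineIII, h1.fderiv_eq, h2.fderiv_eq]

end Congruence

/-! ### The affine third fundamental form of a Monge chart. -/

section ThirdForm

theorem fderiv_dotProduct {f g : ℝ × ℝ → Fin 3 → ℝ} {p : ℝ × ℝ} (hf : DifferentiableAt ℝ f p)
    (hg : DifferentiableAt ℝ g p) (w : ℝ × ℝ) :
    fderiv ℝ (fun q => f q ⬝ᵥ g q) p w = fderiv ℝ f p w ⬝ᵥ g p + f p ⬝ᵥ fderiv ℝ g p w := by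
  have hfi := hasFDerivAt_pi'.1 hf.hasFDerivAt
  have hgi := hasFDerivAt_pi'.1 hg.hasFDerivAt
  have := HasFDerivAt.fun_sum (u := Finset.univ) fun i _ => (hfi i).fun_mul (hgi i)
  simp only [dotProduct]
  rw [this.fderiv]
  simp only [_root_.sum_apply, _root_.add_apply,
    _root_.smul_apply, ContinuousLinearMap.comp_apply, ContinuousLinearMap.proj_apply,
    smul_eq_mul, ← Finset.sum_add_distrib]
  refine Finset.sum_congr rfl fun i _ => ?_
  ring

/-- Differentiating `⟨Dν(w), ξ⟩ = 0` along `w` trades `⟨Dν(w), Dξ(w)⟩` for `-⟨D²ν(w, w), ξ⟩`. The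
affine normal then enters undifferentiated, as a multiple of `ν_u × ν_v`. -/
theorem affineIII_eq_of_eventuallyEq {α ν : ℝ × ℝ → Fin 3 → ℝ} {p : ℝ × ℝ}
    (hν : ContDiff ℝ ∞ ν) (e : conormal α =ᶠ[𝓝 p] ν)
    (hD : ν p ⬝ᵥ crossProduct (pdu ν p) (pdv ν p) ≠ 0) (w : ℝ × ℝ) :
    affineIII α p w = -((ν p ⬝ᵥ crossProduct (pdu ν p) (pdv ν p))⁻¹ *
      (fderiv ℝ (fun q => fderiv ℝ ν q w) p w ⬝ᵥ crossProduct (pdu ν p) (pdv ν p))) := by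
  let X : ℝ × ℝ → Fin 3 → ℝ := fun q => crossProduct (pdu ν q) (pdv ν q)
  let ξ : ℝ × ℝ → Fin 3 → ℝ := fun q => (ν q ⬝ᵥ X q)⁻¹ • X q
  have hu := contDiff_pi.1 (contDiff_pdu hν)
  have hv := contDiff_pi.1 (contDiff_pdv hν)
  have hX : ContDiff ℝ ∞ X := by
    rw [contDiff_pi]
    intro i
    have h0 := hu 0
    have h1 := hu 1
    have h2 := hu 2
    have k0 := hv 0
    have k1 := hv 1
    have k2 := hv 2
    fin_cases i <;> simp only [X, cross_apply] <;> simp <;> fun_prop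
  have hξe : affineNormal α =ᶠ[𝓝 p] ξ := by
    filter_upwards [e, pdu_congr e, pdv_congr e] with q h1 h2 h3
    simp only [affineNormal, h1, h2, h3, ξ, X]
  have hXd : DifferentiableAt ℝ X p := hX.differentiable (by simp) p
  have hξ : DifferentiableAt ℝ ξ p := by
    have h1 : DifferentiableAt ℝ (fun q => ν q ⬝ᵥ X q) p := by
      simp only [dotProduct]
      have hn := differentiableAt_pi.1 (hν.differentiable (by simp) p)
      have hx := differentiableAt_pi.1 hXd
      exact DifferentiableAt.fun_sum fun i _ => (hn i).mul (hx i)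
    exact (h1.inv hD).smul hXd
  have hνw : ContDiff ℝ ∞ fun q => fderiv ℝ ν q w :=
    (hν.fderiv_right (m := ∞) le_rfl).clm_apply contDiff_const
  have horth : ∀ q, fderiv ℝ ν q w ⬝ᵥ ξ q = 0 := by
    intro q
    rw [fderiv_eq_pdu_pdv]
    simp only [ξ, X, dotProduct_smul, add_dotProduct, smul_dotProduct, dot_self_cross,
      dot_cross_self]
    simp
  have hd := fderiv_dotProduct (hνw.differentiable (by simp) p) hξ w
  have h0 : (fun q => fderiv ℝ ν q w ⬝ᵥ ξ q) = fun _ => 0 := funext horth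
  rw [h0] at hd
  simp only [fderiv_fun_const, Pi.zero_apply, _root_.zero_apply] at hd
  rw [affineIII, e.fderiv_eq, hξe.fderiv_eq]
  have : fderiv ℝ (fun q => fderiv ℝ ν q w) p w ⬝ᵥ ξ p = (ν p ⬝ᵥ X p)⁻¹ *
      (fderiv ℝ (fun q => fderiv ℝ ν q w) p w ⬝ᵥ X p) := by
    simp only [ξ, dotProduct_smul, smul_eq_mul]
  rw [this] at hd
  linarith

/-- Hessian determinant. -/
noncomputable def hessDet (h : ℝ × ℝ → ℝ) (p : ℝ × ℝ) : ℝ :=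
  pdu (pdu h) p * pdv (pdv h) p - pdv (pdu h) p ^ 2

theorem fderiv_vec3 {f g k : ℝ × ℝ → ℝ} {p : ℝ × ℝ} (hf : DifferentiableAt ℝ f p)
    (hg : DifferentiableAt ℝ g p) (hk : DifferentiableAt ℝ k p) (w : ℝ × ℝ) :
    fderiv ℝ (fun q => ![f q, g q, k q]) p w =
      ![fderiv ℝ f p w, fderiv ℝ g p w, fderiv ℝ k p w] := by
  have : HasFDerivAt (fun q => ![f q, g q, k q])
      (ContinuousLinearMap.pi ![fderiv ℝ f p, fderiv ℝ g p, fderiv ℝ k p]) p := by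
    rw [hasFDerivAt_pi]
    intro i
    fin_cases i
    · exact hf.hasFDerivAt
    · exact hg.hasFDerivAt
    · exact hk.hasFDerivAt
  rw [this.fderiv]
  ext i
  fin_cases i <;> rfl

theorem pdu_monge {h : ℝ × ℝ → ℝ} (hh : ContDiff ℝ ∞ h) :
    pdu (monge h) = fun p => ![1, 0, pdu h p] := by
  funext p
  have := fderiv_vec3 (f := Prod.fst) (g := Prod.snd) differentiableAt_fst differentiableAt_snd
    (hh.differentiable (by simp) p) (1, 0)
  simpa [fderiv_fst, fderiv_snd] using! this

theorem pdv_monge {h : ℝ × ℝ → ℝ} (hh : ContDiff ℝ ∞ h) :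
    pdv (monge h) = fun p => ![0, 1, pdv h p] := by
  funext p
  have := fderiv_vec3 (f := Prod.fst) (g := Prod.snd) differentiableAt_fst differentiableAt_snd
    (hh.differentiable (by simp) p) (0, 1)
  simpa [fderiv_fst, fderiv_snd] using! this

theorem parabolicFun_monge {h : ℝ × ℝ → ℝ} (hh : ContDiff ℝ ∞ h) (p : ℝ × ℝ) :
    parabolicFun (monge h) p = hessDet h p := by
  have hu := (contDiff_pdu hh).differentiable (by simp)
  have hv := (contDiff_pdv hh).differentiable (by simp)
  have c : ∀ (a : ℝ), DifferentiableAt ℝ (fun _ : ℝ × ℝ => a) p := fun a =>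
    differentiableAt_const a
  have h1 : pdu (pdu (monge h)) p = ![0, 0, pdu (pdu h) p] := by
    rw [pdu_monge hh]
    simpa using! fderiv_vec3 (c 1) (c 0) (hu p) (1, 0)
  have h2 : pdv (pdu (monge h)) p = ![0, 0, pdv (pdu h) p] := by
    rw [pdu_monge hh]
    simpa using! fderiv_vec3 (c 1) (c 0) (hu p) (0, 1)
  have h3 : pdv (pdv (monge h)) p = ![0, 0, pdv (pdv h) p] := by
    rw [pdv_monge hh]
    simpa using! fderiv_vec3 (c 0) (c 1) (hv p) (0, 1)
  rw [parabolicFun, h1, h2, h3, pdu_monge hh, pdv_monge hh]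
  simp [det3, Matrix.det_fin_three, hessDet]

theorem conormal_monge {h : ℝ × ℝ → ℝ} (hh : ContDiff ℝ ∞ h) (p : ℝ × ℝ) :
    conormal (monge h) p =
      |hessDet h p| ^ (-(1 / 4) : ℝ) • ![-pdu h p, -pdv h p, 1] := by
  rw [conormal, parabolicFun_monge hh, pdu_monge hh, pdv_monge hh, cross_apply]
  simp

theorem contDiff_hessDet {h : ℝ × ℝ → ℝ} (hh : ContDiff ℝ ∞ h) : ContDiff ℝ ∞ (hessDet h) := by
  have h1 := contDiff_pdu (contDiff_pdu hh)
  have h2 := contDiff_pdv (contDiff_pdu hh)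
  have h3 := contDiff_pdv (contDiff_pdv hh)
  exact (h1.mul h3).sub (h2.pow 2)

theorem pdu_mul {f g : ℝ × ℝ → ℝ} (hf : ContDiff ℝ ∞ f) (hg : ContDiff ℝ ∞ g) :
    pdu (fun q => f q * g q) = fun q => pdu f q * g q + f q * pdu g q := by
  funext p
  have := (hf.differentiable (by simp) p).hasFDerivAt.fun_mul
    (hg.differentiable (by simp) p).hasFDerivAt
  rw [pdu, this.fderiv]
  simp only [_root_.add_apply, _root_.smul_apply, smul_eq_mul, pdu]
  ring

theorem pdv_mul {f g : ℝ × ℝ → ℝ} (hf : ContDiff ℝ ∞ f) (hg : ContDiff ℝ ∞ g) :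
    pdv (fun q => f q * g q) = fun q => pdv f q * g q + f q * pdv g q := by
  funext p
  have := (hf.differentiable (by simp) p).hasFDerivAt.fun_mul
    (hg.differentiable (by simp) p).hasFDerivAt
  rw [pdv, this.fderiv]
  simp only [_root_.add_apply, _root_.smul_apply, smul_eq_mul, pdv]
  ring

theorem pdu_add {f g : ℝ × ℝ → ℝ} (hf : ContDiff ℝ ∞ f) (hg : ContDiff ℝ ∞ g) :
    pdu (fun q => f q + g q) = fun q => pdu f q + pdu g q := by
  funext p
  simpa using pdu_lin hf hg 1 1 p

theorem pdv_add {f g : ℝ × ℝ → ℝ} (hf : ContDiff ℝ ∞ f) (hg : ContDiff ℝ ∞ g) :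
    pdv (fun q => f q + g q) = fun q => pdv f q + pdv g q := by
  funext p
  simpa using pdv_lin hf hg 1 1 p

theorem pdu_neg (f : ℝ × ℝ → ℝ) : pdu (fun q => -f q) = fun q => -pdu f q := by
  funext p
  simp [pdu, fderiv_fun_neg]

theorem pdv_neg (f : ℝ × ℝ → ℝ) : pdv (fun q => -f q) = fun q => -pdv f q := by
  funext p
  simp [pdv, fderiv_fun_neg]

theorem fderiv_fderiv_apply_self {n : ℝ × ℝ → ℝ} (hn : ContDiff ℝ ∞ n) (p w : ℝ × ℝ) :
    fderiv ℝ (fun q => fderiv ℝ n q w) p w = w.1 ^ 2 * pdu (pdu n) p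
      + 2 * w.1 * w.2 * pdv (pdu n) p + w.2 ^ 2 * pdv (pdv n) p := by
  have : (fun q => fderiv ℝ n q w) = fun q => w.1 * pdu n q + w.2 * pdv n q := by
    funext q
    rw [fderiv_eq_pdu_pdv, smul_eq_mul, smul_eq_mul]
  rw [this, fderiv_eq_pdu_pdv, pdu_lin (contDiff_pdu hn) (contDiff_pdv hn),
    pdv_lin (contDiff_pdu hn) (contDiff_pdv hn), pdu_pdv_comm hn, smul_eq_mul, smul_eq_mul]
  ring

theorem fderiv_fderiv_mul_apply_self {l k : ℝ × ℝ → ℝ} (hl : ContDiff ℝ ∞ l) (hk : ContDiff ℝ ∞ k)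
    (p w : ℝ × ℝ) :
    fderiv ℝ (fun q => fderiv ℝ (fun q => l q * k q) q w) p w =
      w.1 ^ 2 * (pdu (pdu l) p * k p + 2 * pdu l p * pdu k p + l p * pdu (pdu k) p)
      + 2 * w.1 * w.2 * (pdv (pdu l) p * k p + pdu l p * pdv k p + pdv l p * pdu k p
          + l p * pdv (pdu k) p)
      + w.2 ^ 2 * (pdv (pdv l) p * k p + 2 * pdv l p * pdv k p + l p * pdv (pdv k) p) := by
  have lu := contDiff_pdu hl
  have lv := contDiff_pdv hl
  have ku := contDiff_pdu hk
  have kv := contDiff_pdv hk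
  rw [fderiv_fderiv_apply_self (hl.mul hk), pdu_mul hl hk, pdv_mul hl hk,
    pdu_add (lu.mul hk) (hl.mul ku), pdv_add (lu.mul hk) (hl.mul ku),
    pdv_add (lv.mul hk) (hl.mul kv), pdu_mul lu hk, pdu_mul hl ku, pdv_mul lu hk, pdv_mul hl ku,
    pdv_mul lv hk, pdv_mul hl kv]
  ring

/-- The algebraic relation `lam⁴ d = -1` is differentiated instead of a fourth root. Cancelling
`lam³` leaves first-order relations valid near `p`, so they can be differentiated once more. -/
theorem conormal_dilation_derivs {h lam : ℝ × ℝ → ℝ} (hh : ContDiff ℝ ∞ h)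
    (hl : ContDiff ℝ ∞ lam) {p : ℝ × ℝ} (e : ∀ᶠ q in 𝓝 p, lam q ^ 4 * hessDet h q = -1) :
    (4 * pdu lam p * hessDet h p + lam p * pdu (hessDet h) p = 0 ∧
      4 * pdv lam p * hessDet h p + lam p * pdv (hessDet h) p = 0) ∧
    4 * pdu (pdu lam) p * hessDet h p + 5 * pdu lam p * pdu (hessDet h) p
      + lam p * pdu (pdu (hessDet h)) p = 0 ∧
    4 * pdv (pdu lam) p * hessDet h p + 4 * pdu lam p * pdv (hessDet h) p
      + pdv lam p * pdu (hessDet h) p + lam p * pdv (pdu (hessDet h)) p = 0 ∧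
    4 * pdv (pdv lam) p * hessDet h p + 5 * pdv lam p * pdv (hessDet h) p
      + lam p * pdv (pdv (hessDet h)) p = 0 := by
  have hD := contDiff_hessDet hh
  have lu := contDiff_pdu hl
  have lv := contDiff_pdv hl
  have du := contDiff_pdu hD
  have dv := contDiff_pdv hD
  have l2 := hl.mul hl
  have l4 := l2.mul l2
  have e1 : (fun q => lam q * lam q * (lam q * lam q) * hessDet h q) =ᶠ[𝓝 p] fun _ => -1 := by
    filter_upwards [e] with q hq
    rw [← hq]; ring
  have zu : (fun q => 4 * (pdu lam q * hessDet h q) + 1 * (lam q * pdu (hessDet h) q))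
      =ᶠ[𝓝 p] fun _ => 0 := by
    filter_upwards [pdu_congr e1, e] with q hq hq'
    rw [pdu_mul l4 hD, pdu_mul l2 l2, pdu_mul hl hl] at hq
    have h0 : pdu (fun _ : ℝ × ℝ => (-1 : ℝ)) q = 0 := by simp [pdu]
    rw [h0] at hq
    have hne : lam q ^ 3 ≠ 0 := by
      intro h0
      have h0 := pow_eq_zero_iff (by norm_num) |>.1 h0
      rw [h0] at hq'
      norm_num at hq'
    refine mul_left_cancel₀ hne ?_
    linear_combination hq
  have zv : (fun q => 4 * (pdv lam q * hessDet h q) + 1 * (lam q * pdv (hessDet h) q))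
      =ᶠ[𝓝 p] fun _ => 0 := by
    filter_upwards [pdv_congr e1, e] with q hq hq'
    rw [pdv_mul l4 hD, pdv_mul l2 l2, pdv_mul hl hl] at hq
    have h0 : pdv (fun _ : ℝ × ℝ => (-1 : ℝ)) q = 0 := by simp [pdv]
    rw [h0] at hq
    have hne : lam q ^ 3 ≠ 0 := by
      intro h0
      have h0 := pow_eq_zero_iff (by norm_num) |>.1 h0
      rw [h0] at hq'
      norm_num at hq'
    refine mul_left_cancel₀ hne ?_
    linear_combination hq
  have zuu := (pdu_congr zu).eq_of_nhds
  have zuv := (pdv_congr zu).eq_of_nhds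
  have zvv := (pdv_congr zv).eq_of_nhds
  rw [pdu_lin (lu.mul hD) (hl.mul du), pdu_mul lu hD, pdu_mul hl du] at zuu
  rw [pdv_lin (lu.mul hD) (hl.mul du), pdv_mul lu hD, pdv_mul hl du] at zuv
  rw [pdv_lin (lv.mul hD) (hl.mul dv), pdv_mul lv hD, pdv_mul hl dv] at zvv
  have h0 : pdu (fun _ : ℝ × ℝ => (0 : ℝ)) p = 0 := by simp [pdu]
  have h0' : pdv (fun _ : ℝ × ℝ => (0 : ℝ)) p = 0 := by simp [pdv]
  rw [h0] at zuu
  rw [h0'] at zuv zvv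
  have zu0 := zu.eq_of_nhds
  have zv0 := zv.eq_of_nhds
  refine ⟨⟨?_, ?_⟩, ?_, ?_, ?_⟩
  · linear_combination zu0
  · linear_combination zv0
  · linear_combination zuu
  · linear_combination zuv
  · linear_combination zvv

theorem hessDet_derivs {h : ℝ × ℝ → ℝ} (hh : ContDiff ℝ ∞ h) (p : ℝ × ℝ) :
    (pdu (hessDet h) p = pdu (pdu (pdu h)) p * pdv (pdv h) p
        + pdu (pdu h) p * pdv (pdv (pdu h)) p - 2 * pdv (pdu h) p * pdv (pdu (pdu h)) p ∧
      pdv (hessDet h) p = pdv (pdu (pdu h)) p * pdv (pdv h) p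
        + pdu (pdu h) p * pdv (pdv (pdv h)) p - 2 * pdv (pdu h) p * pdv (pdv (pdu h)) p) ∧
    pdu (pdu (hessDet h)) p = pdu (pdu (pdu (pdu h))) p * pdv (pdv h) p
        + 2 * pdu (pdu (pdu h)) p * pdv (pdv (pdu h)) p
        + pdu (pdu h) p * pdv (pdv (pdu (pdu h))) p
        - 2 * pdv (pdu (pdu h)) p ^ 2 - 2 * pdv (pdu h) p * pdv (pdu (pdu (pdu h))) p ∧
    pdv (pdu (hessDet h)) p = pdv (pdu (pdu (pdu h))) p * pdv (pdv h) p
        + pdu (pdu (pdu h)) p * pdv (pdv (pdv h)) p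
        + pdv (pdu (pdu h)) p * pdv (pdv (pdu h)) p
        + pdu (pdu h) p * pdv (pdv (pdv (pdu h))) p
        - 2 * pdv (pdv (pdu h)) p * pdv (pdu (pdu h)) p
        - 2 * pdv (pdu h) p * pdv (pdv (pdu (pdu h))) p ∧
    pdv (pdv (hessDet h)) p = pdv (pdv (pdu (pdu h))) p * pdv (pdv h) p
        + 2 * pdv (pdu (pdu h)) p * pdv (pdv (pdv h)) p
        + pdu (pdu h) p * pdv (pdv (pdv (pdv h))) p
        - 2 * pdv (pdv (pdu h)) p ^ 2 - 2 * pdv (pdu h) p * pdv (pdv (pdv (pdu h))) p := by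
  have hu := contDiff_pdu hh
  have hv := contDiff_pdv hh
  have huu := contDiff_pdu hu
  have huv := contDiff_pdv hu
  have hvv := contDiff_pdv hv
  have huuu := contDiff_pdu huu
  have huuv := contDiff_pdv huu
  have huvv := contDiff_pdv huv
  have hvvv := contDiff_pdv hvv
  have e1 : pdu (pdv h) = pdv (pdu h) := funext (pdu_pdv_comm hh)
  have e2 : pdu (pdv (pdu h)) = pdv (pdu (pdu h)) := funext (pdu_pdv_comm hu)
  have e3 : pdu (pdv (pdv h)) = pdv (pdv (pdu h)) := by
    rw [← e1]; exact funext (pdu_pdv_comm hv)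
  have e4 : pdu (pdv (pdu (pdu h))) = pdv (pdu (pdu (pdu h))) := funext (pdu_pdv_comm huu)
  have e5 : pdu (pdv (pdv (pdu h))) = pdv (pdv (pdu (pdu h))) := by
    rw [← e2]; exact funext (pdu_pdv_comm huv)
  have e6 : hessDet h = fun q => pdu (pdu h) q * pdv (pdv h) q
      + -(pdv (pdu h) q * pdv (pdu h) q) := by
    funext q; rw [hessDet]; ring
  have eu : pdu (hessDet h) = fun q => (pdu (pdu (pdu h)) q * pdv (pdv h) q
      + pdu (pdu h) q * pdv (pdv (pdu h)) q)
      + -(pdv (pdu (pdu h)) q * pdv (pdu h) q + pdv (pdu h) q * pdv (pdu (pdu h)) q) := by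
    rw [e6, pdu_add (huu.mul hvv) (huv.mul huv).neg, pdu_neg, pdu_mul huu hvv, pdu_mul huv huv,
      e2, e3]
  have ev : pdv (hessDet h) = fun q => (pdv (pdu (pdu h)) q * pdv (pdv h) q
      + pdu (pdu h) q * pdv (pdv (pdv h)) q)
      + -(pdv (pdv (pdu h)) q * pdv (pdu h) q + pdv (pdu h) q * pdv (pdv (pdu h)) q) := by
    rw [e6, pdv_add (huu.mul hvv) (huv.mul huv).neg, pdv_neg, pdv_mul huu hvv, pdv_mul huv huv]
  refine ⟨⟨?_, ?_⟩, ?_, ?_, ?_⟩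
  · rw [eu]; ring
  · rw [ev]; ring
  · rw [eu, pdu_add ((huuu.mul hvv).add (huu.mul huvv)) ((huuv.mul huv).add (huv.mul huuv)).neg,
      pdu_neg, pdu_add (huuu.mul hvv) (huu.mul huvv), pdu_add (huuv.mul huv) (huv.mul huuv),
      pdu_mul huuu hvv, pdu_mul huu huvv, pdu_mul huuv huv, pdu_mul huv huuv, e2, e3, e4, e5]
    ring
  · rw [eu, pdv_add ((huuu.mul hvv).add (huu.mul huvv)) ((huuv.mul huv).add (huv.mul huuv)).neg,
      pdv_neg, pdv_add (huuu.mul hvv) (huu.mul huvv), pdv_add (huuv.mul huv) (huv.mul huuv),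
      pdv_mul huuu hvv, pdv_mul huu huvv, pdv_mul huuv huv, pdv_mul huv huuv]
    ring
  · rw [ev, pdv_add ((huuv.mul hvv).add (huu.mul hvvv)) ((huvv.mul huv).add (huv.mul huvv)).neg,
      pdv_neg, pdv_add (huuv.mul hvv) (huu.mul hvvv), pdv_add (huvv.mul huv) (huv.mul huvv),
      pdv_mul huuv hvv, pdv_mul huu hvvv, pdv_mul huvv huv, pdv_mul huv huvv]
    ring

end ThirdForm

/-- In a Monge chart with negative Hessian determinant `III` is a nonzero multiple of the extended
form. -/
theorem affineIII_monge {h : ℝ × ℝ → ℝ} (hh : ContDiff ℝ ∞ h) {p : ℝ × ℝ} (hd : hessDet h p < 0) :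
    ∃ k : ℝ, k ≠ 0 ∧ ∀ w, affineIII (monge h) p w = k * extForm h p w := by
  have hD := contDiff_hessDet hh
  have hVo : IsOpen {q | hessDet h q < 0} := isOpen_lt hD.continuous continuous_const
  have hl0 : ContDiffOn ℝ ∞ (fun q => (-hessDet h q) ^ (-(1 / 4) : ℝ)) {q | hessDet h q < 0} :=
    fun q hq => (hD.contDiffAt.neg.rpow_const_of_ne
      (by exact (neg_pos.2 hq).ne')).contDiffWithinAt
  -- A globally smooth function with the germ of `|d| ^ (-1/4)` at `p`; it makes `ν` below smooth on
  -- the whole plane.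
  obtain ⟨lam, hl, hle⟩ := exists_contDiff_eventuallyEq hVo hd hl0
  have hV : ∀ᶠ q in 𝓝 p, hessDet h q < 0 := hVo.mem_nhds hd
  have e4 : ∀ᶠ q in 𝓝 p, lam q ^ 4 * hessDet h q = -1 := by
    filter_upwards [hle, hV] with q hq hq'
    rw [hq, ← Real.rpow_natCast, ← Real.rpow_mul (by linarith),
      show -(1 / 4 : ℝ) * (4 : ℕ) = -1 by norm_num, Real.rpow_neg_one]
    have : hessDet h q ≠ 0 := hq'.ne
    field_simp
  obtain ⟨⟨hp, hq⟩, hP, hQ, hR⟩ := conormal_dilation_derivs hh hl e4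
  obtain ⟨⟨hdu, hdv⟩, hduu, hduv, hdvv⟩ := hessDet_derivs hh p
  have hu := contDiff_pdu hh
  have hv := contDiff_pdv hh
  let ν : ℝ × ℝ → Fin 3 → ℝ := fun q => ![lam q * -pdu h q, lam q * -pdv h q, lam q * 1]
  have c0 : ContDiff ℝ ∞ fun q => lam q * -pdu h q := hl.mul hu.neg
  have c1 : ContDiff ℝ ∞ fun q => lam q * -pdv h q := hl.mul hv.neg
  have c2 : ContDiff ℝ ∞ fun q => lam q * 1 := hl.mul contDiff_const
  have hν : ContDiff ℝ ∞ ν := by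
    rw [contDiff_pi]
    intro i
    fin_cases i
    exacts [c0, c1, c2]
  have eν : conormal (monge h) =ᶠ[𝓝 p] ν := by
    filter_upwards [hle, hV] with q hq hq'
    rw [conormal_monge hh, abs_of_neg hq', ← hq]
    simp [ν]
  have dν : ∀ q w, fderiv ℝ ν q w = ![fderiv ℝ (fun q => lam q * -pdu h q) q w,
      fderiv ℝ (fun q => lam q * -pdv h q) q w, fderiv ℝ (fun q => lam q * 1) q w] := fun q w =>
    fderiv_vec3 (c0.differentiable (by simp) q) (c1.differentiable (by simp) q)
      (c2.differentiable (by simp) q) w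
  have ddν : ∀ w, fderiv ℝ (fun q => fderiv ℝ ν q w) p w =
      ![fderiv ℝ (fun q => fderiv ℝ (fun q => lam q * -pdu h q) q w) p w,
        fderiv ℝ (fun q => fderiv ℝ (fun q => lam q * -pdv h q) q w) p w,
        fderiv ℝ (fun q => fderiv ℝ (fun q => lam q * 1) q w) p w] := by
    intro w
    have sm : ∀ f : ℝ × ℝ → ℝ, ContDiff ℝ ∞ f → DifferentiableAt ℝ (fun q => fderiv ℝ f q w) p :=
      fun f hf => ((hf.fderiv_right (m := ∞) le_rfl).clm_apply
        contDiff_const).differentiable (by simp) p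
    rw [show (fun q => fderiv ℝ ν q w) = _ from funext fun q => dν q w]
    exact fderiv_vec3 (sm _ c0) (sm _ c1) (sm _ c2) w
  have eνu : pdu ν p = ![pdu lam p * -pdu h p + lam p * -pdu (pdu h) p,
      pdu lam p * -pdv h p + lam p * -pdv (pdu h) p, pdu lam p] := by
    have := dν p (1, 0)
    rw [pdu, this]
    change ![pdu _ p, pdu _ p, pdu _ p] = _
    rw [ pdu_mul hl hu.neg, pdu_mul hl hv.neg, pdu_neg, pdu_neg,
      show pdu (pdv h) = pdv (pdu h) from funext (pdu_pdv_comm hh)]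
    simp
  have eνv : pdv ν p = ![pdv lam p * -pdu h p + lam p * -pdv (pdu h) p,
      pdv lam p * -pdv h p + lam p * -pdv (pdv h) p, pdv lam p] := by
    have := dν p (0, 1)
    rw [pdv, this]
    change ![pdv _ p, pdv _ p, pdv _ p] = _
    rw [ pdv_mul hl hu.neg, pdv_mul hl hv.neg, pdv_neg, pdv_neg]
    simp
  have hL : lam p ≠ 0 := by
    intro h0
    have := e4.self_of_nhds
    rw [h0] at this
    norm_num at this
  have hne : hessDet h p ≠ 0 := hd.ne
  have hdet : ν p ⬝ᵥ crossProduct (pdu ν p) (pdv ν p) = lam p ^ 3 * hessDet h p := by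
    rw [eνu, eνv, cross_apply, hessDet]
    simp [ν, dotProduct, Fin.sum_univ_three]
    ring
  have e1 : pdu (pdv h) = pdv (pdu h) := funext (pdu_pdv_comm hh)
  have e2 : pdu (pdv (pdu h)) = pdv (pdu (pdu h)) := funext (pdu_pdv_comm hu)
  have hcu : pdu (fun _ : ℝ × ℝ => (1 : ℝ)) = fun _ => 0 := by funext; simp [pdu]
  have hcv : pdv (fun _ : ℝ × ℝ => (1 : ℝ)) = fun _ => 0 := by funext; simp [pdv]
  have hcu0 : pdu (fun _ : ℝ × ℝ => (0 : ℝ)) = fun _ => 0 := by funext; simp [pdu]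
  have hcv0 : pdv (fun _ : ℝ × ℝ => (0 : ℝ)) = fun _ => 0 := by funext; simp [pdv]
  refine ⟨-(16 * hessDet h p ^ 2)⁻¹, by simp [hne], fun w => ?_⟩
  rw [affineIII_eq_of_eventuallyEq hν eν (by rw [hdet]; exact mul_ne_zero (pow_ne_zero _ hL) hne),
    hdet, ddν, fderiv_fderiv_mul_apply_self hl hu.neg, fderiv_fderiv_mul_apply_self hl hv.neg,
    fderiv_fderiv_mul_apply_self hl contDiff_const, eνu, eνv, cross_apply, hcu, hcv, hcu0, hcv0]
  simp only [pdu_neg, pdv_neg, e1, e2]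
  rw [extForm, extA, extB, extC]
  rw [hdu] at hp
  rw [hdv] at hq
  rw [hdu, hduu] at hP
  rw [hdv, hdu, hduv] at hQ
  rw [hdv, hdvv] at hR
  simp only [dotProduct, Fin.sum_univ_three, cons_val_zero, cons_val_one, cons_val]
  have hdd : hessDet h p = pdu (pdu h) p * pdv (pdv h) p - pdv (pdu h) p ^ 2 := rfl
  -- What remains is an identity between polynomials in the partial derivatives at `p`, now treated
  -- as independent variables subject to the relations in context.
  generalize hDD : hessDet h p = D at *
  generalize lam p = L at *
  generalize pdu lam p = Lu at *
  generalize pdv lam p = Lv at *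
  generalize pdu (pdu lam) p = Luu at *
  generalize pdv (pdu lam) p = Luv at *
  generalize pdv (pdv lam) p = Lvv at *
  generalize pdu h p = x at *
  generalize pdv h p = y at *
  generalize pdu (pdu h) p = r at *
  generalize pdv (pdu h) p = s at *
  generalize pdv (pdv h) p = t at *
  generalize pdu (pdu (pdu h)) p = a0 at *
  generalize pdv (pdu (pdu h)) p = a1 at *
  generalize pdv (pdv (pdu h)) p = a2 at *
  generalize pdv (pdv (pdv h)) p = a3 at *
  generalize pdu (pdu (pdu (pdu h))) p = b0 at *
  generalize pdv (pdu (pdu (pdu h))) p = b1 at *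
  generalize pdv (pdv (pdu (pdu h))) p = b2 at *
  generalize pdv (pdv (pdv (pdu h))) p = b3 at *
  generalize pdv (pdv (pdv (pdv h))) p = b4 at *
  obtain ⟨a, b⟩ := w
  clear e4 hle hV hVo hl0 eν dν ddν eνu eνv hdet hdu hdv hduu hduv hdvv hDD
  dsimp only
  obtain ⟨du, hdu⟩ : ∃ du, du = a0 * t + r * a2 - 2 * s * a1 := ⟨_, rfl⟩
  obtain ⟨dv, hdv⟩ : ∃ dv, dv = a1 * t + r * a3 - 2 * s * a2 := ⟨_, rfl⟩
  rw [← hdu] at hp hP hQ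
  rw [← hdv] at hq hQ hR
  -- `T` is the expansion of `⟨D²ν(w, w), ν_u × ν_v⟩`; the first derivatives of `h` drop out of it.
  obtain ⟨T, hT⟩ : ∃ T, T = L ^ 2 * D * (a ^ 2 * Luu + 2 * a * b * Luv + b ^ 2 * Lvv)
      - 2 * L * D * (a * Lu + b * Lv) ^ 2
      + L ^ 2 * ((a ^ 2 * a0 + 2 * a * b * a1 + b ^ 2 * a2) * (s * Lv - t * Lu)
        + (a ^ 2 * a1 + 2 * a * b * a2 + b ^ 2 * a3) * (s * Lu - r * Lv)) := ⟨_, rfl⟩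
  -- The relations give `4 D Lu = -L du` and `16 D² Luu = L (5 du² - 4 D duu)`, with analogues for
  -- the other derivatives. The factor `16 D` therefore clears every denominator and removes the
  -- derivatives of `lam`.
  obtain ⟨W, hW⟩ : ∃ W, 16 * D * T = L ^ 3 * W ∧ W =
      (a ^ 2 * (5 * du ^ 2 - 4 * D * (b0 * t + 2 * a0 * a2 + r * b2 - 2 * a1 ^ 2 - 2 * s * b1))
      + 2 * a * b * (5 * du * dv
        - 4 * D * (b1 * t + a0 * a3 + a1 * a2 + r * b3 - 2 * a2 * a1 - 2 * s * b2))
      + b ^ 2 * (5 * dv ^ 2 - 4 * D * (b2 * t + 2 * a1 * a3 + r * b4 - 2 * a2 ^ 2 - 2 * s * b3)))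
      - 2 * (a * du + b * dv) ^ 2
      - 4 * ((a ^ 2 * a0 + 2 * a * b * a1 + b ^ 2 * a2) * (s * dv - t * du)
        + (a ^ 2 * a1 + 2 * a * b * a2 + b ^ 2 * a3) * (s * du - r * dv)) := by
    refine ⟨_, ?_, rfl⟩
    rw [hT]
    linear_combination L ^ 2 * (a ^ 2 * (4 * D * hP - 5 * du * hp)
        + 2 * a * b * (4 * D * hQ - 4 * dv * hp - du * hq) + b ^ 2 * (4 * D * hR - 5 * dv * hq))
      - 2 * L * (4 * D * (a * Lu + b * Lv) - L * (a * du + b * dv)) * (a * hp + b * hq)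
      + 4 * L ^ 2 * ((a ^ 2 * a0 + 2 * a * b * a1 + b ^ 2 * a2) * (s * hq - t * hp)
        + (a ^ 2 * a1 + 2 * a * b * a2 + b ^ 2 * a3) * (s * hp - r * hq))
  trans -((L ^ 3 * D)⁻¹ * T)
  · rw [hT, hdd]
    ring
  · have hT' : T = L ^ 3 * W / (16 * D) := by
      rw [← hW.1]
      field_simp
    trans -(16 * D ^ 2)⁻¹ * W
    · rw [hT']
      field_simp
    · rw [hW.2, hdu, hdv, hdd]
      ring

/-! ### Global solutions of a scalar equation with bounded, signed slope. -/

section Leaves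

open scoped NNReal

/-- A time-dependent scalar field, Lipschitz in space and continuous in time, with `e * f` bounded
between two positive constants. -/
structure IsTransverseField (e : ℝ) (f : ℝ → ℝ → ℝ) (K : ℝ≥0) (m M : ℝ) : Prop where
  sign : e = 1 ∨ e = -1
  lip : ∀ t, LipschitzWith K (f t)
  cont : ∀ x, Continuous fun t => f t x
  pos : 0 < m
  lower : ∀ t x, m ≤ e * f t x
  upper : ∀ t x, e * f t x ≤ M

/-- The solution of `y' = f(t, y)` with `y(t₀) = x₀`. -/
noncomputable def leaf (f : ℝ → ℝ → ℝ) (t₀ x₀ : ℝ) : ℝ → ℝ :=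
  Classical.epsilon fun y => y t₀ = x₀ ∧ ∀ t, HasDerivAt y (f t (y t)) t

variable {e : ℝ} {f : ℝ → ℝ → ℝ} {K : ℝ≥0} {m M : ℝ}

/-- With speed at most `M` a solution stays within `M * T` of its start during time `T`, so
Picard–Lindelöf applies on intervals of every length. Uniqueness glues the solutions together. -/
theorem exists_global_solution (hlip : ∀ t, LipschitzWith K (f t))
    (hcont : ∀ x, Continuous fun t => f t x) (hb : ∀ t x, |f t x| ≤ M) (t₀ x₀ : ℝ) :
    ∃ y : ℝ → ℝ, y t₀ = x₀ ∧ ∀ t, HasDerivAt y (f t (y t)) t := by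
  have hM : 0 ≤ M := (abs_nonneg _).trans (hb 0 0)
  have loc : ∀ T : ℝ, 0 < T → ∃ y : ℝ → ℝ, y t₀ = x₀ ∧
      ∀ t ∈ Ioo (t₀ - T) (t₀ + T), HasDerivAt y (f t (y t)) t := by
    intro T hT
    have hmem : t₀ ∈ Icc (t₀ - T) (t₀ + T) := ⟨by linarith, by linarith⟩
    have hpl : IsPicardLindelof f (⟨t₀, hmem⟩ : Icc (t₀ - T) (t₀ + T)) x₀
        ⟨M * T, by positivity⟩ 0 ⟨M, hM⟩ K :=
      { lipschitzOnWith := fun t _ => (hlip t).lipschitzOnWith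
        continuousOn := fun x _ => (hcont x).continuousOn
        norm_le := fun t _ x _ => hb t x
        mul_max_le := by
          simp only [NNReal.coe_zero, sub_zero]
          rw [show t₀ + T - t₀ = T by ring, show t₀ - (t₀ - T) = T by ring, max_self]
          exact le_refl (M * T) }
    obtain ⟨y, hy0, hy⟩ := hpl.exists_eq_forall_mem_Icc_hasDerivWithinAt₀
    exact ⟨y, hy0, fun t ht => (hy t (Ioo_subset_Icc_self ht)).hasDerivAt
      (Icc_mem_nhds ht.1 ht.2)⟩
  choose! Y hY0 hY using loc
  have agree : ∀ S T : ℝ, 0 < S → S ≤ T → EqOn (Y S) (Y T) (Ioo (t₀ - S) (t₀ + S)) := by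
    intro S T hS hST
    refine ODE_solution_unique_of_mem_Ioo (v := f) (s := fun _ => univ) (t₀ := t₀)
      (fun t _ => (hlip t).lipschitzOnWith) ⟨by linarith, by linarith⟩
      (fun t ht => ⟨hY S hS t ht, mem_univ _⟩)
      (fun t ht => ⟨hY T (hS.trans_le hST) t ⟨by linarith [ht.1], by linarith [ht.2]⟩, mem_univ _⟩)
      ?_
    rw [hY0 S hS, hY0 T (hS.trans_le hST)]
  have hin : ∀ t S : ℝ, |t - t₀| < S → t ∈ Ioo (t₀ - S) (t₀ + S) := fun t S h => by
    rw [abs_lt] at h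
    exact ⟨by linarith, by linarith⟩
  -- The interval used varies with `t`; near a given `t` all these choices agree with the solution
  -- on the fixed larger interval of radius `|t - t₀| + 2`.
  refine ⟨fun t => Y (|t - t₀| + 1) t, hY0 _ (by positivity), fun t => ?_⟩
  have h1 := hY (|t - t₀| + 2) (by positivity) t (hin _ _ (by linarith))
  have h2 : (fun s => Y (|s - t₀| + 1) s) =ᶠ[𝓝 t] Y (|t - t₀| + 2) := by
    have hn : ∀ᶠ s in 𝓝 t, |s - t₀| < |t - t₀| + 1 :=
      (by fun_prop : Continuous fun s => |s - t₀|).continuousAt.eventually_lt continuousAt_const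
        (by linarith)
    filter_upwards [hn] with s hs
    exact agree _ _ (by positivity) (by linarith) (hin _ _ (by linarith))
  have h3 := h1.congr_of_eventuallyEq h2
  rwa [← h2.eq_of_nhds] at h3

namespace IsTransverseField

theorem abs_sign (h : IsTransverseField e f K m M) : |e| = 1 := by
  rcases h.sign with rfl | rfl <;> simp

theorem sign_mul_sign (h : IsTransverseField e f K m M) : e * e = 1 := by
  rcases h.sign with rfl | rfl <;> simp

theorem abs_le (h : IsTransverseField e f K m M) (t x : ℝ) : |f t x| ≤ M := by
  have h1 := h.lower t x
  have h2 := h.upper t x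
  have : |f t x| = |e * f t x| := by rw [abs_mul, h.abs_sign, one_mul]
  rw [this, abs_of_pos (h.pos.trans_le h1)]
  exact h2

theorem leaf_spec (h : IsTransverseField e f K m M) (t₀ x₀ : ℝ) :
    leaf f t₀ x₀ t₀ = x₀ ∧ ∀ t, HasDerivAt (leaf f t₀ x₀) (f t (leaf f t₀ x₀ t)) t :=
  Classical.epsilon_spec (exists_global_solution h.lip h.cont h.abs_le t₀ x₀)

theorem leaf_self (h : IsTransverseField e f K m M) (t₀ x₀ : ℝ) : leaf f t₀ x₀ t₀ = x₀ :=
  (h.leaf_spec t₀ x₀).1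

theorem hasDerivAt_leaf (h : IsTransverseField e f K m M) (t₀ x₀ t : ℝ) :
    HasDerivAt (leaf f t₀ x₀) (f t (leaf f t₀ x₀ t)) t :=
  (h.leaf_spec t₀ x₀).2 t

theorem eq_leaf_of_mem (h : IsTransverseField e f K m M) {I : Set ℝ} (hIo : IsOpen I)
    (hI : I.OrdConnected) {y : ℝ → ℝ} (hy : ∀ t ∈ I, HasDerivAt y (f t (y t)) t) {s t : ℝ}
    (hs : s ∈ I) (ht : t ∈ I) : y t = leaf f s (y s) t := by
  obtain ⟨a, b, ha, hab⟩ : ∃ a b, (s ∈ Ioo a b ∧ t ∈ Ioo a b) ∧ Ioo a b ⊆ I := by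
    have hmin : min s t ∈ I := by rcases min_choice s t with h | h <;> rwa [h]
    have hmax : max s t ∈ I := by rcases max_choice s t with h | h <;> rwa [h]
    obtain ⟨ε, hε, hεI⟩ := Metric.isOpen_iff.1 hIo _ hmin
    obtain ⟨δ, hδ, hδI⟩ := Metric.isOpen_iff.1 hIo _ hmax
    have h1 : min s t - ε / 2 ∈ I := hεI (by
      rw [Metric.mem_ball, Real.dist_eq, sub_sub_cancel_left, abs_neg, abs_of_pos] <;> linarith)
    have h2 : max s t + δ / 2 ∈ I := hδI (by
      rw [Metric.mem_ball, Real.dist_eq, add_sub_cancel_left, abs_of_pos] <;> linarith)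
    refine ⟨min s t - ε / 2, max s t + δ / 2, ⟨⟨?_, ?_⟩, ?_, ?_⟩,
      Ioo_subset_Icc_self.trans (hI.out h1 h2)⟩
    · linarith [min_le_left s t]
    · linarith [le_max_left s t]
    · linarith [min_le_right s t]
    · linarith [le_max_right s t]
  exact ODE_solution_unique_of_mem_Ioo (v := f) (s := fun _ => univ) (t₀ := s)
    (fun t _ => (h.lip t).lipschitzOnWith) ha.1 (fun t ht => ⟨hy t (hab ht), mem_univ _⟩)
    (fun t _ => ⟨h.hasDerivAt_leaf _ _ t, mem_univ _⟩) (h.leaf_self _ _).symm ha.2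

theorem leaf_leaf (h : IsTransverseField e f K m M) (t₀ x₀ s : ℝ) :
    leaf f s (leaf f t₀ x₀ s) = leaf f t₀ x₀ := by
  funext t
  exact (h.eq_leaf_of_mem isOpen_univ ordConnected_univ
    (fun t _ => h.hasDerivAt_leaf t₀ x₀ t) (mem_univ s) (mem_univ t)).symm

theorem leaf_slope (h : IsTransverseField e f K m M) (t₀ x₀ : ℝ) {s t : ℝ} (hst : s ≤ t) :
    m * (t - s) ≤ e * (leaf f t₀ x₀ t - leaf f t₀ x₀ s) ∧
      e * (leaf f t₀ x₀ t - leaf f t₀ x₀ s) ≤ M * (t - s) := by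
  have hd : ∀ t, HasDerivAt (fun t => e * leaf f t₀ x₀ t) (e * f t (leaf f t₀ x₀ t)) t :=
    fun t => (h.hasDerivAt_leaf t₀ x₀ t).const_mul e
  have hdiff : Differentiable ℝ fun t => e * leaf f t₀ x₀ t := fun t => (hd t).differentiableAt
  rw [mul_sub e]
  refine ⟨mul_sub_le_image_sub_of_le_deriv hdiff (fun t => ?_) hst,
    image_sub_le_mul_sub_of_deriv_le hdiff (fun t => ?_) hst⟩
  · rw [(hd t).deriv]; exact h.lower _ _
  · rw [(hd t).deriv]; exact h.upper _ _

theorem abs_leaf_sub_le (h : IsTransverseField e f K m M) (t₀ x₀ s t : ℝ) :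
    |leaf f t₀ x₀ t - leaf f t₀ x₀ s| ≤ M * |t - s| := by
  have key : ∀ {s t : ℝ}, s ≤ t → |leaf f t₀ x₀ t - leaf f t₀ x₀ s| ≤ M * |t - s| := by
    intro s t hst
    have h1 := h.leaf_slope t₀ x₀ hst
    have h0 : 0 ≤ m * (t - s) := mul_nonneg h.pos.le (by linarith)
    rw [abs_of_nonneg (sub_nonneg.2 hst), ← one_mul |leaf f t₀ x₀ t - _|, ← h.abs_sign, ← abs_mul,
      abs_of_nonneg (h0.trans h1.1)]
    exact h1.2
  rcases le_total s t with hst | hst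
  · exact key hst
  · rw [abs_sub_comm, abs_sub_comm t]
    exact key hst

theorem abs_leaf_sub_leaf_le (h : IsTransverseField e f K m M) (t₀ x₀ x₁ t : ℝ) :
    |leaf f t₀ x₀ t - leaf f t₀ x₁ t| ≤ |x₀ - x₁| * Real.exp (K * |t - t₀|) := by
  rcases le_total t₀ t with ht | ht
  · have := dist_le_of_trajectories_ODE (v := f) (f := leaf f t₀ x₀) (g := leaf f t₀ x₁)
      (δ := |x₀ - x₁|) (a := t₀) (b := t) h.lip
      (fun s _ => (h.hasDerivAt_leaf t₀ x₀ s).continuousAt.continuousWithinAt)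
      (fun s _ => (h.hasDerivAt_leaf t₀ x₀ s).hasDerivWithinAt)
      (fun s _ => (h.hasDerivAt_leaf t₀ x₁ s).continuousAt.continuousWithinAt)
      (fun s _ => (h.hasDerivAt_leaf t₀ x₁ s).hasDerivWithinAt)
      (by rw [h.leaf_self, h.leaf_self, Real.dist_eq]) t ⟨ht, le_rfl⟩
    rwa [Real.dist_eq, ← abs_of_nonneg (sub_nonneg.2 ht)] at this
  -- The Grönwall estimate runs forward in time, so earlier times are handled by reversing time.
  · have hd : ∀ x s, HasDerivAt (fun s => leaf f t₀ x (-s)) (-f (-s) (leaf f t₀ x (-s))) s := by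
      intro x s
      simpa using! (h.hasDerivAt_leaf t₀ x (-s)).scomp s (hasDerivAt_neg s)
    have := dist_le_of_trajectories_ODE (v := fun s x => -f (-s) x)
      (f := fun s => leaf f t₀ x₀ (-s)) (g := fun s => leaf f t₀ x₁ (-s))
      (δ := |x₀ - x₁|) (a := -t₀) (b := -t) (K := K) (fun s => (h.lip (-s)).neg)
      (fun s _ => (hd x₀ s).continuousAt.continuousWithinAt)
      (fun s _ => (hd x₀ s).hasDerivWithinAt)
      (fun s _ => (hd x₁ s).continuousAt.continuousWithinAt)
      (fun s _ => (hd x₁ s).hasDerivWithinAt)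
      (by simp only [neg_neg]; rw [h.leaf_self, h.leaf_self, Real.dist_eq]) (-t)
      ⟨by linarith, le_rfl⟩
    simp only [neg_neg] at this
    rwa [Real.dist_eq, show -t - -t₀ = -(t - t₀) by ring, ← abs_of_nonpos (by linarith)] at this

/-- A change of final time costs at most `M` times its size. A change of initial time is, by
`leaf_leaf`, a change of initial value at the old time, and changes of initial value are controlled
by Grönwall. -/
theorem continuous_leaf (h : IsTransverseField e f K m M) :
    Continuous fun z : ℝ × ℝ × ℝ => leaf f z.1 z.2.1 z.2.2 := by
  rw [continuous_iff_continuousAt]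
  rintro ⟨t₀, x₀, t⟩
  have bound : ∀ z : ℝ × ℝ × ℝ, |leaf f z.1 z.2.1 z.2.2 - leaf f t₀ x₀ t| ≤
      M * |z.2.2 - t| + (|z.2.1 - x₀| + M * |t₀ - z.1|) * Real.exp (K * |t - t₀|) := by
    rintro ⟨t₁, x₁, s⟩
    have h1 := h.abs_leaf_sub_le t₁ x₁ t s
    have h2 := h.abs_leaf_sub_leaf_le t₀ (leaf f t₁ x₁ t₀) x₀ t
    rw [h.leaf_leaf] at h2
    have h3 := h.abs_leaf_sub_le t₁ x₁ t₁ t₀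
    rw [h.leaf_self] at h3
    have h4 : |leaf f t₁ x₁ t₀ - x₀| ≤ |x₁ - x₀| + M * |t₀ - t₁| := by
      have := abs_sub_le (leaf f t₁ x₁ t₀) x₁ x₀
      linarith
    have h5 := mul_le_mul_of_nonneg_right h4 (Real.exp_pos (K * |t - t₀|)).le
    have h6 := abs_sub_le (leaf f t₁ x₁ s) (leaf f t₁ x₁ t) (leaf f t₀ x₀ t)
    simp only
    linarith
  rw [ContinuousAt, tendsto_iff_dist_tendsto_zero]
  refine squeeze_zero (fun _ => dist_nonneg) (fun z => (Real.dist_eq _ _).trans_le (bound z)) ?_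
  refine Continuous.tendsto' (by fun_prop) _ _ ?_
  simp

end IsTransverseField

end Leaves

/-! ### Crossings of leaves with a vertical level and with each other. -/

section Crossing

open scoped NNReal

/-- A quantitative form of strict monotonicity, which yields both the uniqueness of meeting times
and the continuous dependence of roots on parameters. -/
theorem root_dist_le {F : ℝ → ℝ} {m : ℝ} (hs : ∀ s t, s ≤ t → m * (t - s) ≤ F t - F s)
    {r : ℝ} (hr : F r = 0) (t : ℝ) : m * |t - r| ≤ |F t| := by
  rcases le_total r t with h | h
  · have := hs r t h
    rw [abs_of_nonneg (sub_nonneg.2 h)]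
    linarith [le_abs_self (F t)]
  · have := hs t r h
    rw [abs_of_nonpos (sub_nonpos.2 h)]
    linarith [neg_le_abs (F t)]

theorem exists_root {F : ℝ → ℝ} (hc : Continuous F) {m : ℝ} (hm : 0 < m)
    (hs : ∀ s t, s ≤ t → m * (t - s) ≤ F t - F s) : ∃ r, F r = 0 := by
  have hpos : 0 ≤ |F 0| / m := by positivity
  have e1 : m * (|F 0| / m) = |F 0| := by field_simp
  have h1 := hs 0 (|F 0| / m) hpos
  have h2 := hs (-(|F 0| / m)) 0 (by linarith)
  have := intermediate_value_Icc (f := F) (show -(|F 0| / m) ≤ |F 0| / m by linarith)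
    hc.continuousOn
  obtain ⟨r, -, hr⟩ := this (show (0 : ℝ) ∈ _ from
    ⟨by linarith [le_abs_self (F 0)], by linarith [neg_le_abs (F 0)]⟩)
  exact ⟨r, hr⟩

theorem continuous_root {Z : Type*} [TopologicalSpace Z] {F : Z → ℝ → ℝ}
    (hc : ∀ t, Continuous fun z => F z t) {m : ℝ} (hm : 0 < m)
    (hs : ∀ z s t, s ≤ t → m * (t - s) ≤ F z t - F z s) {r : Z → ℝ} (hr : ∀ z, F z (r z) = 0) :
    Continuous r := by
  rw [continuous_iff_continuousAt]
  intro z₀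
  rw [ContinuousAt, tendsto_iff_dist_tendsto_zero]
  have h1 : Tendsto (fun z => |F z (r z₀)| / m) (𝓝 z₀) (𝓝 0) :=
    ((hc (r z₀)).abs.div_const m).tendsto' _ _ (by simp [hr])
  refine squeeze_zero (fun _ => dist_nonneg) (fun z => ?_) h1
  rw [dist_comm, Real.dist_eq, le_div_iff₀ hm, mul_comm]
  exact root_dist_le (hs z) (hr z) (r z₀)

/-- The time at which the leaf through `(t, x)` reaches height `L`. -/
noncomputable def crossTime (f : ℝ → ℝ → ℝ) (L t x : ℝ) : ℝ :=
  Classical.epsilon fun s => leaf f t x s = L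

/-- The time at which the leaf of `f` through `(a, L)` meets the leaf of `g` through `(b, L)`. -/
noncomputable def meetTime (f g : ℝ → ℝ → ℝ) (L a b : ℝ) : ℝ :=
  Classical.epsilon fun t => leaf f a L t = leaf g b L t

variable {e : ℝ} {f g : ℝ → ℝ → ℝ} {K K' : ℝ≥0} {m M m' M' : ℝ} {L : ℝ}

namespace IsTransverseField

theorem sign_ne_zero (h : IsTransverseField e f K m M) : e ≠ 0 := by
  rcases h.sign with rfl | rfl <;> simp

theorem differentiable_leaf (h : IsTransverseField e f K m M) (t x : ℝ) :
    Differentiable ℝ (leaf f t x) := fun s => (h.hasDerivAt_leaf t x s).differentiableAt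

theorem leaf_inj (h : IsTransverseField e f K m M) {t₀ x₀ s t : ℝ}
    (hst : leaf f t₀ x₀ s = leaf f t₀ x₀ t) : s = t := by
  rcases lt_trichotomy s t with hlt | rfl | hlt
  · have := (h.leaf_slope t₀ x₀ hlt.le).1
    rw [hst] at this
    have := mul_pos h.pos (sub_pos.2 hlt)
    linarith
  · rfl
  · have := (h.leaf_slope t₀ x₀ hlt.le).1
    rw [hst] at this
    have := mul_pos h.pos (sub_pos.2 hlt)
    linarith

theorem leaf_crossTime (h : IsTransverseField e f K m M) (L t x : ℝ) :
    leaf f t x (crossTime f L t x) = L := by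
  have : ∃ s, leaf f t x s = L := by
    obtain ⟨r, hr⟩ := exists_root (F := fun s => e * (leaf f t x s - L)) (m := m)
      (((h.differentiable_leaf t x).continuous.sub continuous_const).const_mul e) h.pos
      (fun s t' hst => by linarith [(h.leaf_slope t x hst).1])
    exact ⟨r, sub_eq_zero.1 ((mul_eq_zero.1 hr).resolve_left h.sign_ne_zero)⟩
  exact Classical.epsilon_spec this

theorem crossTime_eq (h : IsTransverseField e f K m M) {t x s : ℝ} (hs : leaf f t x s = L) :
    crossTime f L t x = s :=
  h.leaf_inj ((h.leaf_crossTime L t x).trans hs.symm)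

theorem leaf_of_crossTime (h : IsTransverseField e f K m M) (L t x : ℝ) :
    leaf f (crossTime f L t x) L = leaf f t x := by
  conv_lhs => rw [← h.leaf_crossTime L t x]
  have := h.leaf_leaf t x (crossTime f L t x)
  rwa [h.leaf_crossTime L t x] at this ⊢

theorem crossTime_leaf (h : IsTransverseField e f K m M) (a t : ℝ) :
    crossTime f L t (leaf f a L t) = a :=
  h.crossTime_eq (by rw [h.leaf_leaf, h.leaf_self])

theorem continuous_crossTime (h : IsTransverseField e f K m M) (L : ℝ) :
    Continuous fun z : ℝ × ℝ => crossTime f L z.1 z.2 := by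
  refine continuous_root (F := fun (z : ℝ × ℝ) s => e * (leaf f z.1 z.2 s - L)) (m := m)
    (fun s => ?_) h.pos (fun z s t hst => by linarith [(h.leaf_slope z.1 z.2 hst).1])
    (fun z => by rw [h.leaf_crossTime]; simp)
  have := h.continuous_leaf.comp (by fun_prop : Continuous fun z : ℝ × ℝ => (z.1, z.2, s))
  exact (this.sub continuous_const).const_mul e

/-- `e * x` rises at rate at least `m` along leaves of `f` and falls along leaves of `g`, so the gap
between two such leaves grows linearly. This is why they meet exactly once. -/
theorem meet_slope (hf : IsTransverseField e f K m M) (hg : IsTransverseField (-e) g K' m' M')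
    (a b s t : ℝ) (hst : s ≤ t) : m * (t - s) ≤
      e * (leaf f a L t - leaf g b L t) - e * (leaf f a L s - leaf g b L s) := by
  have h1 := (hf.leaf_slope a L hst).1
  have h2 := (hg.leaf_slope b L hst).1
  have h3 : 0 ≤ m' * (t - s) := mul_nonneg hg.pos.le (by linarith)
  linarith

theorem leaf_meetTime (hf : IsTransverseField e f K m M) (hg : IsTransverseField (-e) g K' m' M')
    (L a b : ℝ) : leaf f a L (meetTime f g L a b) = leaf g b L (meetTime f g L a b) := by
  have : ∃ t, leaf f a L t = leaf g b L t := by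
    obtain ⟨r, hr⟩ := exists_root (F := fun t => e * (leaf f a L t - leaf g b L t)) (m := m)
      (((hf.differentiable_leaf a L).continuous.sub
        (hg.differentiable_leaf b L).continuous).const_mul e) hf.pos (hf.meet_slope hg a b)
    exact ⟨r, sub_eq_zero.1 ((mul_eq_zero.1 hr).resolve_left hf.sign_ne_zero)⟩
  exact Classical.epsilon_spec this

theorem meetTime_eq (hf : IsTransverseField e f K m M) (hg : IsTransverseField (-e) g K' m' M')
    {a b t : ℝ} (ht : leaf f a L t = leaf g b L t) : meetTime f g L a b = t := by
  have h1 := root_dist_le (F := fun t => e * (leaf f a L t - leaf g b L t))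
    (hf.meet_slope hg a b) (r := t) (by rw [ht]; ring) (meetTime f g L a b)
  simp only [hf.leaf_meetTime hg, sub_self, mul_zero, abs_zero] at h1
  have h2 := nonpos_of_mul_nonpos_right h1 hf.pos
  exact sub_eq_zero.1 (abs_eq_zero.1 (le_antisymm h2 (abs_nonneg _)))

theorem continuous_meetTime (hf : IsTransverseField e f K m M)
    (hg : IsTransverseField (-e) g K' m' M') (L : ℝ) :
    Continuous fun z : ℝ × ℝ => meetTime f g L z.1 z.2 := by
  refine continuous_root
    (F := fun (z : ℝ × ℝ) t => e * (leaf f z.1 L t - leaf g z.2 L t)) (m := m)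
    (fun t => ?_) hf.pos (fun z => hf.meet_slope hg z.1 z.2)
    (fun z => by rw [hf.leaf_meetTime hg]; simp)
  have h1 := hf.continuous_leaf.comp (by fun_prop : Continuous fun z : ℝ × ℝ => (z.1, L, t))
  have h2 := hg.continuous_leaf.comp (by fun_prop : Continuous fun z : ℝ × ℝ => (z.2, L, t))
  exact (h1.sub h2).const_mul e

/-- Leaves through later points of the line `x = L` lie on one side. -/
theorem leaf_lt_of_lt (h : IsTransverseField e f K m M) {a b : ℝ} (hab : a < b) (t : ℝ) :
    0 < e * (leaf f a L t - leaf f b L t) := by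
  -- Distinct leaves never meet, so the difference keeps its sign; the sign is read off at `t = b`.
  have hne : ∀ t, e * (leaf f a L t - leaf f b L t) ≠ 0 := by
    intro t h0
    have h1 := sub_eq_zero.1 ((mul_eq_zero.1 h0).resolve_left h.sign_ne_zero)
    have h2 : leaf f a L = leaf f b L := by
      rw [← h.leaf_leaf a L t, ← h.leaf_leaf b L t, h1]
    have h3 : leaf f a L a = leaf f a L b := by
      rw [h.leaf_self, h2, h.leaf_self]
    exact hab.ne (h.leaf_inj h3)
  have hpos : 0 < e * (leaf f a L b - leaf f b L b) := by
    have h1 := (h.leaf_slope a L hab.le).1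
    rw [h.leaf_self] at h1 ⊢
    exact (mul_pos h.pos (sub_pos.2 hab)).trans_le h1
  by_contra hneg
  have hc : Continuous fun t => e * (leaf f a L t - leaf f b L t) :=
    ((h.differentiable_leaf a L).continuous.sub (h.differentiable_leaf b L).continuous).const_mul e
  obtain ⟨s, hs⟩ := mem_range_of_exists_le_of_exists_ge hc ⟨t, not_lt.1 hneg⟩ ⟨b, hpos.le⟩
  exact hne s hs

theorem leaf_le_of_le (h : IsTransverseField e f K m M) {a b : ℝ} (hab : a ≤ b) (t : ℝ) :
    0 ≤ e * (leaf f a L t - leaf f b L t) := by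
  rcases hab.eq_or_lt with rfl | hlt
  · simp
  · exact (h.leaf_lt_of_lt hlt t).le

/-- Along a leaf of `f` the coordinate `crossTime g` increases. -/
theorem crossTime_lt_of_lt (hf : IsTransverseField e f K m M)
    (hg : IsTransverseField (-e) g K' m' M') (a : ℝ) {s t : ℝ} (hst : s < t) :
    crossTime g L s (leaf f a L s) < crossTime g L t (leaf f a L t) := by
  -- If the label did not increase, the leaf of `g` through the later point would at time `s` lie,
  -- in the order of `e * x`, at or below the point of the `f`-leaf. It descends up to time `t`
  -- while the `f`-leaf ascends, yet the two agree at `t`.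
  by_contra hle
  have h1 := hg.leaf_le_of_le (L := L) (not_lt.1 hle) s
  have e1 : leaf g (crossTime g L s (leaf f a L s)) L s = leaf f a L s := by
    rw [hg.leaf_of_crossTime, hg.leaf_self]
  have e2 : leaf g (crossTime g L t (leaf f a L t)) L t = leaf f a L t := by
    rw [hg.leaf_of_crossTime, hg.leaf_self]
  have h2 := (hg.leaf_slope (crossTime g L t (leaf f a L t)) L hst.le).1
  have h3 := (hf.leaf_slope a L hst.le).1
  rw [e1] at h1
  rw [e2] at h2
  have h4 := mul_pos hf.pos (sub_pos.2 hst)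
  have h5 := mul_pos hg.pos (sub_pos.2 hst)
  linarith

theorem meetTime_lt_of_lt (hf : IsTransverseField e f K m M)
    (hg : IsTransverseField (-e) g K' m' M') (a : ℝ) {b b' : ℝ} (hb : b < b') :
    meetTime f g L a b < meetTime f g L a b' := by
  by_contra hle
  have key : ∀ b, crossTime g L (meetTime f g L a b) (leaf f a L (meetTime f g L a b)) = b := by
    intro b
    rw [hf.leaf_meetTime hg]
    exact hg.crossTime_leaf b _
  rcases (not_lt.1 hle).eq_or_lt with h | h
  · have h1 := key b
    rw [← h, key b'] at h1
    exact hb.ne h1.symm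
  · have h1 := hf.crossTime_lt_of_lt (L := L) hg a h
    rw [key, key] at h1
    exact hb.not_gt h1

section Periodic

theorem leaf_add_period (h : IsTransverseField e f K m M) {T : ℝ}
    (hT : ∀ t x, f (t + T) x = f t x) (t₀ x₀ t : ℝ) :
    leaf f (t₀ + T) x₀ (t + T) = leaf f t₀ x₀ t := by
  have hd : ∀ s ∈ univ, HasDerivAt (fun s => leaf f (t₀ + T) x₀ (s + T))
      (f s (leaf f (t₀ + T) x₀ (s + T))) s := by
    intro s _
    have := (h.hasDerivAt_leaf (t₀ + T) x₀ (s + T)).comp_add_const s T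
    rwa [hT] at this
  have := h.eq_leaf_of_mem isOpen_univ ordConnected_univ hd (mem_univ t₀) (mem_univ t)
  simpa only [h.leaf_self] using this

theorem crossTime_add_period (h : IsTransverseField e f K m M) {T : ℝ}
    (hT : ∀ t x, f (t + T) x = f t x) (t x : ℝ) :
    crossTime f L (t + T) x = crossTime f L t x + T :=
  h.crossTime_eq (by rw [h.leaf_add_period hT, h.leaf_crossTime])

theorem meetTime_add_period (hf : IsTransverseField e f K m M)
    (hg : IsTransverseField (-e) g K' m' M') {T : ℝ} (hfT : ∀ t x, f (t + T) x = f t x)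
    (hgT : ∀ t x, g (t + T) x = g t x) (a b : ℝ) :
    meetTime f g L (a + T) (b + T) = meetTime f g L a b + T :=
  hf.meetTime_eq hg (by rw [hf.leaf_add_period hfT, hg.leaf_add_period hgT, hf.leaf_meetTime hg])

end Periodic

end IsTransverseField

end Crossing

/-! ### Logarithmic polar coordinates as a covering of the punctured plane. -/

section LogPolar

/-- Logarithmic polar coordinates. -/
noncomputable def logPolar (q : ℝ × ℝ) : ℝ × ℝ := polarMap (Real.exp q.1, q.2)

/-- Rotation by a right angle. -/
def rot (p : ℝ × ℝ) : ℝ × ℝ := (-p.2, p.1)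

/-- A (discontinuous) section of `logPolar`. -/
noncomputable def logPolarSection (p : ℝ × ℝ) : ℝ × ℝ :=
  Complex.equivRealProdCLM (Complex.log (Complex.equivRealProdCLM.symm p))

/-- Identifying the plane with `ℂ` supplies surjectivity onto the nonzero points, the period lattice
and openness from the complex exponential. -/
theorem logPolar_eq_exp (q : ℝ × ℝ) :
    logPolar q = Complex.equivRealProdCLM (Complex.exp (Complex.equivRealProdCLM.symm q)) := by
  have h : Complex.equivRealProdCLM.symm q = ⟨q.1, q.2⟩ := by
    apply Complex.equivRealProdCLM.injective
    rw [ContinuousLinearEquiv.apply_symm_apply]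
    rfl
  rw [h]
  ext <;> simp [logPolar, polarMap, Complex.equivRealProdCLM_apply, Complex.exp_re, Complex.exp_im]

theorem logPolar_logPolarSection {p : ℝ × ℝ} (hp : p ≠ 0) : logPolar (logPolarSection p) = p := by
  rw [logPolar_eq_exp, logPolarSection, ContinuousLinearEquiv.symm_apply_apply, Complex.exp_log,
    ContinuousLinearEquiv.apply_symm_apply]
  simpa using hp

theorem logPolar_ne_zero (q : ℝ × ℝ) : logPolar q ≠ 0 := by
  rw [logPolar_eq_exp]
  exact fun h => Complex.exp_ne_zero _
    (Complex.equivRealProdCLM.injective (h.trans (map_zero _).symm))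

theorem exists_logPolar_eq {p : ℝ × ℝ} (hp : p ≠ 0) : ∃ q, logPolar q = p :=
  ⟨_, logPolar_logPolarSection hp⟩

theorem exists_int_of_logPolar_eq {q q' : ℝ × ℝ} (h : logPolar q = logPolar q') :
    ∃ k : ℤ, q = (q'.1, q'.2 + k * (2 * Real.pi)) := by
  rw [logPolar_eq_exp, logPolar_eq_exp] at h
  obtain ⟨k, hk⟩ := Complex.exp_eq_exp_iff_exists_int.1 (Complex.equivRealProdCLM.injective h)
  refine ⟨k, ?_⟩
  have := congrArg Complex.equivRealProdCLM hk
  rw [ContinuousLinearEquiv.apply_symm_apply, map_add, ContinuousLinearEquiv.apply_symm_apply]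
    at this
  rw [this]
  ext <;> simp [Complex.equivRealProdCLM_apply]

theorem isOpenMap_logPolar : IsOpenMap logPolar := by
  have : logPolar = Complex.equivRealProdCLM ∘ Complex.exp ∘ Complex.equivRealProdCLM.symm :=
    funext logPolar_eq_exp
  rw [this]
  exact Complex.equivRealProdCLM.isOpenMap.comp
    (Complex.isOpenMap_exp.comp Complex.equivRealProdCLM.symm.isOpenMap)

theorem continuous_logPolar : Continuous logPolar := by
  unfold logPolar polarMap
  fun_prop

theorem logPolar_normSq (q : ℝ × ℝ) :
    (logPolar q).1 ^ 2 + (logPolar q).2 ^ 2 = Real.exp q.1 ^ 2 := by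
  simp only [logPolar, polarMap]
  linear_combination Real.exp q.1 ^ 2 * Real.sin_sq_add_cos_sq q.2

theorem logPolar_mem_disc {ρ : ℝ} (hρ : 0 < ρ) (q : ℝ × ℝ) :
    logPolar q ∈ disc ρ ↔ q.1 < Real.log ρ := by
  change (logPolar q).1 ^ 2 + (logPolar q).2 ^ 2 < ρ ^ 2 ↔ _
  rw [logPolar_normSq, Real.lt_log_iff_exp_lt hρ, pow_lt_pow_iff_left₀ (Real.exp_pos _).le hρ.le
    two_ne_zero]

theorem hasDerivAt_logPolar {x t : ℝ → ℝ} {x' t' s : ℝ} (hx : HasDerivAt x x' s)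
    (ht : HasDerivAt t t' s) : HasDerivAt (fun s => logPolar (x s, t s))
      (x' • logPolar (x s, t s) + t' • rot (logPolar (x s, t s))) s := by
  have h1 := (hx.exp.mul ht.cos).prodMk (hx.exp.mul ht.sin)
  convert! h1 using 1
  ext <;> simp [logPolar, polarMap, rot] <;> ring

theorem isOpen_disc (ρ : ℝ) : IsOpen (disc ρ) :=
  isOpen_lt (by fun_prop) continuous_const

/-- A curve with derivative `k γ + J γ` turns with unit angular speed. -/
theorem exists_logPolar_lift {I : Set ℝ} (hIo : IsOpen I) (hI : I.OrdConnected) {γ : ℝ → ℝ × ℝ}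
    {k : ℝ → ℝ} (h0 : ∀ s ∈ I, γ s ≠ 0)
    (hd : ∀ s ∈ I, HasDerivAt γ (k s • γ s + rot (γ s)) s) :
    ∃ (t₀ : ℝ) (x : ℝ → ℝ), ∀ s ∈ I, γ s = logPolar (x s, s + t₀) ∧ HasDerivAt x (k s) s := by
  rcases I.eq_empty_or_nonempty with rfl | ⟨s₀, hs₀⟩
  · exact ⟨0, 0, by simp⟩
  let N : ℝ → ℝ := fun s => (γ s).1 ^ 2 + (γ s).2 ^ 2
  let x : ℝ → ℝ := fun s => Real.log (N s) / 2
  have hN : ∀ s ∈ I, 0 < N s := by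
    intro s hs
    rcases ne_or_eq (γ s).1 0 with h | h
    · have := pow_pos (abs_pos.2 h) 2
      rw [sq_abs] at this
      have h2 := sq_nonneg (γ s).2
      change 0 < _ + _
      linarith
    · have h' : (γ s).2 ≠ 0 := fun h' => h0 s hs (Prod.ext h h')
      have := pow_pos (abs_pos.2 h') 2
      rw [sq_abs] at this
      have h2 := sq_nonneg (γ s).1
      change 0 < _ + _
      linarith
  have hd1 : ∀ s ∈ I, HasDerivAt (fun s => (γ s).1) (k s * (γ s).1 - (γ s).2) s := by
    intro s hs
    have := (hasFDerivAt_fst (p := γ s)).comp_hasDerivAt s (hd s hs)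
    simpa [rot, sub_eq_add_neg] using! this
  have hd2 : ∀ s ∈ I, HasDerivAt (fun s => (γ s).2) (k s * (γ s).2 + (γ s).1) s := by
    intro s hs
    have := (hasFDerivAt_snd (p := γ s)).comp_hasDerivAt s (hd s hs)
    simpa [rot] using! this
  have hx : ∀ s ∈ I, HasDerivAt x (k s) s := by
    intro s hs
    have h1 := (((hd1 s hs).fun_pow 2).fun_add ((hd2 s hs).fun_pow 2)).log (hN s hs).ne'
    convert! h1.div_const 2 using 1
    have := (hN s hs).ne'
    simp only [N] at this
    field_simp
    ring
  have hex : ∀ s ∈ I, Real.exp (x s) ^ 2 = N s := by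
    intro s hs
    rw [← Real.exp_nat_mul]
    change Real.exp ((2 : ℕ) * (Real.log (N s) / 2)) = _
    rw [Nat.cast_ofNat, mul_div_cancel₀ _ two_ne_zero, Real.exp_log (hN s hs)]
  -- `(u, v)` is `γ s` divided by its norm and rotated back by the angle `s`. It is a constant unit
  -- vector, whose argument is the required `t₀`.
  let u : ℝ → ℝ := fun s => Real.exp (-x s) * ((γ s).1 * Real.cos s + (γ s).2 * Real.sin s)
  let v : ℝ → ℝ := fun s => Real.exp (-x s) * ((γ s).2 * Real.cos s - (γ s).1 * Real.sin s)
  have hu : ∀ s ∈ I, HasDerivAt u 0 s := by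
    intro s hs
    have h1 := (hx s hs).neg.exp.mul (((hd1 s hs).mul (Real.hasDerivAt_cos s)).add
      ((hd2 s hs).mul (Real.hasDerivAt_sin s)))
    convert! h1 using 1
    simp only [Pi.neg_apply, Pi.add_apply, Pi.mul_apply]
    ring
  have hv : ∀ s ∈ I, HasDerivAt v 0 s := by
    intro s hs
    have h1 := (hx s hs).neg.exp.mul (((hd2 s hs).mul (Real.hasDerivAt_cos s)).sub
      ((hd1 s hs).mul (Real.hasDerivAt_sin s)))
    convert! h1 using 1
    simp only [Pi.neg_apply, Pi.sub_apply, Pi.mul_apply]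
    ring
  have hconst : ∀ w : ℝ → ℝ, (∀ s ∈ I, HasDerivAt w 0 s) → ∀ s ∈ I, w s = w s₀ := by
    intro w hw s hs
    exact hIo.is_const_of_deriv_eq_zero hI.isPreconnected
      (fun s hs => (hw s hs).differentiableAt.differentiableWithinAt)
      (fun s hs => (hw s hs).deriv) hs hs₀
  have hγ0 : ((u s₀, v s₀) : ℝ × ℝ) ≠ 0 ∧ u s₀ ^ 2 + v s₀ ^ 2 = 1 := by
    have h1 : u s₀ ^ 2 + v s₀ ^ 2 = 1 := by
      have h2 : Real.exp (-x s₀) * Real.exp (x s₀) = 1 := by rw [← Real.exp_add]; simp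
      have h3 : u s₀ ^ 2 + v s₀ ^ 2 = Real.exp (-x s₀) ^ 2 * N s₀ := by
        simp only [u, v, N]
        linear_combination Real.exp (-x s₀) ^ 2 * ((γ s₀).1 ^ 2 + (γ s₀).2 ^ 2)
          * Real.sin_sq_add_cos_sq s₀
      rw [h3, ← hex s₀ hs₀, ← mul_pow, h2, one_pow]
    refine ⟨fun h => ?_, h1⟩
    have hu0 : u s₀ = 0 := congrArg Prod.fst h
    have hv0 : v s₀ = 0 := congrArg Prod.snd h
    rw [hu0, hv0] at h1
    norm_num at h1
  obtain ⟨q, hq⟩ := exists_logPolar_eq hγ0.1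
  have hq1 : Real.exp q.1 = 1 := by
    have h1 := logPolar_normSq q
    rw [hq, hγ0.2] at h1
    have h2 := Real.exp_pos q.1
    nlinarith
  have hcos : u s₀ = Real.cos q.2 := by
    have := congrArg Prod.fst hq
    simp only [logPolar, polarMap, hq1, one_mul] at this
    exact this.symm
  have hsin : v s₀ = Real.sin q.2 := by
    have := congrArg Prod.snd hq
    simp only [logPolar, polarMap, hq1, one_mul] at this
    exact this.symm
  refine ⟨q.2, x, fun s hs => ⟨?_, hx s hs⟩⟩
  have h1 := hconst u hu s hs
  have h2 := hconst v hv s hs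
  rw [hcos] at h1
  rw [hsin] at h2
  have h3 : Real.exp (x s) * Real.exp (-x s) = 1 := by rw [← Real.exp_add]; simp
  have h4 := Real.sin_sq_add_cos_sq s
  simp only [u, v] at h1 h2
  ext
  · simp only [logPolar, polarMap, Real.cos_add, ← h1, ← h2]
    linear_combination -(γ s).1 * h4 - (γ s).1 * (Real.sin s ^ 2 + Real.cos s ^ 2) * h3
  · simp only [logPolar, polarMap, Real.sin_add, ← h1, ← h2]
    linear_combination -(γ s).2 * h4 - (γ s).2 * (Real.sin s ^ 2 + Real.cos s ^ 2) * h3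

/-- The map of the plane induced through `logPolar`. -/
noncomputable def descend (Ψ : ℝ × ℝ → ℝ × ℝ) (p : ℝ × ℝ) : ℝ × ℝ :=
  open Classical in if p = 0 then 0 else logPolar (Ψ (logPolarSection p))

theorem logPolar_add_int (q : ℝ × ℝ) (k : ℤ) :
    logPolar (q.1, q.2 + k * (2 * Real.pi)) = logPolar q := by
  simp [logPolar, polarMap]

theorem equivariant_int {Ψ : ℝ × ℝ → ℝ × ℝ}
    (h : ∀ x t, Ψ (x, t + 2 * Real.pi) = ((Ψ (x, t)).1, (Ψ (x, t)).2 + 2 * Real.pi)) (k : ℤ)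
    (x t : ℝ) : Ψ (x, t + k * (2 * Real.pi)) = ((Ψ (x, t)).1, (Ψ (x, t)).2 + k * (2 * Real.pi)) := by
  induction k using Int.induction_on generalizing t with
  | zero => simp
  | succ n ih =>
    push_cast
    rw [show t + ((n : ℝ) + 1) * (2 * Real.pi) = (t + n * (2 * Real.pi)) + 2 * Real.pi by ring, h]
    have := ih t
    push_cast at this
    rw [this]
    ext <;> simp; ring
  | pred n ih =>
    have h1 := h x (t + (-(n : ℝ) - 1) * (2 * Real.pi))
    rw [show t + (-(n : ℝ) - 1) * (2 * Real.pi) + 2 * Real.pi = t + -(n : ℝ) * (2 * Real.pi) by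
      ring] at h1
    have := ih t
    push_cast at this ⊢
    rw [this] at h1
    have e1 := congrArg Prod.fst h1
    have e2 := congrArg Prod.snd h1
    simp only at e1 e2
    ext
    · exact e1.symm
    · simp only
      linarith

theorem descend_logPolar {Ψ : ℝ × ℝ → ℝ × ℝ}
    (h : ∀ x t, Ψ (x, t + 2 * Real.pi) = ((Ψ (x, t)).1, (Ψ (x, t)).2 + 2 * Real.pi))
    (q : ℝ × ℝ) : descend Ψ (logPolar q) = logPolar (Ψ q) := by
  rw [descend, if_neg (logPolar_ne_zero q)]
  obtain ⟨k, hk⟩ := exists_int_of_logPolar_eq (logPolar_logPolarSection (logPolar_ne_zero q))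
  rw [hk, equivariant_int h, logPolar_add_int]

theorem abs_logPolar_le (q : ℝ × ℝ) : ‖logPolar q‖ ≤ Real.exp q.1 := by
  have h := Real.exp_pos q.1
  rw [logPolar, polarMap, Prod.norm_def, max_le_iff]
  simp only [Real.norm_eq_abs, abs_mul, abs_of_pos h]
  exact ⟨mul_le_of_le_one_right h.le (Real.abs_cos_le_one _),
    mul_le_of_le_one_right h.le (Real.abs_sin_le_one _)⟩

/-- Away from the origin `logPolar` is continuous and open, so neighbourhood filters downstairs are
images of those upstairs and the discontinuity of the section is harmless. At the origin continuity
is exactly the condition on the end `x = -∞`. -/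
theorem continuous_descend {Ψ : ℝ × ℝ → ℝ × ℝ} (hc : Continuous Ψ)
    (h : ∀ x t, Ψ (x, t + 2 * Real.pi) = ((Ψ (x, t)).1, (Ψ (x, t)).2 + 2 * Real.pi))
    (hlim : ∀ C, ∃ C', ∀ q : ℝ × ℝ, q.1 < C' → (Ψ q).1 < C) : Continuous (descend Ψ) := by
  rw [continuous_iff_continuousAt]
  intro p
  by_cases hp : p = 0
  · subst hp
    have h0 : descend Ψ 0 = 0 := by simp [descend]
    rw [ContinuousAt, h0, Metric.tendsto_nhds]
    intro ε hε
    obtain ⟨C', hC'⟩ := hlim (Real.log ε)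
    filter_upwards [(isOpen_disc (Real.exp C')).mem_nhds
      (show (0 : ℝ × ℝ) ∈ disc (Real.exp C') by simp [disc, Real.exp_pos])] with p hp
    by_cases hp0 : p = 0
    · simpa [hp0, h0] using hε
    · obtain ⟨q, rfl⟩ := exists_logPolar_eq hp0
      rw [logPolar_mem_disc (Real.exp_pos _), Real.log_exp] at hp
      rw [descend_logPolar h, dist_zero_right]
      refine (abs_logPolar_le _).trans_lt ?_
      rw [← Real.lt_log_iff_exp_lt hε]
      exact hC' q hp
  · obtain ⟨q, rfl⟩ := exists_logPolar_eq hp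
    rw [ContinuousAt, Tendsto, isOpenMap_logPolar.nhds_le q |>.antisymm
      continuous_logPolar.continuousAt, Filter.map_map]
    rw [show descend Ψ ∘ logPolar = logPolar ∘ Ψ from funext (descend_logPolar h),
      descend_logPolar h]
    exact (continuous_logPolar.comp hc).continuousAt

/-- An equivariant homeomorphism of the logarithmic polar plane preserving the end `x = -∞` induces
a homeomorphism of the plane. -/
theorem exists_homeomorph_of_logPolar {Ψ Φ : ℝ × ℝ → ℝ × ℝ} (hΨ : Continuous Ψ) (hΦ : Continuous Φ)
    (h1 : ∀ q, Φ (Ψ q) = q) (h2 : ∀ q, Ψ (Φ q) = q)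
    (pΨ : ∀ x t, Ψ (x, t + 2 * Real.pi) = ((Ψ (x, t)).1, (Ψ (x, t)).2 + 2 * Real.pi))
    (pΦ : ∀ x t, Φ (x, t + 2 * Real.pi) = ((Φ (x, t)).1, (Φ (x, t)).2 + 2 * Real.pi))
    (lΨ : ∀ C, ∃ C', ∀ q : ℝ × ℝ, q.1 < C' → (Ψ q).1 < C)
    (lΦ : ∀ C, ∃ C', ∀ q : ℝ × ℝ, q.1 < C' → (Φ q).1 < C) :
    ∃ H : (ℝ × ℝ) ≃ₜ (ℝ × ℝ), H 0 = 0 ∧ (∀ q, H (logPolar q) = logPolar (Ψ q)) ∧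
      ∀ q, H.symm (logPolar q) = logPolar (Φ q) := by
  have inv : ∀ {A B : ℝ × ℝ → ℝ × ℝ}, (∀ q, B (A q) = q) →
      (∀ x t, A (x, t + 2 * Real.pi) = ((A (x, t)).1, (A (x, t)).2 + 2 * Real.pi)) →
      (∀ x t, B (x, t + 2 * Real.pi) = ((B (x, t)).1, (B (x, t)).2 + 2 * Real.pi)) →
      ∀ p, descend B (descend A p) = p := by
    intro A B hAB pA pB p
    by_cases hp : p = 0
    · simp [descend, hp]
    · obtain ⟨q, rfl⟩ := exists_logPolar_eq hp
      rw [descend_logPolar pA, descend_logPolar pB, hAB]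
  exact ⟨{ toFun := descend Ψ
           invFun := descend Φ
           left_inv := inv h1 pΨ pΦ
           right_inv := inv h2 pΦ pΨ
           continuous_toFun := continuous_descend hΨ pΨ lΨ
           continuous_invFun := continuous_descend hΦ pΦ lΦ },
    by simp [descend], descend_logPolar pΨ, descend_logPolar pΦ⟩

end LogPolar

/-! ### Simultaneous straightening of two transverse foci. -/

section Foci

open scoped NNReal

variable {e : ℝ} {f g : ℝ → ℝ → ℝ} {K K' : ℝ≥0} {m M m' M' : ℝ} {L : ℝ}

/-- Straightening of two transverse families of leaves in the logarithmic polar plane. -/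
noncomputable def straighten (e : ℝ) (f g : ℝ → ℝ → ℝ) (L : ℝ) (q : ℝ × ℝ) : ℝ × ℝ :=
  (e * (crossTime g L q.2 q.1 - crossTime f L q.2 q.1) / 2,
    (crossTime f L q.2 q.1 + crossTime g L q.2 q.1) / 2)

/-- Inverse of `straighten`. -/
noncomputable def unstraighten (e : ℝ) (f g : ℝ → ℝ → ℝ) (L : ℝ) (q : ℝ × ℝ) : ℝ × ℝ :=
  (leaf f (q.2 - e * q.1) L (meetTime f g L (q.2 - e * q.1) (q.2 + e * q.1)),
    meetTime f g L (q.2 - e * q.1) (q.2 + e * q.1))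

/-- This symmetry lets a single homeomorphism serve both families: statements about `f` apply to `g`
with `e` replaced by `-e`. -/
theorem straighten_symm (e : ℝ) (f g : ℝ → ℝ → ℝ) (L : ℝ) :
    straighten (-e) g f L = straighten e f g L := by
  funext q
  ext <;> simp only [straighten] <;> ring

namespace IsTransverseField

theorem continuous_straighten (hf : IsTransverseField e f K m M)
    (hg : IsTransverseField (-e) g K' m' M') (L : ℝ) : Continuous (straighten e f g L) := by
  have h1 := (hf.continuous_crossTime L).comp continuous_swap
  have h2 := (hg.continuous_crossTime L).comp continuous_swap
  exact (((h2.sub h1).const_mul e).div_const 2).prodMk ((h1.add h2).div_const 2)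

theorem continuous_unstraighten (hf : IsTransverseField e f K m M)
    (hg : IsTransverseField (-e) g K' m' M') (L : ℝ) : Continuous (unstraighten e f g L) := by
  have h1 := (hf.continuous_meetTime hg L).comp
    (by fun_prop : Continuous fun q : ℝ × ℝ => (q.2 - e * q.1, q.2 + e * q.1))
  have h2 : Continuous fun q : ℝ × ℝ => (q.2 - e * q.1, L,
    meetTime f g L (q.2 - e * q.1) (q.2 + e * q.1)) :=
    (by fun_prop : Continuous fun q : ℝ × ℝ => q.2 - e * q.1).prodMk
      (continuous_const.prodMk h1)
  exact (hf.continuous_leaf.comp h2).prodMk h1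

/-- Label the leaves by their crossing times `a`, `b` with the level `L`. The model leaves `x = e (t
- a)` and `x = -e (t - b)` meet at `t = (a + b) / 2`, `x = e (b - a) / 2`; conversely the model
point `(x, t)` has labels `t - e x` and `t + e x`. Both maps preserve labels. -/
theorem straighten_unstraighten (hf : IsTransverseField e f K m M)
    (hg : IsTransverseField (-e) g K' m' M') (L : ℝ) (q : ℝ × ℝ) :
    straighten e f g L (unstraighten e f g L q) = q := by
  have h1 : crossTime g L (unstraighten e f g L q).2 (unstraighten e f g L q).1
      = q.2 + e * q.1 := by
    simp only [unstraighten]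
    rw [hf.leaf_meetTime hg]
    exact hg.crossTime_leaf _ _
  have h2 : crossTime f L (unstraighten e f g L q).2 (unstraighten e f g L q).1
      = q.2 - e * q.1 := hf.crossTime_leaf _ _
  rw [straighten, h1, h2]
  ext
  · linear_combination q.1 * hf.sign_mul_sign
  · simp only; ring

theorem unstraighten_straighten (hf : IsTransverseField e f K m M)
    (hg : IsTransverseField (-e) g K' m' M') (L : ℝ) (q : ℝ × ℝ) :
    unstraighten e f g L (straighten e f g L q) = q := by
  have h1 : (straighten e f g L q).2 - e * (straighten e f g L q).1 = crossTime f L q.2 q.1 := by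
    simp only [straighten]
    linear_combination (-(crossTime g L q.2 q.1 - crossTime f L q.2 q.1) / 2) * hf.sign_mul_sign
  have h2 : (straighten e f g L q).2 + e * (straighten e f g L q).1 = crossTime g L q.2 q.1 := by
    simp only [straighten]
    linear_combination ((crossTime g L q.2 q.1 - crossTime f L q.2 q.1) / 2) * hf.sign_mul_sign
  have h3 : meetTime f g L (crossTime f L q.2 q.1) (crossTime g L q.2 q.1) = q.2 := by
    apply hf.meetTime_eq hg
    rw [hf.leaf_of_crossTime, hg.leaf_of_crossTime, hf.leaf_self, hg.leaf_self]
  rw [unstraighten, h1, h2, h3, hf.leaf_of_crossTime, hf.leaf_self]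

theorem straighten_add_period (hf : IsTransverseField e f K m M)
    (hg : IsTransverseField (-e) g K' m' M') {T : ℝ} (hfT : ∀ t x, f (t + T) x = f t x)
    (hgT : ∀ t x, g (t + T) x = g t x) (x t : ℝ) :
    straighten e f g L (x, t + T) =
      ((straighten e f g L (x, t)).1, (straighten e f g L (x, t)).2 + T) := by
  simp only [straighten, hf.crossTime_add_period hfT, hg.crossTime_add_period hgT]
  ext <;> simp only <;> ring

theorem unstraighten_add_period (hf : IsTransverseField e f K m M)
    (hg : IsTransverseField (-e) g K' m' M') {T : ℝ} (hfT : ∀ t x, f (t + T) x = f t x)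
    (hgT : ∀ t x, g (t + T) x = g t x) (x t : ℝ) :
    unstraighten e f g L (x, t + T) =
      ((unstraighten e f g L (x, t)).1, (unstraighten e f g L (x, t)).2 + T) := by
  simp only [unstraighten, add_sub_right_comm t T, add_right_comm t T,
    hf.meetTime_add_period hg hfT hgT, hf.leaf_add_period hfT]

theorem crossTime_bounds (h : IsTransverseField e f K m M) (t x : ℝ) :
    (x < L → m * (e * (crossTime f L t x - t)) ≤ L - x ∧
      L - x ≤ M * (e * (crossTime f L t x - t)) ∧ 0 < e * (crossTime f L t x - t)) ∧
    (L ≤ x → e * (crossTime f L t x - t) ≤ 0) := by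
  have hx := h.leaf_crossTime L t x
  have h0 := h.leaf_self t x
  have hm := h.pos
  generalize crossTime f L t x = r at *
  have key : ∀ a b : ℝ, a ≤ b → 0 ≤ m * (b - a) := fun a b hab =>
    mul_nonneg hm.le (sub_nonneg.2 hab)
  rcases le_total t r with ht | ht
  · have hs := h.leaf_slope t x ht
    rw [hx, h0] at hs
    have hk := key _ _ ht
    rcases h.sign with rfl | rfl
    · refine ⟨fun hlt => ⟨by linarith, by linarith, ?_⟩, fun hle => ?_⟩
      · rcases ht.eq_or_lt with rfl | ht
        · linarith
        · linarith
      · by_contra hcon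
        have := mul_pos hm (not_le.1 hcon)
        linarith
    · refine ⟨fun hlt => ?_, fun hle => by linarith⟩
      linarith
  · have hs := h.leaf_slope t x ht
    rw [hx, h0] at hs
    have hk := key _ _ ht
    rcases h.sign with rfl | rfl
    · refine ⟨fun hlt => ?_, fun hle => by linarith⟩
      linarith
    · refine ⟨fun hlt => ⟨by linarith, by linarith, ?_⟩, fun hle => ?_⟩
      · rcases ht.eq_or_lt with rfl | ht
        · linarith
        · linarith
      · by_contra hcon
        have := mul_pos hm (not_le.1 hcon)
        linarith

/-- The new first coordinate is minus the mean of the times the two leaves need to reach `L`, each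
counted in its own direction. For `x < L` each time lies between `(L - x) / M` and `(L - x) / m`.
This controls both the boundary of the disc and the end `x = -∞`. -/
theorem straighten_bounds (hf : IsTransverseField e f K m M)
    (hg : IsTransverseField (-e) g K' m M) (q : ℝ × ℝ) :
    (q.1 < L ↔ (straighten e f g L q).1 < 0) ∧
    (q.1 < L → M * (straighten e f g L q).1 ≤ q.1 - L ∧ q.1 - L ≤ m * (straighten e f g L q).1) := by
  have h1 := hf.crossTime_bounds (L := L) q.2 q.1
  have h2 := hg.crossTime_bounds (L := L) q.2 q.1
  simp only [straighten]
  refine ⟨⟨fun h => ?_, fun h => ?_⟩, fun h => ?_⟩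
  · linarith [(h1.1 h).2.2, (h2.1 h).2.2]
  · by_contra hcon
    linarith [h1.2 (not_lt.1 hcon), h2.2 (not_lt.1 hcon)]
  · obtain ⟨a1, a2, -⟩ := h1.1 h
    obtain ⟨b1, b2, -⟩ := h2.1 h
    constructor <;> linarith

theorem upper_pos (hf : IsTransverseField e f K m M) : 0 < M :=
  hf.pos.trans_le ((hf.lower 0 0).trans (hf.upper 0 0))

theorem exists_homeomorph (hf : IsTransverseField e f K m M) (hg : IsTransverseField (-e) g K' m M)
    (hfT : ∀ t x, f (t + 2 * Real.pi) x = f t x) (hgT : ∀ t x, g (t + 2 * Real.pi) x = g t x)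
    (L : ℝ) :
    ∃ H : (ℝ × ℝ) ≃ₜ (ℝ × ℝ), H 0 = 0 ∧
      (∀ q, H (logPolar q) = logPolar (straighten e f g L q)) ∧
      ∀ q, H.symm (logPolar q) = logPolar (unstraighten e f g L q) := by
  refine exists_homeomorph_of_logPolar (hf.continuous_straighten hg L)
    (hf.continuous_unstraighten hg L) (hf.unstraighten_straighten hg L)
    (hf.straighten_unstraighten hg L) (hf.straighten_add_period hg hfT hgT)
    (hf.unstraighten_add_period hg hfT hgT) (fun C => ?_) (fun C => ?_)
  -- Below `L` the new first coordinate `y` satisfies `M * y ≤ x - L`, so `x < L + M * C` suffices.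
  · refine ⟨min L (L + M * C), fun q hq => ?_⟩
    have h1 := ((hf.straighten_bounds hg q).2 (hq.trans_le (min_le_left L _))).1
    have h2 := hq.trans_le (min_le_right L _)
    have hM := hf.upper_pos
    exact lt_of_mul_lt_mul_left (by linarith) hM.le
  -- The inverse map sends negative first coordinates `y` below `L`, where `x - L ≤ m * y`.
  · refine ⟨min 0 ((C - L) / m), fun q hq => ?_⟩
    have hb := hf.straighten_bounds hg (L := L) (unstraighten e f g L q)
    rw [hf.straighten_unstraighten hg] at hb
    have h1 := (hb.2 (hb.1.2 (hq.trans_le (min_le_left _ _)))).2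
    have h2 := hq.trans_le (min_le_right 0 _)
    rw [lt_div_iff₀ hf.pos] at h2
    linarith

theorem sendsTrajectories (hf : IsTransverseField e f K m M)
    (hg : IsTransverseField (-e) g K' m M) {ρ : ℝ} (hρ : 0 < ρ) {X H : ℝ × ℝ → ℝ × ℝ}
    (hX : ∀ x t, x < Real.log ρ → X (logPolar (x, t)) =
      f t x • logPolar (x, t) + rot (logPolar (x, t)))
    (hH : ∀ q, H (logPolar q) = logPolar (straighten e f g (Real.log ρ) q)) :
    SendsTrajectories X (linearFocus e) H (disc ρ \ {0}) := by
  intro I γ hIo hI hγ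
  rcases I.eq_empty_or_nonempty with rfl | ⟨s₀, hs₀⟩
  · exact ⟨id, 0, by simp [StrictMonoOn], continuousOn_empty _, by simp⟩
  have hk : ∀ s ∈ I, ∃ k : ℝ, X (γ s) = k • γ s + rot (γ s) := by
    intro s hs
    obtain ⟨q, hq⟩ := exists_logPolar_eq (hγ s hs).1.2
    have hqd := (hγ s hs).1.1
    rw [← hq, logPolar_mem_disc hρ] at hqd
    exact ⟨f q.2 q.1, by rw [← hq]; exact hX q.1 q.2 hqd⟩
  choose! k hk using hk
  obtain ⟨t₀, x, hx⟩ := exists_logPolar_lift hIo hI (k := k) (fun s hs => (hγ s hs).1.2)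
    (fun s hs => by rw [← hk s hs]; exact (hγ s hs).2)
  have hxL : ∀ s ∈ I, x s < Real.log ρ := by
    intro s hs
    have := (hγ s hs).1.1
    rw [(hx s hs).1] at this
    exact (logPolar_mem_disc hρ _).1 this
  have hkf : ∀ s ∈ I, k s = f (s + t₀) (x s) := by
    intro s hs
    have h1 := hk s hs
    have h2 := hX (x s) (s + t₀) (hxL s hs)
    rw [← (hx s hs).1, h1] at h2
    exact smul_left_injective ℝ (hγ s hs).1.2 (add_right_cancel h2)
  let J : Set ℝ := (fun t => t - t₀) ⁻¹' I
  have hJo : IsOpen J := hIo.preimage (by fun_prop)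
  have hJ : J.OrdConnected := hI.preimage_mono fun a b hab => sub_le_sub_right hab t₀
  have hy : ∀ t ∈ J, HasDerivAt (fun t => x (t - t₀)) (f t (x (t - t₀))) t := by
    intro t ht
    have h1 := (hx (t - t₀) ht).2
    rw [hkf _ ht, sub_add_cancel] at h1
    exact h1.comp_sub_const t t₀
  have hmem : ∀ s ∈ I, s + t₀ ∈ J := fun s hs => by
    change s + t₀ - t₀ ∈ I
    rwa [add_sub_cancel_right]
  let a := crossTime f (Real.log ρ) (s₀ + t₀) (x s₀)
  have hleaf : ∀ s ∈ I, x s = leaf f a (Real.log ρ) (s + t₀) := by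
    intro s hs
    have := hf.eq_leaf_of_mem hJo hJ hy (hmem s₀ hs₀) (hmem s hs)
    simp only [add_sub_cancel_right] at this
    rw [this, hf.leaf_of_crossTime]
  let b : ℝ → ℝ := fun s =>
    crossTime g (Real.log ρ) (s + t₀) (leaf f a (Real.log ρ) (s + t₀))
  have hb : StrictMono b := fun s t hst => hf.crossTime_lt_of_lt hg a (by linarith)
  have hbc : Continuous b := (hg.continuous_crossTime (Real.log ρ)).comp
    ((by fun_prop : Continuous fun s => s + t₀).prodMk
      ((hf.differentiable_leaf a _).continuous.comp (by fun_prop)))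
  -- Along the trajectory the label `a` is fixed and `b` increases strictly. The image runs along
  -- the model leaf with label `a`, and its angle `(a + b) / 2` is the new time.
  refine ⟨fun s => (a + b s) / 2, fun θ => logPolar (e * (θ - a), θ), ?_, ?_, fun s hs => ⟨?_, ?_⟩⟩
  · intro s _ t _ hst
    have := hb hst
    simp only
    linarith
  · exact ((continuous_const.add hbc).div_const 2).continuousOn
  · have h1 : HasDerivAt (fun θ => e * (θ - a)) e ((a + b s) / 2) := by
      simpa using ((hasDerivAt_id ((a + b s) / 2)).sub_const a).const_mul e
    have h2 := hasDerivAt_logPolar h1 (hasDerivAt_id _)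
    convert! h2 using 1
    ext <;> simp [linearFocus, rot] <;> ring
  · rw [(hx s hs).1, hH, straighten]
    have h1 : crossTime f (Real.log ρ) (s + t₀) (x s) = a := by
      rw [hleaf s hs]; exact hf.crossTime_leaf _ _
    have h2 : crossTime g (Real.log ρ) (s + t₀) (x s) = b s := by rw [hleaf s hs]
    simp only [h1, h2]
    congr 1
    ext
    · simp only; ring
    · rfl

theorem sendsTrajectories_symm (hf : IsTransverseField e f K m M)
    (hg : IsTransverseField (-e) g K' m M) {ρ : ℝ} {X H : ℝ × ℝ → ℝ × ℝ}
    (hX : ∀ x t, x < Real.log ρ → X (logPolar (x, t)) =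
      f t x • logPolar (x, t) + rot (logPolar (x, t)))
    (hH : ∀ q, H (logPolar q) = logPolar (unstraighten e f g (Real.log ρ) q)) :
    SendsTrajectories (linearFocus e) X H (disc 1 \ {0}) := by
  intro I γ hIo hI hγ
  rcases I.eq_empty_or_nonempty with rfl | ⟨s₀, hs₀⟩
  · exact ⟨id, 0, by simp [StrictMonoOn], continuousOn_empty _, by simp⟩
  have hfoc : ∀ p, linearFocus e p = e • p + rot p := by
    intro p
    ext <;> simp [linearFocus, rot] <;> ring
  obtain ⟨t₀, x, hx⟩ := exists_logPolar_lift hIo hI (k := fun _ => e)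
    (fun s hs => (hγ s hs).1.2) (fun s hs => by rw [← hfoc]; exact (hγ s hs).2)
  let a := s₀ + t₀ - e * x s₀
  have hxa : ∀ s ∈ I, x s = e * (s + t₀ - a) := by
    have hd : ∀ s ∈ I, HasDerivAt (fun s => x s - e * s) 0 s := fun s hs => by
      simpa using! (hx s hs).2.sub ((hasDerivAt_id s).const_mul e)
    intro s hs
    have := hIo.is_const_of_deriv_eq_zero hI.isPreconnected
      (fun s hs => (hd s hs).differentiableAt.differentiableWithinAt)
      (fun s hs => (hd s hs).deriv) hs hs₀
    simp only [a]
    linear_combination this - x s₀ * hf.sign_mul_sign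
  -- With `t = s + t₀`, the model leaf has `t - e x = a`, so its other label `t + e x` is `2 t - a`.
  let b : ℝ → ℝ := fun s => 2 * (s + t₀) - a
  have hb : StrictMono fun s => meetTime f g (Real.log ρ) a (b s) := fun s t hst =>
    hf.meetTime_lt_of_lt hg a (by simp only [b]; linarith)
  have hbc : Continuous fun s => meetTime f g (Real.log ρ) a (b s) :=
    (hf.continuous_meetTime hg (Real.log ρ)).comp
      (by fun_prop : Continuous fun s => (a, b s))
  have hun : ∀ s ∈ I, unstraighten e f g (Real.log ρ) (x s, s + t₀) =
      (leaf f a (Real.log ρ) (meetTime f g (Real.log ρ) a (b s)),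
        meetTime f g (Real.log ρ) a (b s)) := by
    intro s hs
    have h1 : s + t₀ - e * x s = a := by
      rw [hxa s hs]; linear_combination -(s + t₀ - a) * hf.sign_mul_sign
    have h2 : s + t₀ + e * x s = b s := by
      rw [hxa s hs]; linear_combination (s + t₀ - a) * hf.sign_mul_sign
    simp only [unstraighten, h1, h2]
  refine ⟨fun s => meetTime f g (Real.log ρ) a (b s),
    fun t => logPolar (leaf f a (Real.log ρ) t, t), fun s _ t _ hst => hb hst, hbc.continuousOn,
    fun s hs => ⟨?_, ?_⟩⟩
  · have hneg : x s < 0 := by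
      have h1 := (hγ s hs).1.1
      rw [(hx s hs).1, logPolar_mem_disc one_pos, Real.log_one] at h1
      exact h1
    have h3 := (hf.straighten_bounds hg (L := Real.log ρ)
      (unstraighten e f g (Real.log ρ) (x s, s + t₀))).1
    rw [hf.straighten_unstraighten hg, hun s hs] at h3
    rw [hX _ _ (h3.2 hneg)]
    have h4 := hasDerivAt_logPolar (hf.hasDerivAt_leaf a (Real.log ρ)
      (meetTime f g (Real.log ρ) a (b s))) (hasDerivAt_id _)
    rwa [one_smul] at h4
  · rw [(hx s hs).1, hH, hun s hs]

theorem hasDerivAt_leaf_logPolar (hf : IsTransverseField e f K m M) {ρ : ℝ} {X : ℝ × ℝ → ℝ × ℝ}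
    (hX : ∀ x t, x < Real.log ρ → X (logPolar (x, t)) =
      f t x • logPolar (x, t) + rot (logPolar (x, t))) (t₀ x₀ s : ℝ)
    (hs : leaf f t₀ x₀ (t₀ + s) < Real.log ρ) :
    HasDerivAt (fun s => logPolar (leaf f t₀ x₀ (t₀ + s), t₀ + s))
      (X (logPolar (leaf f t₀ x₀ (t₀ + s), t₀ + s))) s := by
  have h4 := hasDerivAt_logPolar ((hf.hasDerivAt_leaf t₀ x₀ (t₀ + s)).comp_const_add t₀ s)
    ((hasDerivAt_id s).const_add t₀)
  rw [one_smul] at h4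
  rw [hX _ _ hs]
  exact h4

theorem spiralsIn (hf : IsTransverseField (-1) f K m M) {ρ : ℝ} (hρ : 0 < ρ) {X : ℝ × ℝ → ℝ × ℝ}
    (hX : ∀ x t, x < Real.log ρ → X (logPolar (x, t)) =
      f t x • logPolar (x, t) + rot (logPolar (x, t))) : SpiralsIn X ρ := by
  intro p hp hp0
  obtain ⟨⟨x₀, t₀⟩, rfl⟩ := exists_logPolar_eq hp0
  rw [logPolar_mem_disc hρ] at hp
  have hle : ∀ s, 0 ≤ s → leaf f t₀ x₀ (t₀ + s) ≤ x₀ - m * s := by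
    intro s hs
    have := (hf.leaf_slope t₀ x₀ (show t₀ ≤ t₀ + s by linarith)).1
    rw [hf.leaf_self] at this
    linarith
  have hlt : ∀ s, 0 ≤ s → leaf f t₀ x₀ (t₀ + s) < Real.log ρ := fun s hs =>
    ((hle s hs).trans (by linarith [mul_nonneg hf.pos.le hs])).trans_lt hp
  refine ⟨fun s => Real.exp (leaf f t₀ x₀ (t₀ + s)), fun s => t₀ + s, ?_, fun s hs =>
    ⟨Real.exp_pos _, (Real.lt_log_iff_exp_lt hρ).1 (hlt s hs),
      hf.hasDerivAt_leaf_logPolar hX t₀ x₀ s (hlt s hs)⟩, by fun_prop, ?_,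
      tendsto_atTop_add_const_left _ _ tendsto_id⟩
  · simp [hf.leaf_self, logPolar]
  · refine Real.tendsto_exp_atBot.comp ?_
    have h1 : Tendsto (fun s => x₀ - m * s) atTop atBot :=
      tendsto_atBot_add_const_left _ x₀
        (tendsto_neg_atTop_atBot.comp (tendsto_id.const_mul_atTop hf.pos))
    exact tendsto_atBot_mono' _ ((eventually_ge_atTop 0).mono hle) h1

theorem spiralsOut (hf : IsTransverseField 1 f K m M) {ρ : ℝ} (hρ : 0 < ρ) {X : ℝ × ℝ → ℝ × ℝ}
    (hX : ∀ x t, x < Real.log ρ → X (logPolar (x, t)) =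
      f t x • logPolar (x, t) + rot (logPolar (x, t))) : SpiralsOut X ρ := by
  intro p hp hp0
  obtain ⟨⟨x₀, t₀⟩, rfl⟩ := exists_logPolar_eq hp0
  rw [logPolar_mem_disc hρ] at hp
  have hle : ∀ s, s ≤ 0 → leaf f t₀ x₀ (t₀ + s) ≤ x₀ + m * s := by
    intro s hs
    have := (hf.leaf_slope t₀ x₀ (show t₀ + s ≤ t₀ by linarith)).1
    rw [hf.leaf_self] at this
    linarith
  have hlt : ∀ s, s ≤ 0 → leaf f t₀ x₀ (t₀ + s) < Real.log ρ := fun s hs =>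
    ((hle s hs).trans (by linarith [mul_nonpos_of_nonneg_of_nonpos hf.pos.le hs])).trans_lt hp
  refine ⟨fun s => Real.exp (leaf f t₀ x₀ (t₀ + s)), fun s => t₀ + s, ?_, fun s hs =>
    ⟨Real.exp_pos _, (Real.lt_log_iff_exp_lt hρ).1 (hlt s hs),
      hf.hasDerivAt_leaf_logPolar hX t₀ x₀ s (hlt s hs)⟩, by fun_prop, ?_,
      tendsto_atBot_add_const_left _ _ tendsto_id⟩
  · simp [hf.leaf_self, logPolar]
  · refine Real.tendsto_exp_atBot.comp ?_
    have h1 : Tendsto (fun s => x₀ + m * s) atBot atBot :=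
      tendsto_atBot_add_const_left _ x₀ (tendsto_id.const_mul_atBot hf.pos)
    exact tendsto_atBot_mono' _ ((eventually_le_atBot 0).mono hle) h1

end IsTransverseField

/-- Two planar fields which in logarithmic polar coordinates are transverse, one pointing inwards
and the other outwards, form a pair of foci, simultaneously equivalent to the linear model. -/
theorem exists_foci_equivalence (hf : IsTransverseField (-1) f K m M)
    (hg : IsTransverseField 1 g K' m M) (hfT : ∀ t x, f (t + 2 * Real.pi) x = f t x)
    (hgT : ∀ t x, g (t + 2 * Real.pi) x = g t x) {ρ : ℝ} (hρ : 0 < ρ) {X Z : ℝ × ℝ → ℝ × ℝ}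
    (hX : ∀ x t, x < Real.log ρ → X (logPolar (x, t)) =
      f t x • logPolar (x, t) + rot (logPolar (x, t)))
    (hZ : ∀ x t, x < Real.log ρ → Z (logPolar (x, t)) =
      g t x • logPolar (x, t) + rot (logPolar (x, t))) :
    ∃ H : OpenPartialHomeomorph (ℝ × ℝ) (ℝ × ℝ), H.source = disc ρ ∧ H.target = disc 1 ∧
      IsTopologicalEquivalence X (linearFocus (-1)) H ∧
      IsTopologicalEquivalence Z (linearFocus 1) H := by
  have hg' : IsTransverseField (- -1) g K' m M := by rwa [neg_neg]
  obtain ⟨H, H0, H1, H2⟩ := hf.exists_homeomorph hg' hfT hgT (Real.log ρ)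
  have H1' : ∀ q, H (logPolar q) = logPolar (straighten 1 g f (Real.log ρ) q) := by
    intro q
    rw [H1, ← straighten_symm 1]
  have H2' : ∀ q, H.symm (logPolar q) = logPolar (unstraighten 1 g f (Real.log ρ) q) := by
    intro q
    rw [Homeomorph.symm_apply_eq, H1', hg.straighten_unstraighten hf]
  have himg : H '' disc ρ = disc 1 := by
    have hb := fun q => (hf.straighten_bounds hg' (L := Real.log ρ) q).1
    ext p
    constructor
    · rintro ⟨p, hp, rfl⟩
      by_cases hp0 : p = 0
      · rw [hp0, H0]; simp [disc]
      · obtain ⟨q, rfl⟩ := exists_logPolar_eq hp0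
        rw [H1, logPolar_mem_disc one_pos, Real.log_one]
        exact (hb q).1 ((logPolar_mem_disc hρ q).1 hp)
    · intro hp
      by_cases hp0 : p = 0
      · exact ⟨0, by simp [disc, hρ], by rw [H0, hp0]⟩
      · obtain ⟨q, rfl⟩ := exists_logPolar_eq hp0
        rw [logPolar_mem_disc one_pos, Real.log_one] at hp
        refine ⟨H.symm (logPolar q), ?_, H.apply_symm_apply _⟩
        rw [H2, logPolar_mem_disc hρ, hb, hf.straighten_unstraighten hg']
        exact hp
  refine ⟨H.toOpenPartialHomeomorphOfImageEq (disc ρ) (isOpen_disc ρ) (disc 1) himg, rfl, rfl,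
    ⟨?_, H0, ?_, ?_⟩, ?_, H0, ?_, ?_⟩
  · change (0 : ℝ × ℝ) ∈ disc ρ
    simp [disc, hρ]
  · exact hf.sendsTrajectories hg' hρ hX H1
  · exact hf.sendsTrajectories_symm hg' hX H2
  · change (0 : ℝ × ℝ) ∈ disc ρ
    simp [disc, hρ]
  · exact hg.sendsTrajectories hf hρ hZ H1'
  · exact hg.sendsTrajectories_symm hf hZ H2'

end Foci

/-! ### The jet of the height function at the flat umbilic. -/

section Jets

/-- Some polynomials of degree at most three in two variables. -/
def cubicPoly (a b k₁ k₂ k₃ k₄ k₅ k₆ : ℝ) (p : ℝ × ℝ) : ℝ :=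
  a * p.1 ^ 3 + b * (p.1 * p.2 ^ 2) + k₁ * p.1 ^ 2 + k₂ * p.2 ^ 2 + k₃ * (p.1 * p.2) + k₄ * p.1
    + k₅ * p.2 + k₆

theorem contDiff_cubicPoly (a b k₁ k₂ k₃ k₄ k₅ k₆ : ℝ) :
    ContDiff ℝ ∞ (cubicPoly a b k₁ k₂ k₃ k₄ k₅ k₆) := by
  unfold cubicPoly
  fun_prop

/-- The family is stable under both partial derivatives, so higher partials amount to rewriting the
parameters. -/
theorem partials_cubicPoly (a b k₁ k₂ k₃ k₄ k₅ k₆ : ℝ) (p : ℝ × ℝ) :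
    pdu (cubicPoly a b k₁ k₂ k₃ k₄ k₅ k₆) p = cubicPoly 0 0 (3 * a) b 0 (2 * k₁) k₃ k₄ p ∧
    pdv (cubicPoly a b k₁ k₂ k₃ k₄ k₅ k₆) p = cubicPoly 0 0 0 0 (2 * b) k₃ (2 * k₂) k₅ p := by
  have hu : HasFDerivAt (fun p : ℝ × ℝ => p.1) (ContinuousLinearMap.fst ℝ ℝ ℝ) p := hasFDerivAt_fst
  have hv : HasFDerivAt (fun p : ℝ × ℝ => p.2) (ContinuousLinearMap.snd ℝ ℝ ℝ) p := hasFDerivAt_snd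
  have h := ((((((((hu.pow 3).const_mul a).fun_add
    ((hu.fun_mul (hv.pow 2)).const_mul b)).fun_add
    ((hu.pow 2).const_mul k₁)).fun_add ((hv.pow 2).const_mul k₂)).fun_add
    ((hu.fun_mul hv).const_mul k₃)).fun_add (hu.const_mul k₄)).fun_add (hv.const_mul k₅)).add_const k₆
  have h' : HasFDerivAt (cubicPoly a b k₁ k₂ k₃ k₄ k₅ k₆) _ p := h
  rw [pdu, pdv, h'.fderiv]
  constructor <;> simp [cubicPoly] <;> ring

theorem pdu_cubicPoly (a b k₁ k₂ k₃ k₄ k₅ k₆ : ℝ) : pdu (cubicPoly a b k₁ k₂ k₃ k₄ k₅ k₆) =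
    cubicPoly 0 0 (3 * a) b 0 (2 * k₁) k₃ k₄ :=
  funext fun p => (partials_cubicPoly a b k₁ k₂ k₃ k₄ k₅ k₆ p).1

theorem pdv_cubicPoly (a b k₁ k₂ k₃ k₄ k₅ k₆ : ℝ) : pdv (cubicPoly a b k₁ k₂ k₃ k₄ k₅ k₆) =
    cubicPoly 0 0 0 0 (2 * b) k₃ (2 * k₂) k₅ :=
  funext fun p => (partials_cubicPoly a b k₁ k₂ k₃ k₄ k₅ k₆ p).2

/-- The partial derivatives of orders two and three at a flat umbilic in the special chart. -/
theorem flat_umbilic_jet {h : ℝ × ℝ → ℝ} (hh : ContDiff ℝ ∞ h) {c : ℝ}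
    (hO : (fun p : ℝ × ℝ => h p - (p.1 ^ 3 - c * p.1 * p.2 ^ 2))
      =O[𝓝 (0 : ℝ × ℝ)] fun p => ‖p‖ ^ 4) :
    (pdu (pdu h) 0 = 0 ∧ pdv (pdu h) 0 = 0 ∧ pdv (pdv h) 0 = 0) ∧
      pdu (pdu (pdu h)) 0 = 6 ∧ pdv (pdu (pdu h)) 0 = 0 ∧ pdv (pdv (pdu h)) 0 = -2 * c ∧
      pdv (pdv (pdv h)) 0 = 0 := by
  -- Minus the cubic part, so that `h + P` has vanishing second and third derivatives at the origin.
  let P := cubicPoly (-1) c 0 0 0 0 0 0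
  have hP : ContDiff ℝ ∞ P := contDiff_cubicPoly _ _ _ _ _ _ _ _
  have hsum : ContDiff ℝ ∞ fun p => h p + P p := hh.add hP
  have hO' : (fun p => h p + P p) =O[𝓝 (0 : ℝ × ℝ)] fun p => ‖p‖ ^ 4 :=
    hO.congr_left fun p => by simp only [P, cubicPoly]; ring
  have hu := contDiff_pdu hh
  have hv := contDiff_pdv hh
  have Pu := contDiff_pdu hP
  have Pv := contDiff_pdv hP
  have huu := contDiff_pdu hu
  have huv := contDiff_pdv hu
  have hvv := contDiff_pdv hv
  have Puu := contDiff_pdu Pu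
  have Puv := contDiff_pdv Pu
  have Pvv := contDiff_pdv Pv
  obtain ⟨⟨j1, j2, j3⟩, j4, j5, j6, j7⟩ := jet_eq_zero_of_isBigO hsum hO'
  rw [pdu_add hh hP, pdu_add hu Pu] at j1
  rw [pdu_add hh hP, pdv_add hu Pu] at j2
  rw [pdv_add hh hP, pdv_add hv Pv] at j3
  rw [pdu_add hh hP, pdu_add hu Pu, pdu_add huu Puu] at j4
  rw [pdu_add hh hP, pdu_add hu Pu, pdv_add huu Puu] at j5
  rw [pdu_add hh hP, pdv_add hu Pu, pdv_add huv Puv] at j6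
  rw [pdv_add hh hP, pdv_add hv Pv, pdv_add hvv Pvv] at j7
  simp only [P, pdu_cubicPoly, pdv_cubicPoly] at j1 j2 j3 j4 j5 j6 j7
  simp only [cubicPoly, Prod.fst_zero, Prod.snd_zero] at j1 j2 j3 j4 j5 j6 j7
  ring_nf at j1 j2 j3 j4 j5 j6 j7
  refine ⟨⟨?_, ?_, ?_⟩, ?_, ?_, ?_, ?_⟩ <;> linarith

end Jets

/-! ### Polar blow-up of the extended equation. -/

section PolarCoefficients

theorem fderiv_polarMap (q w : ℝ × ℝ) : fderiv ℝ polarMap q w =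
    (Real.cos q.2 * w.1 - q.1 * Real.sin q.2 * w.2,
      Real.sin q.2 * w.1 + q.1 * Real.cos q.2 * w.2) := by
  have h1 : HasFDerivAt (fun q : ℝ × ℝ => q.1) (ContinuousLinearMap.fst ℝ ℝ ℝ) q := hasFDerivAt_fst
  have h2 : HasFDerivAt (fun q : ℝ × ℝ => q.2) (ContinuousLinearMap.snd ℝ ℝ ℝ) q := hasFDerivAt_snd
  have h : HasFDerivAt polarMap _ q := (h1.fun_mul h2.cos).prodMk (h1.fun_mul h2.sin)
  rw [h.fderiv]
  ext <;> simp <;> ring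

/-- The polynomial `A`, divided by `r ^ 2`, for second derivatives `r x, r y, r z`. -/
def scaledA (r x y z a₀ a₁ a₂ a₃ b₀ b₁ b₂ : ℝ) : ℝ :=
  -4 * r * (z * b₀ - 2 * y * b₁) * (x * z - y ^ 2) - 4 * r * x * (x * z - y ^ 2) * b₂
    + 7 * z ^ 2 * a₀ ^ 2 + 3 * x ^ 2 * a₂ ^ 2
    + (-28 * a₁ * y * z + 2 * (x * z + 8 * y ^ 2) * a₂ - 4 * a₃ * x * y) * a₀
    + 12 * (x * z + y ^ 2) * a₁ ^ 2 + 4 * (x ^ 2 * a₃ - 6 * x * y * a₂) * a₁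

/-- The polynomial `B`, divided by `r ^ 2`, for second derivatives `r x, r y, r z`. -/
def scaledB (r x y z a₀ a₁ a₂ a₃ b₁ b₂ b₃ : ℝ) : ℝ :=
  -4 * r * (z * b₁ - 2 * y * b₂) * (x * z - y ^ 2)
    + (7 * z ^ 2 * a₁ - 10 * y * z * a₂ + (-x * z + 4 * y ^ 2) * a₃) * a₀
    - 4 * r * x * (x * z - y ^ 2) * b₃
    - 18 * a₁ ^ 2 * y * z + 7 * a₂ * a₃ * x ^ 2
    + ((15 * x * z + 24 * y ^ 2) * a₂ - 10 * x * y * a₃) * a₁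
    - 18 * a₂ ^ 2 * x * y

/-- The polynomial `C`, divided by `r ^ 2`, for second derivatives `r x, r y, r z`. -/
def scaledC (r x y z a₀ a₁ a₂ a₃ b₂ b₃ b₄ : ℝ) : ℝ :=
  -4 * r * (z * b₂ - 2 * y * b₃) * (x * z - y ^ 2) - 4 * r * x * b₄ * (x * z - y ^ 2)
    + 4 * (-y * z * a₃ + a₂ * z ^ 2) * a₀ + 3 * a₁ ^ 2 * z ^ 2
    + 2 * (-12 * y * z * a₂ + (x * z + 8 * y ^ 2) * a₃) * a₁
    + 12 * (x * z + y ^ 2) * a₂ ^ 2 - 28 * a₂ * a₃ * x * y + 7 * a₃ ^ 2 * x ^ 2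

theorem contDiff_polarMap : ContDiff ℝ ∞ polarMap := by
  unfold polarMap
  fun_prop

theorem polarMap_add_period (r t : ℝ) : polarMap (r, t + 2 * Real.pi) = polarMap (r, t) := by
  simp [polarMap]

/-- Polar blow-up of a smooth function vanishing at the origin. -/
theorem exists_polar_quotient {g : ℝ × ℝ → ℝ} (hg : ContDiff ℝ ∞ g) (h0 : g 0 = 0) :
    ∃ G : ℝ × ℝ → ℝ, ContDiff ℝ ∞ G ∧ (∀ q, g (polarMap q) = q.1 * G q) ∧
      (∀ r t, G (r, t + 2 * Real.pi) = G (r, t)) ∧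
      ∀ t, G (0, t) = Real.cos t * pdu g 0 + Real.sin t * pdv g 0 := by
  obtain ⟨a, b, ha, hb, hab, ha0, hb0⟩ := hadamard_plane hg h0
  have ha' := ha.comp contDiff_polarMap
  have hb' := hb.comp contDiff_polarMap
  refine ⟨fun q => Real.cos q.2 * (a ∘ polarMap) q + Real.sin q.2 * (b ∘ polarMap) q,
    ((Real.contDiff_cos.comp contDiff_snd).mul ha').add
      ((Real.contDiff_sin.comp contDiff_snd).mul hb'), fun q => ?_, fun r t => ?_, fun t => ?_⟩
  · rw [hab]
    simp only [Function.comp]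
    conv_lhs => simp only [polarMap]
    simp only [polarMap]
    ring
  · simp [polarMap_add_period]
  · have : polarMap (0, t) = 0 := by simp [polarMap]
    simp [this, ha0, hb0]

theorem exists_polar_coefficients {h : ℝ × ℝ → ℝ} (hh : ContDiff ℝ ∞ h) {c : ℝ}
    (hc : c = 1 ∨ c = 3)
    (hO : (fun p : ℝ × ℝ => h p - (p.1 ^ 3 - c * p.1 * p.2 ^ 2))
      =O[𝓝 (0 : ℝ × ℝ)] fun p => ‖p‖ ^ 4) :
    ∃ A B C D : ℝ × ℝ → ℝ,
      (ContDiff ℝ ∞ A ∧ ContDiff ℝ ∞ B ∧ ContDiff ℝ ∞ C ∧ ContDiff ℝ ∞ D) ∧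
      (∀ r t, A (r, t + 2 * Real.pi) = A (r, t) ∧ B (r, t + 2 * Real.pi) = B (r, t) ∧
        C (r, t + 2 * Real.pi) = C (r, t) ∧ D (r, t + 2 * Real.pi) = D (r, t)) ∧
      (∀ q, hessDet h (polarMap q) = q.1 ^ 2 * D q) ∧
      (∀ q, extDiscr h (polarMap q) = 4 * q.1 ^ 4 * (B q ^ 2 - A q * C q)) ∧
      (∀ q w, extForm h (polarMap q) (fderiv ℝ polarMap q w) = q.1 ^ 2 * polarForm A B C q w) ∧
      ∀ t, 0 < A (0, t) ∧ 0 < -C (0, t) ∧ 0 < -D (0, t) := by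
  obtain ⟨⟨j1, j2, j3⟩, j4, j5, j6, j7⟩ := flat_umbilic_jet hh hO
  have hu := contDiff_pdu hh
  have hv := contDiff_pdv hh
  have huu := contDiff_pdu hu
  have huv := contDiff_pdv hu
  have hvv := contDiff_pdv hv
  have e1 : pdu (pdv (pdu h)) = pdv (pdu (pdu h)) := funext (pdu_pdv_comm hu)
  have e2 : pdu (pdv (pdv h)) = pdv (pdv (pdu h)) := by
    rw [← show pdu (pdv h) = pdv (pdu h) from funext (pdu_pdv_comm hh)]
    exact funext (pdu_pdv_comm hv)
  obtain ⟨x, hx, ex, px, vx⟩ := exists_polar_quotient huu j1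
  obtain ⟨y, hy, ey, py, vy⟩ := exists_polar_quotient huv j2
  obtain ⟨z, hz, ez, pz, vz⟩ := exists_polar_quotient hvv j3
  rw [j4, j5] at vx
  rw [e1, j5, j6] at vy
  rw [e2, j6, j7] at vz
  let a₀ := fun q => pdu (pdu (pdu h)) (polarMap q)
  let a₁ := fun q => pdv (pdu (pdu h)) (polarMap q)
  let a₂ := fun q => pdv (pdv (pdu h)) (polarMap q)
  let a₃ := fun q => pdv (pdv (pdv h)) (polarMap q)
  let b₀ := fun q => pdu (pdu (pdu (pdu h))) (polarMap q)
  let b₁ := fun q => pdv (pdu (pdu (pdu h))) (polarMap q)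
  let b₂ := fun q => pdv (pdv (pdu (pdu h))) (polarMap q)
  let b₃ := fun q => pdv (pdv (pdv (pdu h))) (polarMap q)
  let b₄ := fun q => pdv (pdv (pdv (pdv h))) (polarMap q)
  have ca₀ : ContDiff ℝ ∞ a₀ := (contDiff_pdu huu).comp contDiff_polarMap
  have ca₁ : ContDiff ℝ ∞ a₁ := (contDiff_pdv huu).comp contDiff_polarMap
  have ca₂ : ContDiff ℝ ∞ a₂ := (contDiff_pdv huv).comp contDiff_polarMap
  have ca₃ : ContDiff ℝ ∞ a₃ := (contDiff_pdv hvv).comp contDiff_polarMap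
  have cb₀ : ContDiff ℝ ∞ b₀ := (contDiff_pdu (contDiff_pdu huu)).comp contDiff_polarMap
  have cb₁ : ContDiff ℝ ∞ b₁ := (contDiff_pdv (contDiff_pdu huu)).comp contDiff_polarMap
  have cb₂ : ContDiff ℝ ∞ b₂ := (contDiff_pdv (contDiff_pdv huu)).comp contDiff_polarMap
  have cb₃ : ContDiff ℝ ∞ b₃ := (contDiff_pdv (contDiff_pdv huv)).comp contDiff_polarMap
  have cb₄ : ContDiff ℝ ∞ b₄ := (contDiff_pdv (contDiff_pdv hvv)).comp contDiff_polarMap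
  -- Each monomial of the numerators has either two second derivatives and two third ones, or three
  -- second derivatives and one fourth. Dividing by `r ^ 2` thus leaves a factor `r` on the
  -- fourth-order terms only.
  let SA := fun q : ℝ × ℝ =>
    scaledA q.1 (x q) (y q) (z q) (a₀ q) (a₁ q) (a₂ q) (a₃ q) (b₀ q) (b₁ q) (b₂ q)
  let SB := fun q : ℝ × ℝ =>
    scaledB q.1 (x q) (y q) (z q) (a₀ q) (a₁ q) (a₂ q) (a₃ q) (b₁ q) (b₂ q) (b₃ q)
  let SC := fun q : ℝ × ℝ =>
    scaledC q.1 (x q) (y q) (z q) (a₀ q) (a₁ q) (a₂ q) (a₃ q) (b₂ q) (b₃ q) (b₄ q)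
  have eA : ∀ q, extA h (polarMap q) = q.1 ^ 2 * SA q := by
    intro q
    simp only [extA, ex, ey, ez, SA, scaledA, a₀, a₁, a₂, a₃, b₀, b₁, b₂]
    ring
  have eB : ∀ q, extB h (polarMap q) = q.1 ^ 2 * SB q := by
    intro q
    simp only [extB, ex, ey, ez, SB, scaledB, a₀, a₁, a₂, a₃, b₁, b₂, b₃]
    ring
  have eC : ∀ q, extC h (polarMap q) = q.1 ^ 2 * SC q := by
    intro q
    simp only [extC, ex, ey, ez, SC, scaledC, a₀, a₁, a₂, a₃, b₂, b₃, b₄]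
    ring
  have cSA : ContDiff ℝ ∞ SA := by
    simp only [SA, scaledA]
    fun_prop
  have cSB : ContDiff ℝ ∞ SB := by
    simp only [SB, scaledB]
    fun_prop
  have cSC : ContDiff ℝ ∞ SC := by
    simp only [SC, scaledC]
    fun_prop
  have pS : ∀ r t, SA (r, t + 2 * Real.pi) = SA (r, t) ∧ SB (r, t + 2 * Real.pi) = SB (r, t) ∧
      SC (r, t + 2 * Real.pi) = SC (r, t) := by
    intro r t
    simp only [SA, SB, SC, px, py, pz, a₀, a₁, a₂, a₃, b₀, b₁, b₂, b₃, b₄, polarMap_add_period,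
      and_self]
  have p0 : ∀ t : ℝ, polarMap (0, t) = 0 := fun t => by simp [polarMap]
  -- The coefficients in the orthonormal coframe `dr`, `r dt`, obtained by rotating the form through
  -- the angle `t`; the rotation preserves `B² - A C`.
  refine ⟨fun q => SA q * Real.cos q.2 ^ 2 + 2 * SB q * Real.cos q.2 * Real.sin q.2
      + SC q * Real.sin q.2 ^ 2,
    fun q => (SC q - SA q) * Real.cos q.2 * Real.sin q.2
      + SB q * (Real.cos q.2 ^ 2 - Real.sin q.2 ^ 2),
    fun q => SA q * Real.sin q.2 ^ 2 - 2 * SB q * Real.cos q.2 * Real.sin q.2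
      + SC q * Real.cos q.2 ^ 2,
    fun q => x q * z q - y q ^ 2, ⟨by fun_prop, by fun_prop, by fun_prop, by fun_prop⟩,
    fun r t => ?_, fun q => ?_, fun q => ?_, fun q w => ?_, fun t => ?_⟩
  · simp only [(pS r t).1, (pS r t).2.1, (pS r t).2.2, px, py, pz, Real.cos_add_two_pi,
      Real.sin_add_two_pi, and_self]
  · rw [hessDet, ex, ey, ez]
    ring
  · rw [extDiscr, eA, eB, eC]
    have h1 := Real.sin_sq_add_cos_sq q.2
    linear_combination -(4 * q.1 ^ 4 * (SB q ^ 2 - SA q * SC q)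
      * (Real.sin q.2 ^ 2 + Real.cos q.2 ^ 2 + 1)) * h1
  · rw [fderiv_polarMap, extForm, eA, eB, eC, polarForm]
    ring
  · have h1 := Real.sin_sq_add_cos_sq t
    simp only [SA, SB, SC, scaledA, scaledB, scaledC, vx, vy, vz, a₀, a₁, a₂, a₃, b₀, b₁, b₂, b₃, b₄,
      p0, j4, j5, j6, j7]
    generalize Real.sin t = s at *
    generalize Real.cos t = k at *
    have hs : s ^ 2 = 1 - k ^ 2 := by linarith
    have hk1 : 0 ≤ k ^ 2 := sq_nonneg k
    have hk2 : 0 ≤ s ^ 2 := sq_nonneg s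
    -- On `r = 0` the first coefficient is `192 c² (3 k² + c s²)²` and `-D` is `4 c (3 k² + c s²)`.
    -- The negative of the third is `768 (1 - k² + k⁴)` for `c = 1` and the constant `20736` for `c
    -- = 3`.
    rcases hc with rfl | rfl
    · refine ⟨?_, ?_, ?_⟩
      · have : 0 < 192 * (1 + 2 * k ^ 2) ^ 2 := by positivity
        convert this using 1
        linear_combination (192 * (k ^ 2 * 6 + (s ^ 2 + 1 - k ^ 2))) * hs
      · have : 0 < 768 * (1 - k ^ 2 + k ^ 4) := by nlinarith [sq_nonneg (k ^ 2 - 1)]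
        convert this using 1
        linear_combination (768 * (s ^ 2 + 1)) * hs
      · nlinarith
    · refine ⟨?_, ?_, ?_⟩
      · convert (show (0:ℝ) < 15552 by norm_num) using 1
        linear_combination (15552 * (s ^ 2 + 1 + k ^ 2)) * hs
      · convert (show (0:ℝ) < 20736 by norm_num) using 1
        linear_combination (20736 * (s ^ 2 + 1 + k ^ 2)) * hs
      · nlinarith

end PolarCoefficients

/-! ### The two root fields and their bounds on a strip. -/

section Roots

open scoped NNReal

/-- The tube lemma over one period of the angle; periodicity spreads the bound to all angles. -/
theorem exists_uniform_radius {F : ℝ × ℝ → ℝ} (hF : Continuous F)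
    (hper : ∀ r t, F (r, t + 2 * Real.pi) = F (r, t)) (h0 : ∀ t, 0 < F (0, t)) :
    ∃ ε : ℝ, 0 < ε ∧ ∀ r t, 0 ≤ r → r ≤ ε → 0 < F (r, t) := by
  obtain ⟨u, v, hu, -, h0u, hv, huv⟩ := generalized_tube_lemma (isCompact_singleton (x := (0 : ℝ)))
    (isCompact_Icc (a := 0) (b := 2 * Real.pi)) (isOpen_lt continuous_const hF)
    (by rintro ⟨r, t⟩ ⟨rfl, -⟩; exact h0 t)
  obtain ⟨δ, hδ, hball⟩ := Metric.isOpen_iff.1 hu 0 (h0u rfl)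
  refine ⟨δ / 2, by positivity, fun r t hr hrδ => ?_⟩
  have hp : Function.Periodic (fun t => F (r, t)) (2 * Real.pi) := hper r
  obtain ⟨s, hs, hst⟩ := hp.exists_mem_Ico₀ (by positivity) t
  rw [hst]
  refine huv (show (r, s) ∈ _ from ⟨hball ?_, hv (Ico_subset_Icc_self hs)⟩)
  rw [Metric.mem_ball, Real.dist_eq, sub_zero, abs_of_nonneg hr]
  linarith

theorem abs_exp_min_sub_le {ρ : ℝ} (hρ : 0 < ρ) (x y : ℝ) :
    |Real.exp (min x (Real.log ρ)) - Real.exp (min y (Real.log ρ))| ≤ ρ * |x - y| := by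
  have h1 := (convex_Iic (Real.log ρ)).norm_image_sub_le_of_norm_deriv_le (f := Real.exp) (C := ρ)
    (fun x _ => Real.differentiableAt_exp) (fun x hx => by
      rw [Real.deriv_exp, Real.norm_eq_abs, Real.abs_exp]
      exact (Real.le_log_iff_exp_le hρ).1 hx)
    (min_le_right y (Real.log ρ)) (min_le_right x (Real.log ρ))
  rw [Real.norm_eq_abs, Real.norm_eq_abs] at h1
  have h2 := abs_min_sub_min_le_max x (Real.log ρ) y (Real.log ρ)
  rw [sub_self, abs_zero, max_eq_left (abs_nonneg _)] at h2
  exact h1.trans (mul_le_mul_of_nonneg_left h2 hρ.le)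

/-- The field `σ(r, t)` in the variable `x = log r`, frozen beyond `r = ρ`. -/
noncomputable def logField (σ : ℝ × ℝ → ℝ) (ρ t x : ℝ) : ℝ := σ (Real.exp (min x (Real.log ρ)), t)

/-- Freezing at `r = ρ` and periodicity reduce all bounds to the compact rectangle `[0, ρ] × [0,
2π]`. If `C` bounds the derivative of `σ` there, the Lipschitz constant in `x = log r` is `C * ρ`,
because `exp` is `ρ`-Lipschitz below `log ρ`. -/
theorem exists_isTransverseField {σ : ℝ × ℝ → ℝ} {O : Set (ℝ × ℝ)} (hO : IsOpen O)
    (hσ : ContDiffOn ℝ ∞ σ O) (hper : ∀ r t, σ (r, t + 2 * Real.pi) = σ (r, t)) {ρ : ℝ}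
    (hρ : 0 < ρ) (hsub : ∀ r t, 0 ≤ r → r ≤ ρ → (r, t) ∈ O) {e : ℝ} (he : e = 1 ∨ e = -1)
    (hpos : ∀ r t, 0 ≤ r → r ≤ ρ → 0 < e * σ (r, t)) :
    ∃ K m M, IsTransverseField e (logField σ ρ) K m M := by
  let S : Set (ℝ × ℝ) := Icc 0 ρ ×ˢ Icc 0 (2 * Real.pi)
  have hS : IsCompact S := isCompact_Icc.prod isCompact_Icc
  have hSO : S ⊆ O := fun q hq => hsub q.1 q.2 hq.1.1 hq.1.2
  have hSne : S.Nonempty := ⟨(0, 0), ⟨le_rfl, hρ.le⟩, le_rfl, by positivity⟩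
  have hcont : ContinuousOn (fun q => e * σ q) S :=
    (hσ.continuousOn.mono hSO).const_mul e
  obtain ⟨qm, hqm, hmin⟩ := hS.exists_isMinOn hSne hcont
  obtain ⟨qM, hqM, hmax⟩ := hS.exists_isMaxOn hSne hcont
  have hfd : ContinuousOn (fderiv ℝ σ) S :=
    (hσ.continuousOn_fderiv_of_isOpen hO (by simp)).mono hSO
  obtain ⟨C, hC⟩ := (hS.image_of_continuousOn hfd).isBounded.exists_norm_le
  have hred : ∀ t, ∃ s ∈ Icc 0 (2 * Real.pi), ∀ r, σ (r, t) = σ (r, s) := by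
    intro t
    have hp : Function.Periodic (fun t r => σ (r, t)) (2 * Real.pi) := fun t =>
      funext fun r => hper r t
    obtain ⟨s, hs, hst⟩ := hp.exists_mem_Ico₀ (by positivity) t
    exact ⟨s, Ico_subset_Icc_self hs, fun r => congrFun hst r⟩
  have hin : ∀ x, Real.exp (min x (Real.log ρ)) ∈ Icc 0 ρ := fun x =>
    ⟨(Real.exp_pos _).le, (Real.le_log_iff_exp_le hρ).1 (min_le_right _ _)⟩
  have hC0 : 0 ≤ C := (norm_nonneg _).trans (hC _ ⟨_, hqm, rfl⟩)
  refine ⟨⟨C * ρ, by positivity⟩, e * σ qm, e * σ qM, ⟨he, fun t => ?_, fun x => ?_,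
    hpos _ _ hqm.1.1 hqm.1.2, fun t x => ?_, fun t x => ?_⟩⟩
  · obtain ⟨s, hs, hst⟩ := hred t
    refine LipschitzWith.of_dist_le_mul fun x y => ?_
    rw [Real.dist_eq, Real.dist_eq, logField, logField, hst, hst]
    have h1 := ((convex_Icc 0 ρ).prod (convex_Icc 0 (2 * Real.pi))).norm_image_sub_le_of_norm_fderiv_le
      (𝕜 := ℝ) (f := σ) (C := C)
      (fun q hq => (hσ.contDiffAt (hO.mem_nhds (hSO hq))).differentiableAt (by simp))
      (fun q hq => hC _ ⟨q, hq, rfl⟩)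
      (show (Real.exp (min y (Real.log ρ)), s) ∈ Icc 0 ρ ×ˢ Icc 0 (2 * Real.pi) from ⟨hin y, hs⟩)
      (show (Real.exp (min x (Real.log ρ)), s) ∈ Icc 0 ρ ×ˢ Icc 0 (2 * Real.pi) from ⟨hin x, hs⟩)
    rw [Prod.mk_sub_mk, sub_self, Prod.norm_mk, norm_zero, max_eq_left (norm_nonneg _),
      Real.norm_eq_abs, Real.norm_eq_abs] at h1
    refine h1.trans ((mul_le_mul_of_nonneg_left (abs_exp_min_sub_le hρ x y) hC0).trans_eq ?_)
    change _ = C * ρ * _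
    ring
  · rw [continuous_iff_continuousAt]
    intro t
    have h1 : ContinuousAt σ (Real.exp (min x (Real.log ρ)), t) :=
      hσ.continuousOn.continuousAt (hO.mem_nhds (hsub _ _ (hin x).1 (hin x).2))
    exact h1.comp (f := fun t => (Real.exp (min x (Real.log ρ)), t)) (by fun_prop)
  · obtain ⟨s, hs, hst⟩ := hred t
    rw [logField, hst]
    exact hmin (show (_, s) ∈ S from ⟨hin x, hs⟩)
  · obtain ⟨s, hs, hst⟩ := hred t
    rw [logField, hst]
    exact hmax (show (_, s) ∈ S from ⟨hin x, hs⟩)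

theorem IsTransverseField.weaken {e : ℝ} {f : ℝ → ℝ → ℝ} {K : ℝ≥0} {m M m' M' : ℝ}
    (h : IsTransverseField e f K m M) (hm' : 0 < m') (hm : m' ≤ m) (hM : M ≤ M') :
    IsTransverseField e f K m' M' :=
  ⟨h.sign, h.lip, h.cont, hm', fun t x => hm.trans (h.lower t x), fun t x => (h.upper t x).trans hM⟩

theorem IsTransverseField.continuous_uncurry {e : ℝ} {f : ℝ → ℝ → ℝ} {K : ℝ≥0} {m M : ℝ}
    (h : IsTransverseField e f K m M) : Continuous fun q : ℝ × ℝ => f q.2 q.1 :=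
  continuous_prod_of_continuous_lipschitzWith (fun z : ℝ × ℝ => f z.2 z.1) K h.cont h.lip

/-- The roots of `A s² + 2 B s + C`. -/
noncomputable def rootField (A B C : ℝ × ℝ → ℝ) (ε : ℝ) (q : ℝ × ℝ) : ℝ :=
  (-B q + ε * √(B q ^ 2 - A q * C q)) / A q

/-- The product `C / A` of the roots is negative; equivalently the square root exceeds `|B|`. -/
theorem rootField_sign {A B C : ℝ × ℝ → ℝ} {q : ℝ × ℝ} (hA : 0 < A q) (hC : 0 < -C q) {ε : ℝ}
    (hε : ε = 1 ∨ ε = -1) : 0 < ε * rootField A B C ε q := by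
  have h1 : |B q| < √(B q ^ 2 - A q * C q) := by
    apply Real.lt_sqrt_of_sq_lt
    rw [sq_abs]
    nlinarith [mul_pos hA hC]
  have h2 := abs_lt.1 h1
  rw [rootField, ← mul_div_assoc]
  apply div_pos _ hA
  rcases hε with rfl | rfl <;> linarith [h2.1, h2.2]

theorem contDiffOn_rootField {A B C : ℝ × ℝ → ℝ} (hA : ContDiff ℝ ∞ A) (hB : ContDiff ℝ ∞ B)
    (hC : ContDiff ℝ ∞ C) (ε : ℝ) :
    ContDiffOn ℝ ∞ (rootField A B C ε) {q | 0 < A q ∧ 0 < -C q} := by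
  rintro q ⟨h1, h2⟩
  have hd : B q ^ 2 - A q * C q ≠ 0 := by nlinarith [mul_pos h1 h2, sq_nonneg (B q)]
  have h3 : ContDiffAt ℝ ∞ (fun q => √(B q ^ 2 - A q * C q)) q :=
    ContDiffAt.sqrt (by fun_prop) hd
  exact ((hB.contDiffAt.neg.add (contDiffAt_const.mul h3)).div hA.contDiffAt
    h1.ne').contDiffWithinAt

/-- The form factors as `A (dr - r σ₋ dt) (dr - r σ₊ dt)`. This remains true on `r = 0`, where both
factors are `dr` and the two lines coincide. -/
theorem polarForm_eq_zero_iff {A B C : ℝ × ℝ → ℝ} {q : ℝ × ℝ} (hA : 0 < A q) (hC : 0 < -C q)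
    (w : ℝ × ℝ) : polarForm A B C q w = 0 ↔
      ∃ i : Fin 2, ∃ k : ℝ, w = k • (q.1 * rootField A B C (![-1, 1] i) q, (1 : ℝ)) := by
  have hs : √(B q ^ 2 - A q * C q) ^ 2 = B q ^ 2 - A q * C q :=
    Real.sq_sqrt (by nlinarith [mul_pos hA hC, sq_nonneg (B q)])
  have hf : polarForm A B C q w = A q * ((w.1 - q.1 * rootField A B C (-1) q * w.2) *
      (w.1 - q.1 * rootField A B C 1 q * w.2)) := by
    rw [polarForm, rootField, rootField]
    field_simp
    linear_combination q.1 ^ 2 * w.2 ^ 2 * hs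
  have hw : ∀ σ : ℝ, w.1 - q.1 * σ * w.2 = 0 ↔ ∃ k : ℝ, w = k • (q.1 * σ, (1 : ℝ)) := by
    intro σ
    constructor
    · intro h
      refine ⟨w.2, Prod.ext ?_ ?_⟩
      · simp only [Prod.smul_mk, smul_eq_mul]; linarith
      · simp
    · rintro ⟨k, rfl⟩
      simp only [Prod.smul_mk, smul_eq_mul]
      ring
  rw [hf, mul_eq_zero, mul_eq_zero, hw, hw, Fin.exists_fin_two]
  simp [hA.ne']

end Roots

/-! ### Line fields in the punctured plane and curves tangent to them. -/

section LineFields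

/-- A continuous nonvanishing vector along an interval which is everywhere tangent to one of two
transverse continuous fields is everywhere tangent to the same one. -/
theorem exists_common_index {I : Set ℝ} (hI : I.OrdConnected) {v : ℝ → ℝ × ℝ}
    {V : Fin 2 → ℝ → ℝ × ℝ} (hv : ContinuousOn v I) (hV : ∀ i, ContinuousOn (V i) I)
    (hv0 : ∀ s ∈ I, v s ≠ 0)
    (hdet : ∀ s ∈ I, (V 0 s).1 * (V 1 s).2 - (V 0 s).2 * (V 1 s).1 ≠ 0)
    (h : ∀ s ∈ I, ∃ i, ∃ k : ℝ, v s = k • V i s) : ∃ i, ∀ s ∈ I, ∃ k : ℝ, v s = k • V i s := by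
  let d : Fin 2 → ℝ → ℝ := fun i s => (v s).1 * (V i s).2 - (v s).2 * (V i s).1
  have hdc : ∀ i, ContinuousOn (d i) I := fun i =>
    (hv.fst.mul (hV i).snd).sub (hv.snd.mul (hV i).fst)
  have hd0 : ∀ i, ∀ s, (∃ k : ℝ, v s = k • V i s) → d i s = 0 := by
    rintro i s ⟨k, hk⟩
    simp only [d, hk, Prod.smul_fst, Prod.smul_snd, smul_eq_mul]
    ring
  -- At each time exactly one of the determinants `d 0`, `d 1` vanishes. The continuous function `d
  -- 0 ^ 2 - d 1 ^ 2` therefore has no zero on the interval, and its constant sign tells which field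
  -- is followed.
  have hne : ∀ s ∈ I, d 0 s ^ 2 - d 1 s ^ 2 ≠ 0 := by
    intro s hs hz
    obtain ⟨i, k, hk⟩ := h s hs
    have hi := hd0 i s ⟨k, hk⟩
    have h01 : d 0 s = 0 ∧ d 1 s = 0 := by
      fin_cases i
      · simp only [Fin.zero_eta] at hi
        refine ⟨hi, pow_eq_zero_iff (two_ne_zero) |>.1 ?_⟩
        rw [hi] at hz; linarith
      · simp only [Fin.mk_one] at hi
        refine ⟨pow_eq_zero_iff (two_ne_zero) |>.1 ?_, hi⟩
        rw [hi] at hz; linarith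
    apply hv0 s hs
    have hD := hdet s hs
    have e1 : (v s).1 * ((V 0 s).1 * (V 1 s).2 - (V 0 s).2 * (V 1 s).1) = 0 := by
      have a := h01.1
      have b := h01.2
      simp only [d] at a b
      linear_combination (V 0 s).1 * b - (V 1 s).1 * a
    have e2 : (v s).2 * ((V 0 s).1 * (V 1 s).2 - (V 0 s).2 * (V 1 s).1) = 0 := by
      have a := h01.1
      have b := h01.2
      simp only [d] at a b
      linear_combination (V 0 s).2 * b - (V 1 s).2 * a
    exact Prod.ext ((mul_eq_zero.1 e1).resolve_right hD) ((mul_eq_zero.1 e2).resolve_right hD)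
  have hwc : ContinuousOn (fun s => d 0 s ^ 2 - d 1 s ^ 2) I := ((hdc 0).pow 2).sub ((hdc 1).pow 2)
  have hsign : (∀ s ∈ I, 0 < d 0 s ^ 2 - d 1 s ^ 2) ∨ ∀ s ∈ I, d 0 s ^ 2 - d 1 s ^ 2 < 0 := by
    by_contra hcon
    push Not at hcon
    obtain ⟨⟨a, ha, ha'⟩, b, hb, hb'⟩ := hcon
    obtain ⟨s, hs, hs'⟩ := hI.isPreconnected.intermediate_value ha hb hwc ⟨ha', hb'⟩
    exact hne s hs hs'
  rcases hsign with hs | hs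
  · refine ⟨1, fun s hsI => ?_⟩
    obtain ⟨i, hi⟩ := h s hsI
    fin_cases i
    · have h1 := hs s hsI
      rw [hd0 0 s hi] at h1
      nlinarith [sq_nonneg (d 1 s)]
    · exact hi
  · refine ⟨0, fun s hsI => ?_⟩
    obtain ⟨i, hi⟩ := h s hsI
    fin_cases i
    · exact hi
    · have h1 := hs s hsI
      rw [hd0 1 s hi] at h1
      nlinarith [sq_nonneg (d 0 s)]

/-- The planar field given by `x' = f(t, x)`, `t' = 1` in logarithmic polar coordinates. -/
noncomputable def planarField (f : ℝ → ℝ → ℝ) (p : ℝ × ℝ) : ℝ × ℝ :=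
  f (logPolarSection p).2 (logPolarSection p).1 • p + rot p

/-- Two choices of logarithm differ by a multiple of `2π` in the angle, which the periodicity of `f`
absorbs. -/
theorem planarField_logPolar {f : ℝ → ℝ → ℝ} (hf : ∀ t x, f (t + 2 * Real.pi) x = f t x)
    (q : ℝ × ℝ) : planarField f (logPolar q) = f q.2 q.1 • logPolar q + rot (logPolar q) := by
  obtain ⟨k, hk⟩ := exists_int_of_logPolar_eq (logPolar_logPolarSection (logPolar_ne_zero q))
  have hp : Function.Periodic (fun t => f t q.1) (2 * Real.pi) := fun t => hf t q.1
  rw [planarField, hk]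
  simp only
  rw [show f (q.2 + k * (2 * Real.pi)) q.1 = f q.2 q.1 from hp.int_mul k q.2]

theorem continuousAt_planarField {f : ℝ → ℝ → ℝ} (hf : ∀ t x, f (t + 2 * Real.pi) x = f t x)
    (hc : Continuous fun q : ℝ × ℝ => f q.2 q.1) {p : ℝ × ℝ} (hp : p ≠ 0) :
    ContinuousAt (planarField f) p := by
  obtain ⟨q, rfl⟩ := exists_logPolar_eq hp
  rw [ContinuousAt, Tendsto, isOpenMap_logPolar.nhds_le q |>.antisymm
    continuous_logPolar.continuousAt, Filter.map_map]
  rw [show planarField f ∘ logPolar = _ from funext (planarField_logPolar hf),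
    planarField_logPolar hf]
  have hr : Continuous rot := by unfold rot; fun_prop
  exact ((hc.smul continuous_logPolar).add (hr.comp continuous_logPolar)).continuousAt

theorem polarMap_eq_logPolar {q : ℝ × ℝ} (hq : 0 < q.1) :
    polarMap q = logPolar (Real.log q.1, q.2) := by
  simp [logPolar, Real.exp_log hq]

theorem fderiv_polarMap_eq (q : ℝ × ℝ) (σ : ℝ) :
    fderiv ℝ polarMap q (q.1 * σ, 1) = σ • polarMap q + rot (polarMap q) := by
  rw [fderiv_polarMap]
  ext <;> simp [polarMap, rot] <;> ring

theorem exists_fderiv_polarMap_eq {q : ℝ × ℝ} (hq : 0 < q.1) (w : ℝ × ℝ) :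
    ∃ w', fderiv ℝ polarMap q w' = w := by
  refine ⟨(Real.cos q.2 * w.1 + Real.sin q.2 * w.2,
    (Real.cos q.2 * w.2 - Real.sin q.2 * w.1) / q.1), ?_⟩
  rw [fderiv_polarMap]
  have h := Real.sin_sq_add_cos_sq q.2
  ext <;> simp only <;> field_simp
  · linear_combination w.1 * h
  · linear_combination w.2 * h

end LineFields

/-! ### Choice of the disc and assembly. -/

section Main

theorem exists_disc_subset {W : Set (ℝ × ℝ)} (hW : W ∈ 𝓝 (0 : ℝ × ℝ)) :
    ∃ δ : ℝ, 0 < δ ∧ ∀ ρ, 0 < ρ → ρ ≤ δ → disc ρ ⊆ W := by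
  obtain ⟨δ, hδ, hball⟩ := Metric.mem_nhds_iff.1 hW
  refine ⟨δ, hδ, fun ρ hρ hρδ p hp => hball ?_⟩
  have hp' : p.1 ^ 2 + p.2 ^ 2 < ρ ^ 2 := hp
  rw [mem_ball_zero_iff, Prod.norm_def, max_lt_iff, Real.norm_eq_abs, Real.norm_eq_abs]
  have h1 := abs_lt_of_sq_lt_sq (show p.1 ^ 2 < ρ ^ 2 by nlinarith [sq_nonneg p.2]) hρ.le
  have h2 := abs_lt_of_sq_lt_sq (show p.2 ^ 2 < ρ ^ 2 by nlinarith [sq_nonneg p.1]) hρ.le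
  exact ⟨h1.trans_le hρδ, h2.trans_le hρδ⟩

theorem exists_polarMap_eq {ρ : ℝ} (hρ : 0 < ρ) {p : ℝ × ℝ} (hp : p ∈ disc ρ) (hp0 : p ≠ 0) :
    ∃ q : ℝ × ℝ, 0 < q.1 ∧ q.1 < ρ ∧ polarMap q = p := by
  obtain ⟨q, rfl⟩ := exists_logPolar_eq hp0
  rw [logPolar_mem_disc hρ, Real.lt_log_iff_exp_lt hρ] at hp
  exact ⟨(Real.exp q.1, q.2), Real.exp_pos _, hp, rfl⟩

end Main

theorem mainTheorem6 (c : ℝ) (hc : c = 1 ∨ c = 3) (U : Set (ℝ × ℝ)) (hU : IsOpen U)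
    (hU0 : (0 : ℝ × ℝ) ∈ U) (h : ℝ × ℝ → ℝ) (hsmooth : ContDiffOn ℝ ∞ h U)
    (hchart : (fun p : ℝ × ℝ => h p - (p.1 ^ 3 - c * p.1 * p.2 ^ 2))
      =O[𝓝 (0 : ℝ × ℝ)] fun p => ‖p‖ ^ 4) :
    ∃ ρ : ℝ, 0 < ρ ∧ disc ρ ⊆ U ∧
      -- the discriminant set is locally the isolated point `0`
      (∀ p ∈ disc ρ, extDiscr h p = 0 ↔ p = 0) ∧
      -- off `0` there are no parabolic points, and the extended equation is `III = 0`
      (∀ p ∈ disc ρ, p ≠ 0 → parabolicFun (monge h) p ≠ 0 ∧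
        ∀ w, affineIII (monge h) p w = 0 ↔ extForm h p w = 0) ∧
      ∃ (Abar Bbar Cbar : ℝ × ℝ → ℝ) (Y X : Fin 2 → ℝ × ℝ → ℝ × ℝ)
        (H : OpenPartialHomeomorph (ℝ × ℝ) (ℝ × ℝ)),
        -- the polar blow-up of the extended equation, divided by `r ^ 2`
        ContDiffOn ℝ ∞ Abar (strip ρ) ∧ ContDiffOn ℝ ∞ Bbar (strip ρ) ∧
          ContDiffOn ℝ ∞ Cbar (strip ρ) ∧
        (∀ q ∈ strip ρ, ∀ w, extForm h (polarMap q) (fderiv ℝ polarMap q w)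
          = q.1 ^ 2 * polarForm Abar Bbar Cbar q w) ∧
        -- its solutions form two line fields, regular up to and including `r = 0`
        (∀ i, ContDiffOn ℝ ∞ (Y i) (strip ρ)) ∧
        (∀ i, ∀ q ∈ strip ρ, 0 < (Y i q).2) ∧
        (∀ q ∈ strip ρ, ∀ w, polarForm Abar Bbar Cbar q w = 0 ↔ ∃ i, ∃ k : ℝ, w = k • Y i q) ∧
        -- they are transversal for `r > 0`, with `r` decreasing along `Y 0`, increasing along `Y 1`
        (∀ q ∈ strip ρ, 0 < q.1 → LinearIndependent ℝ ![Y 0 q, Y 1 q] ∧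
          (Y 0 q).1 < 0 ∧ 0 < (Y 1 q).1) ∧
        -- blowing down
        (∀ i, ∀ q ∈ strip ρ, 0 < q.1 → X i (polarMap q) = fderiv ℝ polarMap q (Y i q)) ∧
        -- the affine asymptotic lines are the regular curves tangent to one of the line fields
        (∀ (I : Set ℝ) (γ : ℝ → ℝ × ℝ), IsOpen I → I.OrdConnected →
          (∀ s ∈ I, γ s ∈ disc ρ ∧ γ s ≠ 0) →
          (IsAffineAsymptoticLine (monge h) I γ ↔
            IsRegularCurve I γ ∧ ∃ i, ∀ s ∈ I, ∃ k : ℝ, deriv γ s = k • X i (γ s))) ∧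
        -- a stable and an unstable focus
        SpiralsIn (X 0) ρ ∧ SpiralsOut (X 1) ρ ∧
        -- one homeomorphism carries the pair to the pair of linear foci
        H.source = disc ρ ∧ H.target = disc 1 ∧
        IsTopologicalEquivalence (X 0) (linearFocus (-1)) H ∧
        IsTopologicalEquivalence (X 1) (linearFocus 1) H := by
  -- All computations are made for a globally smooth `g` with the same germ at `0`. The disc is
  -- later chosen so small that `h` and `g` agree near each of its points.
  obtain ⟨g, hg, hgh⟩ := exists_contDiff_eventuallyEq hU hU0 hsmooth
  have hchart' : (fun p : ℝ × ℝ => g p - (p.1 ^ 3 - c * p.1 * p.2 ^ 2))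
      =O[𝓝 (0 : ℝ × ℝ)] fun p => ‖p‖ ^ 4 :=
    (hchart.congr' (hgh.mono fun p hp => by simp only [hp]) EventuallyEq.rfl)
  obtain ⟨A, B, C, D, ⟨cA, cB, cC, cD⟩, hper, hdet, hdiscr, hform, h0⟩ :=
    exists_polar_coefficients hg hc hchart'
  obtain ⟨ε₁, hε₁, pA⟩ := exists_uniform_radius cA.continuous (fun r t => (hper r t).1)
    (fun t => (h0 t).1)
  obtain ⟨ε₂, hε₂, pC⟩ := exists_uniform_radius (F := fun q => -C q) cC.continuous.neg
    (fun r t => by simp only [(hper r t).2.2.1]) (fun t => (h0 t).2.1)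
  obtain ⟨ε₃, hε₃, pD⟩ := exists_uniform_radius (F := fun q => -D q) cD.continuous.neg
    (fun r t => by simp only [(hper r t).2.2.2]) (fun t => (h0 t).2.2)
  obtain ⟨δ, hδ, hdisc⟩ := exists_disc_subset
    (inter_mem (hU.mem_nhds hU0) (eventually_eventually_nhds.2 hgh))
  obtain ⟨ρ, hρ, hρ₁, hρ₂, hρ₃, hρδ⟩ : ∃ ρ : ℝ, 0 < ρ ∧ ρ ≤ ε₁ ∧ ρ ≤ ε₂ ∧ ρ ≤ ε₃ ∧ ρ ≤ δ :=
    ⟨min (min ε₁ ε₂) (min ε₃ δ), by positivity, by simp, by simp, by simp, by simp⟩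
  replace pA : ∀ r t, 0 ≤ r → r ≤ ρ → 0 < A (r, t) := fun r t h1 h2 => pA r t h1 (h2.trans hρ₁)
  replace pC : ∀ r t, 0 ≤ r → r ≤ ρ → 0 < -C (r, t) := fun r t h1 h2 => pC r t h1 (h2.trans hρ₂)
  replace pD : ∀ r t, 0 ≤ r → r ≤ ρ → 0 < -D (r, t) := fun r t h1 h2 => pD r t h1 (h2.trans hρ₃)
  replace hdisc := hdisc ρ hρ hρδ
  have heq : ∀ p ∈ disc ρ, h =ᶠ[𝓝 p] g := fun p hp => (hdisc hp).2.mono fun q hq => hq.symm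
  let O : Set (ℝ × ℝ) := {q | 0 < A q ∧ 0 < -C q}
  have hO : IsOpen O := (isOpen_lt continuous_const cA.continuous).inter
    (isOpen_lt continuous_const cC.continuous.neg)
  have hsub : ∀ r t, 0 ≤ r → r ≤ ρ → (r, t) ∈ O := fun r t h1 h2 => ⟨pA r t h1 h2, pC r t h1 h2⟩
  have hstrip : strip ρ ⊆ O := fun q hq => hsub q.1 q.2 hq.1 hq.2.le
  let σ : Fin 2 → ℝ × ℝ → ℝ := fun i => rootField A B C (![-1, 1] i)
  have hσc : ∀ i, ContDiffOn ℝ ∞ (σ i) O := fun i => contDiffOn_rootField cA cB cC _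
  have hσp : ∀ i r t, σ i (r, t + 2 * Real.pi) = σ i (r, t) := by
    intro i r t
    simp only [σ, rootField, (hper r t).1, (hper r t).2.1, (hper r t).2.2.1]
  have hsgn : ∀ i : Fin 2, (![-1, 1] i : ℝ) = 1 ∨ (![-1, 1] i : ℝ) = -1 := by
    intro i; fin_cases i <;> simp
  have hσs : ∀ (i : Fin 2) r t, 0 ≤ r → r ≤ ρ → 0 < (![-1, 1] i : ℝ) * σ i (r, t) :=
    fun i r t h1 h2 => rootField_sign (pA r t h1 h2) (pC r t h1 h2) (hsgn i)
  let f : Fin 2 → ℝ → ℝ → ℝ := fun i => logField (σ i) ρ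
  have hfp : ∀ i t x, f i (t + 2 * Real.pi) x = f i t x := fun i t x => hσp i _ t
  have htf : ∀ i, ∃ K m M, IsTransverseField (![-1, 1] i) (f i) K m M := fun i =>
    exists_isTransverseField hO (hσc i) (hσp i) hρ hsub (hsgn i) (hσs i)
  obtain ⟨K₀, m₀, M₀, hf₀⟩ := htf 0
  obtain ⟨K₁, m₁, M₁, hf₁⟩ := htf 1
  simp only [cons_val_zero, cons_val_one] at hf₀ hf₁
  -- The straightening bounds use one pair of slope constants for both families.
  have hm : 0 < min m₀ m₁ := lt_min hf₀.pos hf₁.pos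
  have T₀ := hf₀.weaken hm (min_le_left _ _) (le_max_left M₀ M₁)
  have T₁ := hf₁.weaken hm (min_le_right _ _) (le_max_right M₀ M₁)
  have hfc : ∀ i, Continuous fun q : ℝ × ℝ => f i q.2 q.1 := by
    intro i
    fin_cases i
    exacts [T₀.continuous_uncurry, T₁.continuous_uncurry]
  let X : Fin 2 → ℝ × ℝ → ℝ × ℝ := fun i => planarField (f i)
  -- Normalised to unit angular speed, the solutions `dr = r σ dt` are smooth up to `r = 0`, where
  -- both become `(0, 1)`.
  let Y : Fin 2 → ℝ × ℝ → ℝ × ℝ := fun i q => (q.1 * σ i q, 1)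
  have hXlog : ∀ i x t, x < Real.log ρ → X i (logPolar (x, t)) =
      f i t x • logPolar (x, t) + rot (logPolar (x, t)) := fun i x t _ =>
    planarField_logPolar (hfp i) (x, t)
  have hXY : ∀ i, ∀ q ∈ strip ρ, 0 < q.1 → X i (polarMap q) = fderiv ℝ polarMap q (Y i q) := by
    intro i q hq hq0
    have h1 : f i q.2 (Real.log q.1) = σ i q := by
      simp only [f, logField]
      rw [min_eq_left (Real.log_le_log hq0 hq.2.le), Real.exp_log hq0]
    rw [fderiv_polarMap_eq, polarMap_eq_logPolar hq0, ← h1]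
    exact planarField_logPolar (hfp i) _
  have hsol : ∀ q ∈ strip ρ, ∀ w, polarForm A B C q w = 0 ↔ ∃ i, ∃ k : ℝ, w = k • Y i q :=
    fun q hq w => polarForm_eq_zero_iff (hstrip hq).1 (hstrip hq).2 w
  have hform' : ∀ q ∈ strip ρ, ∀ w, extForm h (polarMap q) (fderiv ℝ polarMap q w)
      = q.1 ^ 2 * polarForm A B C q w := by
    intro q hq w
    rw [← hform, extForm_congr]
    apply heq
    change (q.1 * Real.cos q.2) ^ 2 + (q.1 * Real.sin q.2) ^ 2 < ρ ^ 2
    have h1 := Real.sin_sq_add_cos_sq q.2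
    have h2 := pow_lt_pow_left₀ hq.2 hq.1 two_ne_zero
    have h3 : (q.1 * Real.cos q.2) ^ 2 + (q.1 * Real.sin q.2) ^ 2 = q.1 ^ 2 := by
      linear_combination q.1 ^ 2 * h1
    rwa [h3]
  have hextX : ∀ p ∈ disc ρ, p ≠ 0 → ∀ w, extForm h p w = 0 ↔ ∃ i, ∃ k : ℝ, w = k • X i p := by
    intro p hp hp0 w
    obtain ⟨q, hq0, hqρ, rfl⟩ := exists_polarMap_eq hρ hp hp0
    have hq : q ∈ strip ρ := ⟨hq0.le, hqρ⟩
    constructor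
    · intro hw
      obtain ⟨w', rfl⟩ := exists_fderiv_polarMap_eq hq0 w
      rw [hform' q hq, mul_eq_zero, hsol q hq] at hw
      obtain ⟨i, k, rfl⟩ := hw.resolve_left (pow_ne_zero _ hq0.ne')
      exact ⟨i, k, by rw [hXY i q hq hq0, map_smul]⟩
    · rintro ⟨i, k, rfl⟩
      rw [hXY i q hq hq0, ← map_smul, hform' q hq, (hsol q hq _).2 ⟨i, k, rfl⟩, mul_zero]
  have hpar : ∀ p ∈ disc ρ, p ≠ 0 → hessDet g p < 0 := by
    intro p hp hp0
    obtain ⟨q, hq0, hqρ, rfl⟩ := exists_polarMap_eq hρ hp hp0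
    rw [hdet]
    have := mul_pos (pow_pos hq0 2) (pD q.1 q.2 hq0.le hqρ.le)
    linarith
  have hIII : ∀ p ∈ disc ρ, p ≠ 0 → parabolicFun (monge h) p ≠ 0 ∧
      ∀ w, affineIII (monge h) p w = 0 ↔ extForm h p w = 0 := by
    intro p hp hp0
    have hmg := monge_congr (heq p hp)
    have hd := hpar p hp hp0
    refine ⟨?_, fun w => ?_⟩
    · rw [(parabolicFun_congr hmg).eq_of_nhds, parabolicFun_monge hg]
      exact hd.ne
    · obtain ⟨k, hk, hkw⟩ := affineIII_monge hg hd
      rw [affineIII_congr hmg, hkw, extForm_congr (heq p hp), mul_eq_zero, or_iff_right hk]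
  obtain ⟨H, Hs, Ht, HX₀, HX₁⟩ := exists_foci_equivalence T₀ T₁ (hfp 0) (hfp 1) hρ (hXlog 0)
    (hXlog 1)
  refine ⟨ρ, hρ, fun p hp => (hdisc hp).1, fun p hp => ?_, hIII, A, B, C, Y, X, H,
    cA.contDiffOn, cB.contDiffOn, cC.contDiffOn, hform', fun i => ?_, fun i q _ => one_pos, hsol,
    fun q hq hq0 => ?_, hXY, fun I γ hIo hI hγ => ?_, T₀.spiralsIn hρ (hXlog 0),
    T₁.spiralsOut hρ (hXlog 1), Hs, Ht, HX₀, HX₁⟩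
  · rw [extDiscr_congr (heq p hp)]
    constructor
    · intro hz
      by_contra hp0
      obtain ⟨q, hq0, hqρ, rfl⟩ := exists_polarMap_eq hρ hp hp0
      rw [hdiscr] at hz
      have h1 := mul_pos (pA q.1 q.2 hq0.le hqρ.le) (pC q.1 q.2 hq0.le hqρ.le)
      have h2 : 0 < B q ^ 2 - A q * C q := by nlinarith [sq_nonneg (B q)]
      have h3 : 0 < 4 * q.1 ^ 4 := by positivity
      exact (mul_pos h3 h2).ne' hz
    · rintro rfl
      have h1 := hdiscr 0
      rw [show polarMap 0 = 0 by simp [polarMap]] at h1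
      simpa using h1
  · exact (contDiff_fst.contDiffOn.mul ((hσc i).mono hstrip)).prodMk contDiffOn_const
  · have h1 := hσs 0 q.1 q.2 hq.1 hq.2.le
    have h2 := hσs 1 q.1 q.2 hq.1 hq.2.le
    simp only [cons_val_zero, cons_val_one] at h1 h2
    have h3 : q.1 * σ 0 q < 0 := mul_neg_of_pos_of_neg hq0 (by linarith)
    have h4 : 0 < q.1 * σ 1 q := mul_pos hq0 (by linarith)
    refine ⟨?_, h3, h4⟩
    rw [LinearIndependent.pair_iff]
    intro a b hab
    have e1 := congrArg Prod.fst hab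
    have e2 := congrArg Prod.snd hab
    simp only [Y, Prod.fst_add, Prod.snd_add, Prod.smul_fst, Prod.smul_snd, smul_eq_mul, mul_one,
      Prod.fst_zero, Prod.snd_zero] at e1 e2
    have e3 : a * (q.1 * σ 0 q - q.1 * σ 1 q) = 0 := by
      linear_combination e1 - q.1 * σ 1 q * e2
    have ha : a = 0 := (mul_eq_zero.1 e3).resolve_right (by linarith)
    exact ⟨ha, by rw [ha] at e2; linarith⟩
  · constructor
    · rintro ⟨hreg, hasy⟩
      refine ⟨hreg, ?_⟩
      refine exists_common_index hI (V := fun i s => X i (γ s)) hreg.2 (fun i s hs => ?_)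
        (fun s hs => (hreg.1 s hs).2) (fun s hs => ?_) (fun s hs => ?_)
      · exact ((continuousAt_planarField (hfp i) (hfc i) (hγ s hs).2).comp
          (hreg.1 s hs).1.continuousAt).continuousWithinAt
      · simp only [X]
        obtain ⟨q, hq⟩ := exists_logPolar_eq (hγ s hs).2
        rw [← hq, planarField_logPolar (hfp 0), planarField_logPolar (hfp 1)]
        have h1 := T₀.lower q.2 q.1
        have h2 := T₁.lower q.2 q.1
        have h3 := logPolar_normSq q
        have h4 := pow_pos (Real.exp_pos q.1) 2
        rw [← h3] at h4
        simp only [rot, Prod.fst_add, Prod.snd_add, Prod.smul_fst, Prod.smul_snd, smul_eq_mul]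
        intro hz
        -- The determinant of `f₀ p + J p` and `f₁ p + J p` is `(f₀ - f₁) |p|²`, and `f₀ < 0 < f₁`.
        have h5 : (f 0 q.2 q.1 - f 1 q.2 q.1) *
            ((logPolar q).1 ^ 2 + (logPolar q).2 ^ 2) = 0 := by linear_combination hz
        have h6 := (mul_eq_zero.1 h5).resolve_right h4.ne'
        linarith
      · have h1 := (hIII (γ s) (hγ s hs).1 (hγ s hs).2).2 (deriv γ s)
        exact (hextX _ (hγ s hs).1 (hγ s hs).2 _).1 (h1.1 (hasy s hs).2)
    · rintro ⟨hreg, i, hi⟩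
      refine ⟨hreg, fun s hs => ⟨(hIII _ (hγ s hs).1 (hγ s hs).2).1, ?_⟩⟩
      rw [(hIII _ (hγ s hs).1 (hγ s hs).2).2, hextX _ (hγ s hs).1 (hγ s hs).2]
      exact ⟨i, hi s hs⟩
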